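/- Let $G$ be an $n$-player normal-form game with finite action sets $\mathcal A_i$ and utility functions $u_i:\prod_j\mathcal A_j\to\mathbb R$; extend $u_i$ to profiles of independent mixed strategies $s_j\in\Delta(\mathcal A_j)$ by taking expectations. In the uncorrelated program game of $G$, each player $i$ submits a deterministic program $p_i$, which receives the other players' programs $p_{-i}$ (and its own source code) and an i.i.d. $U[0,1]$ sequence $(r^i_m)_{m\ge 0}$ (the sequences of different players being independent) and outputs an action in $\mathcal A_i$; programs may use real constants and exact real arithmetic and comparisons, and may run any program on any arguments. A profile $p_{1:n}$ of programs is a program equilibrium if the programs almost surely halt against each other and no player $i$ can obtain a higher expected utility by replacing $p_i$ with a program $p_i'$ such that $p_i',p_{-i}$ still almost surely halt against each other. For $\epsilon>0$ and a computable policy $\pi_i$, the uncorrelated $\epsilon$Grounded$\pi_i$Bot is the program which, on input $p_{-i},(r_m)_{m\ge0}$, finds $T=\min\{t: r_t<\epsilon\}$, computes $a_j^t=\mathit{apply}(p_j,(p_{-j},(r_m)_{m\ge T+1-t}))$ for $t=1,\dots,T$ and $j=1,\dots,n$ (where $\mathit{apply}$ runs a program on the given arguments), and outputs $\pi_i(a^{1},\dots,a^{T};r_0,\dots,r_T)$.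 Suppose that the payoffs $v_{1:n}$ are feasible without correlation, i.e. $v_i=u_i(s_1,\dots,s_n)$ for all $i$, for some strategies $s_j\in\Delta(\mathcal A_j)$. Suppose further that for each $i$ there is some $\lambda>0$ with $$v_i\;\ge\;\min_{(S_j':\mathcal A_i\to\Delta(\mathcal A_j))_{j\ne i}}\;\max_{q\in[0,1],\;s_i'\in\Delta(\mathcal A_i)}\Big[u_i\Big((1-q)s_i+qs_i',\;\big((1-q)s_j+q\,S_j'\bullet s_i'\big)_{j\ne i}\Big)+\lambda q\Big],$$ where $S_j'\bullet s_i'=\sum_{a}s_i'(a)S_j'(a)$. Then there exist $\epsilon\in(0,1)$ and computable policies $\pi_1,\dots,\pi_n$ such that the uncorrelated $\epsilon$Grounded$\pi_i$Bots, $i=1,\dots,n$, form a program equilibrium in which each player $i$ has expected utility $v_i$. -/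

import Mathlib

open MeasureTheory

/-! ## Normal-form games -/

/-- Expected utility when the players act independently, player `j` following `σ j`. -/
def mixedUtility {n : ℕ} {A : Fin n → Type*} [∀ j, Fintype (A j)]
    (w : (∀ j, A j) → ℝ) (σ : ∀ j, A j → ℝ) : ℝ :=
  ∑ a : ∀ j, A j, (∏ j, σ j (a j)) * w a

/-- The strategies that result when player `i`, who should follow `s i`, deviates with
probability `q` to `s'`, and every other player `j` then punishes the deviation action
according to `S j`: player `i` plays `(1 - q) s_i + q s'`, and player `j ≠ i` plays
`(1 - q) s_j + q ∑ a, s'(a) S_j(a)`. -/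
def punishedProfile {n : ℕ} {A : Fin n → Type*} [∀ j, Fintype (A j)]
    (s : ∀ j, stdSimplex ℝ (A j)) (i : Fin n)
    (S : ∀ j : {j : Fin n // j ≠ i}, A i → stdSimplex ℝ (A j))
    (q : ℝ) (s' : stdSimplex ℝ (A i)) : ∀ j, A j → ℝ :=
  fun j =>
    if h : j = i then
      fun b => (1 - q) * (s j).1 b + q * s'.1 (h ▸ b)
    else
      fun b => (1 - q) * (s j).1 b + q * ∑ a, s'.1 a * (S ⟨j, h⟩ a).1 b

/-! ## The programming language

A small Lisp over the real numbers (a real-number machine with exact arithmetic and comparison,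
and with real constants).  Programs and data are the same kind of object, so programs can read,
build and run source code.  A program is run on an input and has access to a sequence of reals. -/

/-- The symbols of the language. -/
inductive Op : Type
  | input | nil | quote | fst | snd | cons | kind | eq | lt | add | sub | mul | div
  | ite | bind | loop | rand | apply

/-- Expressions: real numbers, symbols, and pairs. -/
inductive Tm : Type
  | num (x : ℝ) : Tm
  | sym (o : Op) : Tm
  | pair (a b : Tm) : Tm

namespace Tm

/-- The empty list. -/
def nil : Tm := sym .nil

/-- Truth values as numbers. -/
noncomputable def ofProp (P : Prop) [Decidable P] : Tm := num (if P then 1 else 0)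

/-- Lists as data. -/
def list : List Tm → Tm
  | [] => nil
  | a :: l => pair a (list l)

/-- Binary operations on numbers. -/
def onNums (f : ℝ → ℝ → Option Tm) : Tm → Tm → Option Tm
  | num y, num z => f y z
  | _, _ => none

/-- The first component of a pair. -/
def left : Tm → Option Tm
  | pair a _ => some a
  | _ => none

/-- The second component of a pair. -/
def right : Tm → Option Tm
  | pair _ b => some b
  | _ => none

/-- `0` for numbers, `1` for symbols, `2` for pairs. -/
noncomputable def kindOf : Tm → Tm
  | num _ => num 0
  | sym _ => num 1
  | pair _ _ => num 2

/-- The real number that an expression is, if it is one. -/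
def toReal : Tm → Option ℝ
  | num y => some y
  | _ => none

/-- Read the entry of a sequence at an index that must be a natural number. -/
noncomputable def readSeq (ρ : ℕ → Option ℝ) : Tm → Option Tm
  | num y => if (⌊y⌋₊ : ℝ) = y then (ρ ⌊y⌋₊).map num else none
  | _ => none

open Classical in
/-- `eval k ρ e x` is the result of running the program `e` on input `x` with access to the
sequence `ρ`, or `none` if there is no result within `k` nested evaluation steps.  (Entries of the
sequence are allowed to be undefined, since a program may supply a simulated program with a
sequence that it computes on demand.)

* a number evaluates to itself, `input` to the input, `(quote . v)` to `v`;
* `(bind e . f)` runs `f` with the value of `e` as its input;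
* `(ite c a . b)` is a conditional, `0` being false;
* `(loop c b . e)` starts with the value of `e` and, as long as `c` is not false on the current
  value, replaces that value by the result of `b` on it;
* `(rand . e)` reads the entry of the sequence with index the value of `e`;
* `(apply e d . g)` runs the program that is the value of `e` on the input that is the value of
  `d`, giving it the sequence whose `m`-th entry is computed by the program that is the value
  of `g`, from input `m` and the present sequence. -/
noncomputable def eval : ℕ → (ℕ → Option ℝ) → Tm → Tm → Option Tm
  | 0, _, _, _ => none
  | _ + 1, _, num c, _ => some (num c)
  | _ + 1, _, sym .input, x => some x
  | _ + 1, _, pair (sym .quote) v, _ => some v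
  | k + 1, ρ, pair (sym .fst) e, x => (eval k ρ e x).bind left
  | k + 1, ρ, pair (sym .snd) e, x => (eval k ρ e x).bind right
  | k + 1, ρ, pair (sym .cons) (pair e f), x =>
      (eval k ρ e x).bind fun v => (eval k ρ f x).bind fun w => some (pair v w)
  | k + 1, ρ, pair (sym .kind) e, x => (eval k ρ e x).bind fun v => some (kindOf v)
  | k + 1, ρ, pair (sym .eq) (pair e f), x =>
      (eval k ρ e x).bind fun v => (eval k ρ f x).bind fun w => some (ofProp (v = w))
  | k + 1, ρ, pair (sym .lt) (pair e f), x =>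
      (eval k ρ e x).bind fun v => (eval k ρ f x).bind fun w =>
        onNums (fun y z => some (ofProp (y < z))) v w
  | k + 1, ρ, pair (sym .add) (pair e f), x =>
      (eval k ρ e x).bind fun v => (eval k ρ f x).bind fun w =>
        onNums (fun y z => some (num (y + z))) v w
  | k + 1, ρ, pair (sym .sub) (pair e f), x =>
      (eval k ρ e x).bind fun v => (eval k ρ f x).bind fun w =>
        onNums (fun y z => some (num (y - z))) v w
  | k + 1, ρ, pair (sym .mul) (pair e f), x =>
      (eval k ρ e x).bind fun v => (eval k ρ f x).bind fun w =>
        onNums (fun y z => some (num (y * z))) v w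
  | k + 1, ρ, pair (sym .div) (pair e f), x =>
      (eval k ρ e x).bind fun v => (eval k ρ f x).bind fun w =>
        onNums (fun y z => if z = 0 then none else some (num (y / z))) v w
  | k + 1, ρ, pair (sym .ite) (pair c (pair e f)), x =>
      (eval k ρ c x).bind fun t => if t = num 0 then eval k ρ f x else eval k ρ e x
  | k + 1, ρ, pair (sym .bind) (pair e f), x => (eval k ρ e x).bind fun v => eval k ρ f v
  | k + 1, ρ, pair (sym .loop) (pair c (pair b e)), x =>
      (eval k ρ e x).bind fun v => (eval k ρ c v).bind fun t =>
        if t = num 0 then some v else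
          (eval k ρ b v).bind fun v' =>
            eval k ρ (pair (sym .loop) (pair c (pair b (pair (sym .quote) v')))) x
  | k + 1, ρ, pair (sym .rand) e, x => (eval k ρ e x).bind (readSeq ρ)
  | k + 1, ρ, pair (sym .apply) (pair e (pair d g)), x =>
      (eval k ρ e x).bind fun p => (eval k ρ d x).bind fun y => (eval k ρ g x).bind fun h =>
        eval k (fun m => (eval k ρ h (num m)).bind toReal) p y
  | _ + 1, _, _, _ => none

/-- Running `p` on input `x` and the sequence `ρ` halts with output `v`. -/
def HaltsWith (p x : Tm) (ρ : ℕ → Option ℝ) (v : Tm) : Prop := ∃ k, eval k ρ p x = some v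

/-! Notation for building programs. -/

def inp : Tm := sym .input
def mkQuote (v : Tm) : Tm := pair (sym .quote) v
def mkFst (e : Tm) : Tm := pair (sym .fst) e
def mkSnd (e : Tm) : Tm := pair (sym .snd) e
def mkCons (e f : Tm) : Tm := pair (sym .cons) (pair e f)
def mkLt (e f : Tm) : Tm := pair (sym .lt) (pair e f)
def mkAdd (e f : Tm) : Tm := pair (sym .add) (pair e f)
def mkSub (e f : Tm) : Tm := pair (sym .sub) (pair e f)
def mkIte (c e f : Tm) : Tm := pair (sym .ite) (pair c (pair e f))
def mkBind (e f : Tm) : Tm := pair (sym .bind) (pair e f)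
def mkLoop (c b e : Tm) : Tm := pair (sym .loop) (pair c (pair b e))
def mkRand (e : Tm) : Tm := pair (sym .rand) e
def mkApply (e d g : Tm) : Tm := pair (sym .apply) (pair e (pair d g))

/-- The program computing the list of the values of the given programs. -/
def mkList : List Tm → Tm
  | [] => mkQuote nil
  | e :: l => mkCons e (mkList l)

/-- The program extracting entry `j` of the list computed by `e`. -/
def mkNth : ℕ → Tm → Tm
  | 0, e => mkFst e
  | j + 1, e => mkNth j (mkSnd e)

/-- A program whose value is the source code `(rand . (add input . k))`, where `k` is the value
of `e`; as an argument of `apply`, it passes on the present sequence without its first `k`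
entries. -/
def mkShift (e : Tm) : Tm :=
  mkCons (mkQuote (sym .rand)) (mkCons (mkQuote (sym .add)) (mkCons (mkQuote inp) e))

end Tm

open Tm

/-! ## Uncorrelated program games -/

/-- An action as data: its number in an enumeration of the action set. -/
noncomputable def actionTm {α : Type*} [Fintype α] (a : α) : Tm :=
  num ((Fintype.equivFin α a : ℕ) : ℝ)

/-- The input of program `i` besides its random sequence: all programs in order, together with its
own position among them.  That is, the programs of the opponents and its own source code. -/
def programInput {n : ℕ} (p : Fin n → Tm) (i : Fin n) : Tm :=
  pair (num ((i : ℕ) : ℝ)) (list (List.ofFn p))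

/-- With random sequence `r`, program `i` of the profile `p` halts and outputs the action `a`. -/
def Plays {n : ℕ} {A : Fin n → Type*} [∀ j, Fintype (A j)]
    (p : Fin n → Tm) (i : Fin n) (r : ℕ → unitInterval) (a : A i) : Prop :=
  HaltsWith (p i) (programInput p i) (fun m => some (r m : ℝ)) (actionTm a)

/-- The law of the random sequences: one i.i.d. `U[0,1]` sequence for every player, independent
of each other. -/
noncomputable def randomness (n : ℕ) : Measure (Fin n → ℕ → unitInterval) :=
  Measure.pi fun _ => Measure.infinitePi fun _ => (volume : Measure unitInterval)

/-- The programs almost surely halt against each other (and output actions). -/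
def HaltAgainst {n : ℕ} (A : Fin n → Type*) [∀ j, Fintype (A j)] (p : Fin n → Tm) : Prop :=
  ∀ᵐ r ∂randomness n, ∀ i, ∃ a : A i, Plays p i (r i) a

/-- The probability of the outcome `a`. -/
noncomputable def outcomeProb {n : ℕ} {A : Fin n → Type*} [∀ j, Fintype (A j)]
    (p : Fin n → Tm) (a : ∀ j, A j) : ℝ :=
  (randomness n).real {r | ∀ i, Plays p i (r i) (a i)}

/-- The expected utility of player `i` in the uncorrelated program game. -/
noncomputable def programUtility {n : ℕ} {A : Fin n → Type*} [∀ j, Fintype (A j)]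
    (u : Fin n → (∀ j, A j) → ℝ) (p : Fin n → Tm) (i : Fin n) : ℝ :=
  ∑ a : ∀ j, A j, outcomeProb p a * u i a

/-- Program equilibrium: the programs almost surely halt against each other, and each is a best
response among all programs for which this remains so. -/
def IsProgramEquilibrium {n : ℕ} {A : Fin n → Type*} [∀ j, Fintype (A j)]
    (u : Fin n → (∀ j, A j) → ℝ) (p : Fin n → Tm) : Prop :=
  HaltAgainst A p ∧
    ∀ (i : Fin n) (p' : Tm), HaltAgainst A (Function.update p i p') →
      programUtility u (Function.update p i p') i ≤ programUtility u p i

/-! ## Uncorrelated `ε`-grounded `π`-bots -/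

/-- A policy of player `i`: from the action history `a^1, …, a^t` and `r_0, …, r_t`, an action. -/
abbrev Policy {n : ℕ} (A : Fin n → Type*) (i : Fin n) : Type _ :=
  List (∀ j, A j) → List ℝ → A i

/-- An action history as data, in chronological order. -/
noncomputable def historyTm {n : ℕ} {A : Fin n → Type*} [∀ j, Fintype (A j)]
    (h : List (∀ j, A j)) : Tm :=
  list (h.map fun a => list (List.ofFn fun j => actionTm (a j)))

/-- The program `c` computes the policy `π`, whatever sequence it is run with. -/
def Computes {n : ℕ} {A : Fin n → Type*} [∀ j, Fintype (A j)] {i : Fin n}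
    (c : Tm) (π : Policy A i) : Prop :=
  ∀ (ρ : ℕ → Option ℝ) (h : List (∀ j, A j)) (r : List ℝ),
    r.length = h.length + 1 → (∀ x ∈ r, x ∈ Set.Icc (0 : ℝ) 1) →
      HaltsWith c (pair (historyTm h) (list (r.map num))) ρ (actionTm (π h r))

/-- Computes `T`, the least `t` with `r_t < ε`. -/
noncomputable def findTime (ε : ℝ) : Tm :=
  mkLoop (mkIte (mkLt (mkRand inp) (num ε)) (num 0) (num 1)) (mkAdd inp (num 1)) (num 0)

/-- On input `(k . (T . (P . h)))`, where `P` is the list of the `n` programs: the list of the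
outputs of `apply(p_j, (p_{-j}, (r_m)_{m ≥ k + 1}))` for all players `j`. -/
noncomputable def simulateAll (n : ℕ) : Tm :=
  mkList (List.ofFn fun j : Fin n =>
    mkApply (mkNth j (mkFst (mkSnd (mkSnd inp))))
      (mkCons (num ((j : ℕ) : ℝ)) (mkFst (mkSnd (mkSnd inp))))
      (mkShift (mkAdd (mkFst inp) (num 1))))

/-- On input `(T . P)`: the list `a^1, …, a^T`, where `a_j^t` is the output of
`apply(p_j, (p_{-j}, (r_m)_{m ≥ T + 1 - t}))`.  It is built from its end, `t = T, …, 1`. -/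
noncomputable def simulatedHistory (n : ℕ) : Tm :=
  mkSnd (mkSnd (mkSnd (mkLoop
    (mkLt (mkFst inp) (mkFst (mkSnd inp)))
    (mkCons (mkAdd (mkFst inp) (num 1)) (mkCons (mkFst (mkSnd inp))
      (mkCons (mkFst (mkSnd (mkSnd inp))) (mkCons (simulateAll n) (mkSnd (mkSnd (mkSnd inp)))))))
    (mkCons (num 0) (mkCons (mkFst inp) (mkCons (mkSnd inp) (mkQuote nil)))))))

/-- On input `(T . P)`: the list `r_0, …, r_T`. -/
noncomputable def randomPrefix : Tm :=
  mkSnd (mkLoop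
    (mkLt (num 0) (mkFst inp))
    (mkCons (mkSub (mkFst inp) (num 1))
      (mkCons (mkRand (mkSub (mkFst inp) (num 1))) (mkSnd inp)))
    (mkCons (mkAdd (mkFst inp) (num 1)) (mkQuote nil)))

/-- The uncorrelated `ε`-grounded `π`-bot in an `n`-player game, where `c` computes `π`: let `T` be
the least `t` with `r_t < ε`, simulate all programs `p_j` (itself included) on `p_{-j}` and
`(r_m)_{m ≥ T + 1 - t}` for `t = 1, …, T`, and apply `π` to the resulting history and
`r_0, …, r_T`. -/
noncomputable def groundedBot (n : ℕ) (ε : ℝ) (c : Tm) : Tm :=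
  mkBind (mkCons (findTime ε) (mkSnd inp))
    (mkBind (mkCons (simulatedHistory n) randomPrefix) c)

namespace Tm

/-! ## Fuel monotonicity -/

theorem bind_mono {α β : Type*} {a a' : Option α} {f f' : α → Option β} {v : β}
    (h : a.bind f = some v) (ha : ∀ y, a = some y → a' = some y)
    (hf : ∀ y, f y = some v → f' y = some v) : a'.bind f' = some v := by
  obtain ⟨y, hy, hv⟩ := Option.bind_eq_some_iff.1 h
  exact Option.bind_eq_some_iff.2 ⟨y, ha y hy, hf y hv⟩

theorem readSeq_mono {ρ ρ' : ℕ → Option ℝ} (hρ : ∀ m y, ρ m = some y → ρ' m = some y)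
    {t v : Tm} (h : readSeq ρ t = some v) : readSeq ρ' t = some v := by
  cases t with
  | num y =>
    simp only [readSeq] at h ⊢
    split_ifs at h ⊢
    obtain ⟨z, hz, hv⟩ := Option.map_eq_some_iff.1 h
    exact Option.map_eq_some_iff.2 ⟨z, hρ _ _ hz, hv⟩
  | sym o => exact h
  | pair a b => exact h

theorem eval_mono {k : ℕ} : ∀ {k' : ℕ} {ρ ρ' : ℕ → Option ℝ} {e x v : Tm}, k ≤ k' →
    (∀ m y, ρ m = some y → ρ' m = some y) → eval k ρ e x = some v → eval k' ρ' e x = some v := by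
  induction k with
  | zero => intro k' ρ ρ' e x v _ _ h; simp [eval] at h
  | succ k ih =>
    intro k' ρ ρ' e x v hk hρ h
    obtain ⟨k', rfl⟩ : ∃ l, k' = l + 1 := ⟨k' - 1, by omega⟩
    have hk' : k ≤ k' := by omega
    have ih' : ∀ {e x v : Tm}, eval k ρ e x = some v → eval k' ρ' e x = some v :=
      fun h => ih hk' hρ h
    have un : ∀ {e x v : Tm} {f : Tm → Option Tm}, (eval k ρ e x).bind f = some v →
        (eval k' ρ' e x).bind f = some v :=
      fun h => bind_mono h (fun _ => ih') (fun _ => id)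
    have bin : ∀ {e e' x v : Tm} {f : Tm → Tm → Option Tm},
        ((eval k ρ e x).bind fun y => (eval k ρ e' x).bind fun z => f y z) = some v →
        ((eval k' ρ' e x).bind fun y => (eval k' ρ' e' x).bind fun z => f y z) = some v :=
      fun h => bind_mono h (fun _ => ih') (fun _ h => un h)
    match e, h with
    | num c, h => exact h
    | sym .input, h => exact h
    | pair (sym .quote) w, h => exact h
    | pair (sym .fst) e, h => exact un h
    | pair (sym .snd) e, h => exact un h
    | pair (sym .cons) (pair e f), h => exact bin h
    | pair (sym .kind) e, h => exact un h
    | pair (sym .eq) (pair e f), h => exact bin h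
    | pair (sym .lt) (pair e f), h => exact bin h
    | pair (sym .add) (pair e f), h => exact bin h
    | pair (sym .sub) (pair e f), h => exact bin h
    | pair (sym .mul) (pair e f), h => exact bin h
    | pair (sym .div) (pair e f), h => exact bin h
    | pair (sym .ite) (pair c (pair e f)), h =>
      refine bind_mono h (fun _ => ih') fun y hy => ?_
      beta_reduce at hy ⊢
      split_ifs at hy ⊢ <;> exact ih' hy
    | pair (sym .bind) (pair e f), h => exact bind_mono h (fun _ => ih') fun _ => ih'
    | pair (sym .loop) (pair c (pair b e)), h =>
      refine bind_mono h (fun _ => ih') fun y hy => bind_mono hy (fun _ => ih') fun z hz => ?_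
      beta_reduce at hz ⊢
      split_ifs at hz ⊢
      · exact hz
      · exact bind_mono hz (fun _ => ih') fun _ => ih'
    | pair (sym .rand) e, h => exact bind_mono h (fun _ => ih') fun _ => readSeq_mono hρ
    | pair (sym .apply) (pair e (pair d g)), h =>
      refine bind_mono h (fun _ => ih') fun p hp => bind_mono hp (fun _ => ih') fun y hy =>
        bind_mono hy (fun _ => ih') fun g hg => ih hk' (fun m z hz => ?_) hg
      exact bind_mono hz (fun _ => ih') fun _ => id

theorem HaltsWith.unique {p x v w : Tm} {ρ : ℕ → Option ℝ} (hv : HaltsWith p x ρ v)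
    (hw : HaltsWith p x ρ w) : v = w := by
  obtain ⟨k, hk⟩ := hv
  obtain ⟨l, hl⟩ := hw
  have h₁ := eval_mono (le_max_left k l) (fun _ _ => id) hk
  have h₂ := eval_mono (le_max_right k l) (fun _ _ => id) hl
  exact Option.some_injective _ (h₁.symm.trans h₂)

/-! ## Evaluation rules -/

section Rules
variable {ρ : ℕ → Option ℝ} {e f g x v w : Tm}

theorem HaltsWith.up {k : ℕ} (h : eval k ρ e x = some v) {l : ℕ} (hl : k ≤ l) :
    eval l ρ e x = some v := eval_mono hl (fun _ _ => id) h

theorem halts_num (c : ℝ) : HaltsWith (num c) x ρ (num c) := ⟨1, rfl⟩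

theorem halts_inp : HaltsWith inp x ρ x := ⟨1, rfl⟩

theorem halts_quote : HaltsWith (mkQuote v) x ρ v := ⟨1, rfl⟩

theorem HaltsWith.unary {o : Tm} {F : Tm → Option Tm}
    (ho : ∀ k, eval (k + 1) ρ (pair o e) x = (eval k ρ e x).bind F)
    (he : HaltsWith e x ρ v) (hF : F v = some w) : HaltsWith (pair o e) x ρ w := by
  obtain ⟨k, hk⟩ := he
  exact ⟨k + 1, by rw [ho, hk]; exact hF⟩

theorem HaltsWith.binary {o u : Tm} {F : Tm → Tm → Option Tm}
    (ho : ∀ k, eval (k + 1) ρ (pair o (pair e f)) x =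
      (eval k ρ e x).bind fun v => (eval k ρ f x).bind fun w => F v w)
    (he : HaltsWith e x ρ v) (hf : HaltsWith f x ρ w) (hF : F v w = some u) :
    HaltsWith (pair o (pair e f)) x ρ u := by
  obtain ⟨k, hk⟩ := he
  obtain ⟨l, hl⟩ := hf
  exact ⟨max k l + 1, by
    rw [ho, HaltsWith.up hk (le_max_left k l), HaltsWith.up hl (le_max_right k l)]; exact hF⟩

theorem HaltsWith.fst (h : HaltsWith e x ρ (pair v w)) : HaltsWith (mkFst e) x ρ v :=
  h.unary (fun _ => rfl) rfl

theorem HaltsWith.snd (h : HaltsWith e x ρ (pair v w)) : HaltsWith (mkSnd e) x ρ w :=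
  h.unary (fun _ => rfl) rfl

theorem HaltsWith.cons (he : HaltsWith e x ρ v) (hf : HaltsWith f x ρ w) :
    HaltsWith (mkCons e f) x ρ (pair v w) :=
  he.binary (fun _ => rfl) hf rfl

open Classical in
theorem HaltsWith.eq (he : HaltsWith e x ρ v) (hf : HaltsWith f x ρ w) :
    HaltsWith (pair (sym .eq) (pair e f)) x ρ (ofProp (v = w)) :=
  he.binary (fun _ => rfl) hf rfl

open Classical in
theorem HaltsWith.lt {y z : ℝ} (he : HaltsWith e x ρ (num y)) (hf : HaltsWith f x ρ (num z)) :
    HaltsWith (mkLt e f) x ρ (ofProp (y < z)) :=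
  he.binary (F := fun v w => onNums (fun y z => some (ofProp (y < z))) v w) (fun _ => rfl) hf rfl

theorem HaltsWith.add {y z : ℝ} (he : HaltsWith e x ρ (num y)) (hf : HaltsWith f x ρ (num z)) :
    HaltsWith (mkAdd e f) x ρ (num (y + z)) :=
  he.binary (F := fun v w => onNums (fun y z => some (num (y + z))) v w) (fun _ => rfl) hf rfl

theorem HaltsWith.sub {y z : ℝ} (he : HaltsWith e x ρ (num y)) (hf : HaltsWith f x ρ (num z)) :
    HaltsWith (mkSub e f) x ρ (num (y - z)) :=
  he.binary (F := fun v w => onNums (fun y z => some (num (y - z))) v w) (fun _ => rfl) hf rfl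

theorem HaltsWith.mul {y z : ℝ} (he : HaltsWith e x ρ (num y)) (hf : HaltsWith f x ρ (num z)) :
    HaltsWith (pair (sym .mul) (pair e f)) x ρ (num (y * z)) :=
  he.binary (F := fun v w => onNums (fun y z => some (num (y * z))) v w) (fun _ => rfl) hf rfl

theorem HaltsWith.bind (he : HaltsWith e x ρ v) (hf : HaltsWith f v ρ w) :
    HaltsWith (mkBind e f) x ρ w := by
  obtain ⟨k, hk⟩ := he
  obtain ⟨l, hl⟩ := hf
  refine ⟨max k l + 1, ?_⟩
  change (eval _ ρ e x).bind _ = _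
  rw [HaltsWith.up hk (le_max_left k l)]
  exact HaltsWith.up hl (le_max_right k l)

theorem HaltsWith.ite_zero (hc : HaltsWith g x ρ (num 0)) (hf : HaltsWith f x ρ w) :
    HaltsWith (mkIte g e f) x ρ w := by
  obtain ⟨k, hk⟩ := hc
  obtain ⟨l, hl⟩ := hf
  refine ⟨max k l + 1, ?_⟩
  change (eval _ ρ g x).bind _ = _
  rw [HaltsWith.up hk (le_max_left k l)]
  simpa using HaltsWith.up hl (le_max_right k l)

theorem HaltsWith.ite_ne {t : Tm} (hc : HaltsWith g x ρ t) (ht : t ≠ num 0)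
    (he : HaltsWith e x ρ w) : HaltsWith (mkIte g e f) x ρ w := by
  obtain ⟨k, hk⟩ := hc
  obtain ⟨l, hl⟩ := he
  refine ⟨max k l + 1, ?_⟩
  change (eval _ ρ g x).bind _ = _
  rw [HaltsWith.up hk (le_max_left k l)]
  simpa [ht] using HaltsWith.up hl (le_max_right k l)

theorem HaltsWith.ite {P : Prop} [Decidable P] (hc : HaltsWith g x ρ (ofProp P))
    (he : P → HaltsWith e x ρ w) (hf : ¬ P → HaltsWith f x ρ w) :
    HaltsWith (mkIte g e f) x ρ w := by
  by_cases h : P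
  · exact hc.ite_ne (by simp [ofProp, h]) (he h)
  · exact HaltsWith.ite_zero (by simpa [ofProp, h] using hc) (hf h)

theorem HaltsWith.loop_stop {c b : Tm} (he : HaltsWith e x ρ v) (hc : HaltsWith c v ρ (num 0)) :
    HaltsWith (mkLoop c b e) x ρ v := by
  obtain ⟨k, hk⟩ := he
  obtain ⟨l, hl⟩ := hc
  refine ⟨max k l + 1, ?_⟩
  change (eval _ ρ e x).bind _ = _
  rw [HaltsWith.up hk (le_max_left k l)]
  change (eval _ ρ c v).bind _ = _
  rw [HaltsWith.up hl (le_max_right k l)]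
  simp

open Classical in
theorem HaltsWith.loop_step {c b t : Tm} (he : HaltsWith e x ρ v) (hc : HaltsWith c v ρ t)
    (ht : t ≠ num 0) (hb : HaltsWith b v ρ w) {u : Tm}
    (hl : HaltsWith (mkLoop c b (mkQuote w)) x ρ u) : HaltsWith (mkLoop c b e) x ρ u := by
  obtain ⟨k₁, h₁⟩ := he
  obtain ⟨k₂, h₂⟩ := hc
  obtain ⟨k₃, h₃⟩ := hb
  obtain ⟨k₄, h₄⟩ := hl
  refine ⟨k₁ + k₂ + k₃ + k₄ + 1, ?_⟩
  change (eval _ ρ e x).bind _ = _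
  rw [HaltsWith.up h₁ (by omega)]
  change (eval _ ρ c v).bind _ = _
  rw [HaltsWith.up h₂ (by omega)]
  change (if t = num 0 then some v else _) = _
  rw [if_neg ht, HaltsWith.up h₃ (by omega)]
  exact HaltsWith.up h₄ (by omega)

/-- A loop runs through the states `z 0, …, z N`. -/
theorem HaltsWith.loop {c b : Tm} (z : ℕ → Tm) (N : ℕ) (he : HaltsWith e x ρ (z 0))
    (hc : ∀ m < N, ∃ t ≠ num 0, HaltsWith c (z m) ρ t)
    (hb : ∀ m < N, HaltsWith b (z m) ρ (z (m + 1)))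
    (hN : HaltsWith c (z N) ρ (num 0)) : HaltsWith (mkLoop c b e) x ρ (z N) := by
  induction N generalizing z e with
  | zero => exact he.loop_stop hN
  | succ N ih =>
    obtain ⟨t, ht, hct⟩ := hc 0 N.succ_pos
    refine he.loop_step hct ht (hb 0 N.succ_pos) ?_
    exact ih (fun m => z (m + 1)) halts_quote (fun m hm => hc _ (by omega))
      (fun m hm => hb _ (by omega)) hN

theorem HaltsWith.rand {m : ℕ} {y : ℝ} (he : HaltsWith e x ρ (num m)) (hy : ρ m = some y) :
    HaltsWith (mkRand e) x ρ (num y) :=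
  he.unary (fun _ => rfl) (by simp [readSeq, hy])

/-- Running a program on a shifted sequence. -/
theorem HaltsWith.apply_shift {d g p y : Tm} {m : ℕ} (he : HaltsWith e x ρ p)
    (hd : HaltsWith d x ρ y) (hg : HaltsWith g x ρ (num m))
    (hp : HaltsWith p y (fun l => ρ (l + m)) w) : HaltsWith (mkApply e d (mkShift g)) x ρ w := by
  have hs : HaltsWith (mkShift g) x ρ (mkRand (mkAdd inp (num m))) :=
    HaltsWith.cons halts_quote (HaltsWith.cons halts_quote (HaltsWith.cons halts_quote hg))
  obtain ⟨k₁, h₁⟩ := he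
  obtain ⟨k₂, h₂⟩ := hd
  obtain ⟨k₃, h₃⟩ := hs
  obtain ⟨k₄, h₄⟩ := hp
  refine ⟨k₁ + k₂ + k₃ + k₄ + 3 + 1, ?_⟩
  change (eval _ ρ e x).bind _ = _
  rw [HaltsWith.up h₁ (by omega)]
  change (eval _ ρ d x).bind _ = _
  rw [HaltsWith.up h₂ (by omega)]
  change (eval _ ρ (mkShift g) x).bind _ = _
  rw [HaltsWith.up h₃ (by omega)]
  refine eval_mono (by omega) (fun l z hz => ?_) h₄
  have h₅ : eval 3 ρ (mkRand (mkAdd inp (num m))) (num l) = some (num z) := by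
    change (readSeq ρ (num ((l : ℝ) + m))) = _
    have hlm : ((l : ℝ) + m) = ((l + m : ℕ) : ℝ) := by push_cast; ring
    rw [hlm]
    simp only [readSeq, Nat.floor_natCast]
    rw [if_pos trivial, hz]
    rfl
  rw [HaltsWith.up h₅ (by omega)]
  rfl

end Rules

end Tm

namespace Tm

theorem ofProp_true {P : Prop} [Decidable P] (h : P) : ofProp P = num 1 := by simp [ofProp, h]

theorem ofProp_false {P : Prop} [Decidable P] (h : ¬ P) : ofProp P = num 0 := by simp [ofProp, h]

section Lists
variable {ρ : ℕ → Option ℝ} {x : Tm}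

theorem HaltsWith.nth {l : List Tm} {v e : Tm} {j : ℕ} (he : HaltsWith e x ρ (list l))
    (hj : l[j]? = some v) : HaltsWith (mkNth j e) x ρ v := by
  induction j generalizing l e with
  | zero =>
    cases l with
    | nil => simp at hj
    | cons a l =>
      obtain rfl : a = v := by simpa using hj
      exact he.fst
  | succ j ih =>
    cases l with
    | nil => simp at hj
    | cons a l => exact ih he.snd (by simpa using hj)

theorem HaltsWith.mkList {es vs : List Tm} (h : List.Forall₂ (fun e v => HaltsWith e x ρ v) es vs) :
    HaltsWith (mkList es) x ρ (list vs) := by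
  induction h with
  | nil => exact halts_quote
  | cons h _ ih => exact h.cons ih

theorem HaltsWith.mkList_ofFn {n : ℕ} {e v : Fin n → Tm} (h : ∀ j, HaltsWith (e j) x ρ (v j)) :
    HaltsWith (Tm.mkList (List.ofFn e)) x ρ (list (List.ofFn v)) :=
  HaltsWith.mkList (List.forall₂_iff_get.2 ⟨by simp, fun i h₁ h₂ => by simpa using h _⟩)

end Lists

end Tm

/-- The sequence of random numbers with its first `m` entries dropped. -/
def dropSeq (m : ℕ) (r : ℕ → unitInterval) : ℕ → unitInterval := fun l => r (l + m)

/-- The first time at which the sequence is below `ε` is `T`. -/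
def IsTime (ε : ℝ) (r : ℕ → unitInterval) (T : ℕ) : Prop :=
  (r T : ℝ) < ε ∧ ∀ m < T, ¬ (r m : ℝ) < ε

section Bot
variable {n : ℕ} {A : Fin n → Type*} [∀ j, Fintype (A j)] {ε : ℝ} {P : Fin n → Tm}
  {r : ℕ → unitInterval} {T : ℕ}

theorem findTime_halts (hT : IsTime ε r T) (x : Tm) :
    HaltsWith (findTime ε) x (fun m => some (r m : ℝ)) (num T) := by
  refine HaltsWith.loop (fun m => num m) T (by simpa using halts_num 0) (fun m hm => ?_)
    (fun m _ => ?_) ?_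
  · refine ⟨num 1, by simp, ?_⟩
    refine HaltsWith.ite ((HaltsWith.rand halts_inp rfl).lt (halts_num ε))
      (fun h => absurd h (hT.2 m hm)) (fun _ => halts_num 1)
  · simpa using halts_inp.add (halts_num 1)
  · exact HaltsWith.ite ((HaltsWith.rand halts_inp rfl).lt (halts_num ε))
      (fun _ => halts_num 0) (fun h => absurd hT.1 h)

theorem randomPrefix_halts (x : Tm) :
    HaltsWith randomPrefix (pair (num T) x) (fun m => some (r m : ℝ))
      (list ((List.range (T + 1)).map fun m => num (r m : ℝ))) := by
  have key := HaltsWith.loop (ρ := fun m => some (r m : ℝ)) (x := pair (num T) x)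
    (c := mkLt (num 0) (mkFst inp))
    (b := mkCons (mkSub (mkFst inp) (num 1))
      (mkCons (mkRand (mkSub (mkFst inp) (num 1))) (mkSnd inp)))
    (e := mkCons (mkAdd (mkFst inp) (num 1)) (mkQuote nil))
    (fun m => pair (num (((T + 1 - m : ℕ)) : ℝ))
      (list ((List.range' (T + 1 - m) m).map fun m => num (r m : ℝ)))) (T + 1)
    (by
      have := (halts_inp (x := pair (num T) x) (ρ := fun m => some (r m : ℝ))).fst.add (halts_num 1)
      simpa [list] using this.cons halts_quote)
    (fun m hm => ⟨num 1, by simp, by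
      have := (halts_num (x := pair (num (((T + 1 - m : ℕ)) : ℝ))
        (list ((List.range' (T + 1 - m) m).map fun m => num (r m : ℝ))))
        (ρ := fun m => some (r m : ℝ)) 0).lt halts_inp.fst
      rwa [ofProp_true (by exact_mod_cast Nat.sub_pos_of_lt hm)] at this⟩)
    (fun m hm => by
      have h₁ : T + 1 - m = (T + 1 - (m + 1)) + 1 := by omega
      have h₂ : (((T + 1 - m : ℕ)) : ℝ) - 1 = ((T + 1 - (m + 1) : ℕ) : ℝ) := by
        rw [h₁]; push_cast; ring
      have hs : HaltsWith (mkSub (mkFst inp) (num 1)) (pair (num (((T + 1 - m : ℕ)) : ℝ))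
        (list ((List.range' (T + 1 - m) m).map fun m => num (r m : ℝ))))
        (fun m => some (r m : ℝ)) (num ((T + 1 - (m + 1) : ℕ) : ℝ)) := by
        rw [← h₂]
        exact halts_inp.fst.sub (halts_num 1)
      have := hs.cons ((HaltsWith.rand hs rfl).cons halts_inp.snd)
      rw [List.range'_succ, List.map_cons, ← h₁]
      exact this)
    (by
      have := (halts_num (x := pair (num (((T + 1 - (T + 1) : ℕ)) : ℝ))
        (list ((List.range' (T + 1 - (T + 1)) (T + 1)).map fun m => num (r m : ℝ))))
        (ρ := fun m => some (r m : ℝ)) 0).lt halts_inp.fst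
      rwa [ofProp_false (by simp)] at this)
  simpa [randomPrefix, List.range_eq_range'] using key.snd

/-- The history that results from the profiles `act 1, …, act T` that are simulated on the
sequences without their first `1, …, T` entries. -/
def historyOf {α : Type*} (act : ℕ → α) (T : ℕ) : List α :=
  ((List.range T).map fun m => act (m + 1)).reverse

theorem historyOf_succ {α : Type*} (act : ℕ → α) (T : ℕ) :
    historyOf act (T + 1) = act (T + 1) :: historyOf act T := by
  simp [historyOf, List.range_succ]

theorem simulateAll_halts {m : ℕ} {a : ∀ j, A j} {y z : Tm}
    (h : ∀ j, Plays P j (dropSeq (m + 1) r) (a j)) :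
    HaltsWith (simulateAll n) (pair (num m) (pair y (pair (list (List.ofFn P)) z)))
      (fun m => some (r m : ℝ)) (list (List.ofFn fun j => actionTm (a j))) := by
  refine HaltsWith.mkList_ofFn fun j => ?_
  have hP : HaltsWith (mkFst (mkSnd (mkSnd inp)))
      (pair (num m) (pair y (pair (list (List.ofFn P)) z)))
      (fun m => some (r m : ℝ)) (list (List.ofFn P)) := halts_inp.snd.snd.fst
  refine HaltsWith.apply_shift (hP.nth (v := P j) (by simp)) ((halts_num _).cons hP) ?_ (h j)
  simpa using halts_inp.fst.add (halts_num 1)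

theorem simulatedHistory_halts {act : ℕ → ∀ j, A j}
    (h : ∀ m < T, ∀ j, Plays P j (dropSeq (m + 1) r) (act (m + 1) j)) :
    HaltsWith (simulatedHistory n) (pair (num T) (list (List.ofFn P))) (fun m => some (r m : ℝ))
      (historyTm (historyOf act T)) := by
  have key := HaltsWith.loop (ρ := fun m => some (r m : ℝ))
    (x := pair (num T) (list (List.ofFn P)))
    (c := mkLt (mkFst inp) (mkFst (mkSnd inp)))
    (b := mkCons (mkAdd (mkFst inp) (num 1)) (mkCons (mkFst (mkSnd inp))
      (mkCons (mkFst (mkSnd (mkSnd inp))) (mkCons (simulateAll n) (mkSnd (mkSnd (mkSnd inp)))))))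
    (e := mkCons (num 0) (mkCons (mkFst inp) (mkCons (mkSnd inp) (mkQuote nil))))
    (fun m => pair (num m) (pair (num T) (pair (list (List.ofFn P)) (historyTm (historyOf act m)))))
    T
    (by
      have := (halts_num (ρ := fun m => some (r m : ℝ))
        (x := pair (num T) (list (List.ofFn P))) 0).cons (halts_inp.fst.cons
        (halts_inp.snd.cons (halts_quote (v := nil))))
      simpa [historyOf, historyTm, list] using this)
    (fun m hm => ⟨num 1, by simp, by
      have := (halts_inp (ρ := fun m => some (r m : ℝ)) (x := pair (num m) (pair (num T)
        (pair (list (List.ofFn P)) (historyTm (historyOf act m)))))).fst.lt halts_inp.snd.fst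
      rwa [ofProp_true (by exact_mod_cast hm)] at this⟩)
    (fun m hm => by
      have h₁ : HaltsWith (mkAdd (mkFst inp) (num 1)) (pair (num m) (pair (num T)
          (pair (list (List.ofFn P)) (historyTm (historyOf act m)))))
          (fun m => some (r m : ℝ)) (num ((m + 1 : ℕ) : ℝ)) := by
        simpa using halts_inp.fst.add (halts_num 1)
      rw [historyOf_succ]
      exact h₁.cons (halts_inp.snd.fst.cons (halts_inp.snd.snd.fst.cons
        ((simulateAll_halts (h m hm)).cons halts_inp.snd.snd.snd))))
    (by
      have := (halts_inp (ρ := fun m => some (r m : ℝ)) (x := pair (num T) (pair (num T)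
        (pair (list (List.ofFn P)) (historyTm (historyOf act T)))))).fst.lt halts_inp.snd.fst
      rwa [ofProp_false (lt_irrefl _)] at this)
  exact key.snd.snd.snd

/-- What a grounded bot plays, given what the programs play on the later parts of the sequence. -/
theorem groundedBot_plays {i : Fin n} {c : Tm} {π : Policy A i} (hc : Computes c π)
    (hP : P i = groundedBot n ε c) (hT : IsTime ε r T) {act : ℕ → ∀ j, A j}
    (h : ∀ m < T, ∀ j, Plays P j (dropSeq (m + 1) r) (act (m + 1) j)) :
    Plays P i r (π (historyOf act T) ((List.range (T + 1)).map fun m => (r m : ℝ))) := by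
  unfold Plays
  rw [hP]
  refine HaltsWith.bind ((findTime_halts hT _).cons halts_inp.snd)
    (HaltsWith.bind ((simulatedHistory_halts h).cons (randomPrefix_halts _)) ?_)
  have := hc (fun m => some (r m : ℝ)) (historyOf act T)
    ((List.range (T + 1)).map fun m => (r m : ℝ)) (by simp [historyOf])
    (by simp only [List.mem_map]; rintro _ ⟨m, _, rfl⟩; exact (r m).2)
  simpa [Function.comp_def] using this

end Bot

namespace Tm

/-! ## Measurability of the evaluation -/

/-- A number for every symbol. -/
def opCode : Op → ℕ
  | .input => 0 | .nil => 1 | .quote => 2 | .fst => 3 | .snd => 4 | .cons => 5 | .kind => 6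
  | .eq => 7 | .lt => 8 | .add => 9 | .sub => 10 | .mul => 11 | .div => 12 | .ite => 13
  | .bind => 14 | .loop => 15 | .rand => 16 | .apply => 17

theorem opCode_injective : Function.Injective opCode := by
  intro a b h
  cases a <;> cases b <;> first | rfl | (simp [opCode] at h)

/-- The node of an expression at a given address. -/
def node : List Bool → Tm → ℝ × ℕ
  | [], num y => (y, 0)
  | [], pair _ _ => (0, 1)
  | [], sym o => (0, opCode o + 2)
  | b :: p, pair t u => node p (if b then u else t)
  | _ :: _, num _ => (0, 100)
  | _ :: _, sym _ => (0, 100)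

/-- The node of a possibly undefined expression at a given address. -/
def node? (p : List Bool) : Option Tm → ℝ × ℕ
  | some t => node p t
  | none => (0, 101)

theorem opCode_lt (o : Op) : opCode o < 50 := by cases o <;> simp [opCode]

theorem node_injective {t u : Tm} (h : ∀ p, node p t = node p u) : t = u := by
  induction t generalizing u with
  | num y =>
    have := h []
    cases u with
    | num z => simpa [node] using this
    | sym o => simp [node] at this
    | pair a b => simp [node] at this
  | sym o =>
    have := h []
    cases u with
    | num z => simp [node] at this
    | sym o' =>
      obtain rfl : o = o' := opCode_injective (by simpa [node] using this)
      rfl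
    | pair a b => simp [node] at this
  | pair a b iha ihb =>
    have := h []
    cases u with
    | num z => simp [node] at this
    | sym o' => simp [node] at this
    | pair c d =>
      rw [iha fun p => by simpa [node] using h (false :: p),
        ihb fun p => by simpa [node] using h (true :: p)]

/-- The first component, or the empty list. -/
def leftD (t : Tm) : Tm := (left t).getD nil

/-- The second component, or the empty list. -/
def rightD (t : Tm) : Tm := (right t).getD nil

section Measurability
variable {Ω : Type*} [MeasurableSpace Ω]

theorem measurable_ite_of {β : Type*} [MeasurableSpace β] {c : Ω → Prop} [DecidablePred c]
    (hc : MeasurableSet {ω | c ω}) {f g : Ω → β} (hf : Measurable f) (hg : Measurable g) :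
    Measurable fun ω => if c ω then f ω else g ω :=
  Measurable.ite hc hf hg

/-- Measurability of expression-valued functions. -/
def MeasTm (f : Ω → Tm) : Prop := ∀ p, Measurable fun ω => node p (f ω)

/-- Measurability of partially defined expression-valued functions. -/
def MeasTm? (F : Ω → Option Tm) : Prop := ∀ p, Measurable fun ω => node? p (F ω)

theorem MeasTm.some {f : Ω → Tm} (hf : MeasTm f) : MeasTm? fun ω => some (f ω) := hf

theorem measTm_const (t : Tm) : MeasTm fun _ : Ω => t := fun _ => measurable_const

theorem measTm?_none : MeasTm? fun _ : Ω => none := fun _ => measurable_const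

theorem MeasTm.ite {c : Ω → Prop} [DecidablePred c] (hc : MeasurableSet {ω | c ω}) {f g : Ω → Tm}
    (hf : MeasTm f) (hg : MeasTm g) : MeasTm fun ω => if c ω then f ω else g ω := by
  intro p
  simpa only [apply_ite (node p)] using measurable_ite_of hc (hf p) (hg p)

theorem MeasTm?.ite {c : Ω → Prop} [DecidablePred c] (hc : MeasurableSet {ω | c ω})
    {f g : Ω → Option Tm} (hf : MeasTm? f) (hg : MeasTm? g) :
    MeasTm? fun ω => if c ω then f ω else g ω := by
  intro p
  simpa only [apply_ite (node? p)] using measurable_ite_of hc (hf p) (hg p)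

theorem measurableSet_isNone {F : Ω → Option Tm} (hF : MeasTm? F) :
    MeasurableSet {ω | F ω = none} := by
  have : {ω | F ω = none} = (fun ω => (node? [] (F ω)).2) ⁻¹' {101} := by
    ext ω
    rcases h : F ω with _ | (_ | o | _)
    all_goals simp [h, node?, node]
    have := opCode_lt o
    omega
  rw [this]
  exact (hF []).snd (measurableSet_singleton _)

theorem MeasTm?.getD {F : Ω → Option Tm} (hF : MeasTm? F) (t : Tm) :
    MeasTm fun ω => (F ω).getD t := by
  classical
  intro p
  have := measurable_ite_of (measurableSet_isNone hF) (measurable_const (a := node p t)) (hF p)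
  convert this using 2 with ω
  beta_reduce
  rcases F ω with _ | u <;> simp [node?]

theorem MeasTm?.bind {F : Ω → Option Tm} {G : Ω → Tm → Option Tm} (hF : MeasTm? F)
    (hG : ∀ f : Ω → Tm, MeasTm f → MeasTm? fun ω => G ω (f ω)) :
    MeasTm? fun ω => (F ω).bind (G ω) := by
  classical
  have := MeasTm?.ite (measurableSet_isNone hF) measTm?_none (hG _ (hF.getD nil))
  convert this using 2 with ω
  rcases F ω with _ | u <;> simp

theorem MeasTm.pair {f g : Ω → Tm} (hf : MeasTm f) (hg : MeasTm g) :
    MeasTm fun ω => pair (f ω) (g ω) := by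
  intro p
  rcases p with _ | ⟨_ | _, p⟩
  · exact measurable_const
  · exact hf p
  · exact hg p

theorem measTm_num {y : Ω → ℝ} : MeasTm (fun ω => num (y ω)) ↔ Measurable y := by
  refine ⟨fun h => (h []).fst, fun h p => ?_⟩
  rcases p with _ | ⟨b, p⟩
  · exact h.prodMk measurable_const
  · exact measurable_const

theorem MeasTm.eq {f g : Ω → Tm} (hf : MeasTm f) (hg : MeasTm g) :
    MeasurableSet {ω | f ω = g ω} := by
  have : {ω | f ω = g ω} = ⋂ p, {ω | node p (f ω) = node p (g ω)} := by
    ext ω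
    simp only [Set.mem_ofPred_eq, Set.mem_iInter]
    exact ⟨fun h p => by rw [h], node_injective⟩
  rw [this]
  exact MeasurableSet.iInter fun p => measurableSet_eq_fun (hf p) (hg p)

theorem MeasTm?.eq_some {F : Ω → Option Tm} (hF : MeasTm? F) (v : Tm) :
    MeasurableSet {ω | F ω = Option.some v} := by
  have : {ω | F ω = Option.some v} = {ω | F ω = none}ᶜ ∩ {ω | (F ω).getD nil = v} := by
    ext ω
    rcases h : F ω with _ | u <;> simp [h]
  rw [this]
  exact (measurableSet_isNone hF).compl.inter ((hF.getD nil).eq (measTm_const v))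

theorem MeasTm.code {f : Ω → Tm} (hf : MeasTm f) (p : List Bool) (m : ℕ) :
    MeasurableSet {ω | (node p (f ω)).2 = m} := (hf p).snd (measurableSet_singleton m)

theorem isPair_iff {t : Tm} : (node [] t).2 = 1 ↔ ∃ a b, t = Tm.pair a b := by
  cases t <;> simp [node]

theorem isNum_iff {t : Tm} : (node [] t).2 = 0 ↔ ∃ y, t = num y := by
  cases t <;> simp [node]

theorem MeasTm.isPair {f : Ω → Tm} (hf : MeasTm f) : MeasurableSet {ω | ∃ a b, f ω = Tm.pair a b} := by
  simpa only [isPair_iff] using hf.code [] 1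

theorem MeasTm.isNum {f : Ω → Tm} (hf : MeasTm f) : MeasurableSet {ω | ∃ y, f ω = num y} := by
  simpa only [isNum_iff] using hf.code [] 0

theorem MeasTm.left {f : Ω → Tm} (hf : MeasTm f) : MeasTm? fun ω => left (f ω) := by
  classical
  intro p
  have := measurable_ite_of hf.isPair (hf (false :: p)) (measurable_const (a := ((0 : ℝ), 101)))
  convert this using 2 with ω
  beta_reduce
  rcases f ω with _ | _ | _ <;> simp [Tm.left, node?, node]

theorem MeasTm.right {f : Ω → Tm} (hf : MeasTm f) : MeasTm? fun ω => right (f ω) := by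
  classical
  intro p
  have := measurable_ite_of hf.isPair (hf (true :: p)) (measurable_const (a := ((0 : ℝ), 101)))
  convert this using 2 with ω
  beta_reduce
  rcases f ω with _ | _ | _ <;> simp [Tm.right, node?, node]

theorem MeasTm.leftD {f : Ω → Tm} (hf : MeasTm f) : MeasTm fun ω => leftD (f ω) :=
  hf.left.getD _

theorem MeasTm.rightD {f : Ω → Tm} (hf : MeasTm f) : MeasTm fun ω => rightD (f ω) :=
  hf.right.getD _

/-- The real number that an expression is, or `0`. -/
def real (t : Tm) : ℝ := (node [] t).1

theorem MeasTm.real {f : Ω → Tm} (hf : MeasTm f) : Measurable fun ω => real (f ω) := (hf []).fst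

theorem measTm_kindOf {f : Ω → Tm} (hf : MeasTm f) : MeasTm fun ω => kindOf (f ω) := by
  classical
  have := MeasTm.ite hf.isPair (measTm_const (num 2))
    (MeasTm.ite hf.isNum (measTm_const (num 0)) (measTm_const (num 1)))
  convert this using 2 with ω
  rcases f ω with _ | _ | _ <;> simp [kindOf]

theorem measTm_ofProp {c : Ω → Prop} [DecidablePred c] (hc : MeasurableSet {ω | c ω}) :
    MeasTm fun ω => ofProp (c ω) :=
  measTm_num.2 (Measurable.ite hc measurable_const measurable_const)

theorem MeasTm.onNums {F : ℝ → ℝ → Option Tm} {f g : Ω → Tm} (hf : MeasTm f) (hg : MeasTm g)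
    (hF : MeasTm? fun ω => F (Tm.real (f ω)) (Tm.real (g ω))) :
    MeasTm? fun ω => onNums F (f ω) (g ω) := by
  classical
  have := MeasTm?.ite hf.isNum (MeasTm?.ite hg.isNum hF measTm?_none) measTm?_none
  convert this using 2 with ω
  rcases f ω with _ | _ | _ <;> rcases g ω with _ | _ | _ <;> simp [Tm.onNums, Tm.real, node]

theorem MeasTm.readSeq {ρ : Ω → ℕ → Option ℝ} (hρ : ∀ m, MeasTm? fun ω => (ρ ω m).map num)
    {f : Ω → Tm} (hf : MeasTm f) : MeasTm? fun ω => readSeq (ρ ω) (f ω) := by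
  classical
  have hfl : Measurable fun ω => ⌊Tm.real (f ω)⌋₊ := Nat.measurable_floor.comp hf.real
  have h₁ : MeasTm? fun ω => (ρ ω ⌊Tm.real (f ω)⌋₊).map num := by
    intro p
    have : Measurable fun z : Ω × ℕ => node? p ((ρ z.1 z.2).map num) :=
      measurable_from_prod_countable_left fun m => hρ m p
    exact this.comp (measurable_id.prodMk hfl)
  have hfl' : Measurable fun ω => (⌊Tm.real (f ω)⌋₊ : ℝ) := by fun_prop
  have := MeasTm?.ite hf.isNum
    (MeasTm?.ite (measurableSet_eq_fun hfl' hf.real) h₁ measTm?_none) measTm?_none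
  convert this using 2 with ω
  rcases f ω with _ | _ | _ <;> simp [Tm.readSeq, Tm.real, node]
  congr

theorem MeasTm.toReal {f : Ω → Tm} (hf : MeasTm f) : MeasTm? fun ω => (toReal (f ω)).map num := by
  classical
  have := MeasTm?.ite hf.isNum hf.some measTm?_none
  convert this using 2 with ω
  rcases f ω with _ | _ | _ <;> simp [Tm.toReal]

end Measurability

/-- `t` is the symbol `o` applied to something. -/
def HasHead (o : Op) (t : Tm) : Prop := ∃ a, t = pair (sym o) a

/-- `t` is the symbol `o` applied to a pair. -/
def HasHead₂ (o : Op) (t : Tm) : Prop := ∃ a b, t = pair (sym o) (pair a b)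

/-- `t` is the symbol `o` applied to a triple. -/
def HasHead₃ (o : Op) (t : Tm) : Prop := ∃ a b c, t = pair (sym o) (pair a (pair b c))

section
variable {Ω : Type*} [MeasurableSpace Ω] {f : Ω → Tm}

theorem MeasTm.hasHead (hf : MeasTm f) (o : Op) : MeasurableSet {ω | HasHead o (f ω)} := by
  have : {ω | HasHead o (f ω)} = {ω | ∃ a b, f ω = Tm.pair a b} ∩ {ω | Tm.leftD (f ω) = sym o} := by
    ext ω
    simp only [Set.mem_inter_iff, Set.mem_ofPred_eq, HasHead]
    rcases f ω with _ | _ | _ <;> simp [Tm.leftD, Tm.left]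
  rw [this]
  exact hf.isPair.inter (hf.leftD.eq (measTm_const _))

theorem MeasTm.hasHead₂ (hf : MeasTm f) (o : Op) : MeasurableSet {ω | HasHead₂ o (f ω)} := by
  have : {ω | HasHead₂ o (f ω)} =
      {ω | HasHead o (f ω)} ∩ {ω | ∃ a b, Tm.rightD (f ω) = Tm.pair a b} := by
    ext ω
    simp only [Set.mem_inter_iff, Set.mem_ofPred_eq, HasHead, HasHead₂]
    rcases f ω with _ | _ | _ <;> simp [Tm.rightD, Tm.right]
  rw [this]
  exact (hf.hasHead o).inter hf.rightD.isPair

theorem MeasTm.hasHead₃ (hf : MeasTm f) (o : Op) : MeasurableSet {ω | HasHead₃ o (f ω)} := by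
  have : {ω | HasHead₃ o (f ω)} =
      {ω | HasHead₂ o (f ω)} ∩ {ω | ∃ a b, Tm.rightD (Tm.rightD (f ω)) = Tm.pair a b} := by
    ext ω
    simp only [Set.mem_inter_iff, Set.mem_ofPred_eq, HasHead₂, HasHead₃]
    rcases f ω with _ | _ | ⟨_, _ | _ | _⟩ <;> simp [Tm.rightD, Tm.right]
  rw [this]
  exact (hf.hasHead₂ o).inter hf.rightD.rightD.isPair

end

theorem hasHead_iff {o o' : Op} {a : Tm} : HasHead o (pair (sym o') a) ↔ o' = o := by
  simp [HasHead]

theorem hasHead₂_iff {o o' : Op} {a b : Tm} : HasHead₂ o (pair (sym o') (pair a b)) ↔ o' = o := by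
  simp [HasHead₂]

theorem hasHead₃_iff {o o' : Op} {a b c : Tm} :
    HasHead₃ o (pair (sym o') (pair a (pair b c))) ↔ o' = o := by
  simp [HasHead₃]

@[simp] theorem not_hasHead_sym {o o' : Op} : ¬ HasHead o (sym o') := by simp [HasHead]
@[simp] theorem not_hasHead_num_head {o : Op} {y : ℝ} {a : Tm} : ¬ HasHead o (pair (num y) a) := by
  simp [HasHead]
@[simp] theorem not_hasHead_pair_head {o : Op} {a b c : Tm} :
    ¬ HasHead o (pair (pair a b) c) := by simp [HasHead]

theorem HasHead₂.hasHead {o : Op} {t : Tm} (h : HasHead₂ o t) : HasHead o t := by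
  obtain ⟨a, b, rfl⟩ := h; exact ⟨_, rfl⟩
theorem HasHead₃.hasHead₂ {o : Op} {t : Tm} (h : HasHead₃ o t) : HasHead₂ o t := by
  obtain ⟨a, b, c, rfl⟩ := h; exact ⟨_, _, rfl⟩

@[simp] theorem not_hasHead₂_of {o : Op} {t : Tm} (h : ¬ HasHead o t) : ¬ HasHead₂ o t :=
  fun h' => h h'.hasHead
@[simp] theorem not_hasHead₃_of {o : Op} {t : Tm} (h : ¬ HasHead o t) : ¬ HasHead₃ o t :=
  fun h' => h h'.hasHead₂.hasHead

theorem not_hasHead₂_num {o o' : Op} {y : ℝ} : ¬ HasHead₂ o (pair (sym o') (num y)) := by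
  simp [HasHead₂]
theorem not_hasHead₂_sym {o o' o'' : Op} : ¬ HasHead₂ o (pair (sym o') (sym o'')) := by
  simp [HasHead₂]
theorem not_hasHead₃_num {o o' : Op} {y : ℝ} : ¬ HasHead₃ o (pair (sym o') (num y)) := by
  simp [HasHead₃]
theorem not_hasHead₃_sym {o o' o'' : Op} : ¬ HasHead₃ o (pair (sym o') (sym o'')) := by
  simp [HasHead₃]
theorem not_hasHead₃_pair_num {o o' : Op} {a : Tm} {y : ℝ} :
    ¬ HasHead₃ o (pair (sym o') (pair a (num y))) := by simp [HasHead₃]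
theorem not_hasHead₃_pair_sym {o o' o'' : Op} {a : Tm} :
    ¬ HasHead₃ o (pair (sym o') (pair a (sym o''))) := by simp [HasHead₃]

open Classical in
/-- Evaluation as a conditional over the possible forms of the program. -/
theorem eval_succ_eq (k : ℕ) (ρ : ℕ → Option ℝ) (e x : Tm) : eval (k + 1) ρ e x =
    if ∃ y, e = num y then some e
    else if e = inp then some x
    else if HasHead .quote e then some (rightD e)
    else if HasHead .fst e then (eval k ρ (rightD e) x).bind left
    else if HasHead .snd e then (eval k ρ (rightD e) x).bind right
    else if HasHead₂ .cons e then
      (eval k ρ (leftD (rightD e)) x).bind fun v => (eval k ρ (rightD (rightD e)) x).bind fun w =>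
        some (pair v w)
    else if HasHead .kind e then (eval k ρ (rightD e) x).bind fun v => some (kindOf v)
    else if HasHead₂ .eq e then
      (eval k ρ (leftD (rightD e)) x).bind fun v => (eval k ρ (rightD (rightD e)) x).bind fun w =>
        some (ofProp (v = w))
    else if HasHead₂ .lt e then
      (eval k ρ (leftD (rightD e)) x).bind fun v => (eval k ρ (rightD (rightD e)) x).bind fun w =>
        onNums (fun y z => some (ofProp (y < z))) v w
    else if HasHead₂ .add e then
      (eval k ρ (leftD (rightD e)) x).bind fun v => (eval k ρ (rightD (rightD e)) x).bind fun w =>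
        onNums (fun y z => some (num (y + z))) v w
    else if HasHead₂ .sub e then
      (eval k ρ (leftD (rightD e)) x).bind fun v => (eval k ρ (rightD (rightD e)) x).bind fun w =>
        onNums (fun y z => some (num (y - z))) v w
    else if HasHead₂ .mul e then
      (eval k ρ (leftD (rightD e)) x).bind fun v => (eval k ρ (rightD (rightD e)) x).bind fun w =>
        onNums (fun y z => some (num (y * z))) v w
    else if HasHead₂ .div e then
      (eval k ρ (leftD (rightD e)) x).bind fun v => (eval k ρ (rightD (rightD e)) x).bind fun w =>
        onNums (fun y z => if z = 0 then none else some (num (y / z))) v w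
    else if HasHead₃ .ite e then
      (eval k ρ (leftD (rightD e)) x).bind fun t =>
        if t = num 0 then eval k ρ (rightD (rightD (rightD e))) x
        else eval k ρ (leftD (rightD (rightD e))) x
    else if HasHead₂ .bind e then
      (eval k ρ (leftD (rightD e)) x).bind fun v => eval k ρ (rightD (rightD e)) v
    else if HasHead₃ .loop e then
      (eval k ρ (rightD (rightD (rightD e))) x).bind fun v =>
        (eval k ρ (leftD (rightD e)) v).bind fun t =>
          if t = num 0 then some v else
            (eval k ρ (leftD (rightD (rightD e))) v).bind fun v' =>
              eval k ρ (pair (sym .loop) (pair (leftD (rightD e))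
                (pair (leftD (rightD (rightD e))) (pair (sym .quote) v')))) x
    else if HasHead .rand e then (eval k ρ (rightD e) x).bind (readSeq ρ)
    else if HasHead₃ .apply e then
      (eval k ρ (leftD (rightD e)) x).bind fun p =>
        (eval k ρ (leftD (rightD (rightD e))) x).bind fun y =>
          (eval k ρ (rightD (rightD (rightD e))) x).bind fun h =>
            eval k (fun m => (eval k ρ h (num m)).bind toReal) p y
    else none := by
  rcases e with y | o | ⟨_ | o | _, b⟩
  · simp [eval]
  · cases o <;> simp [inp] <;> rfl
  · simp [inp]; rfl
  · rcases b with _ | _ | ⟨a, _ | _ | _⟩ <;> cases o <;>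
      (simp only [inp, hasHead_iff, hasHead₂_iff, not_hasHead₂_num, not_hasHead₂_sym, hasHead₃_iff,
        not_hasHead₃_num, not_hasHead₃_sym, not_hasHead₃_pair_num, not_hasHead₃_pair_sym,
        leftD, rightD, left, right, reduceCtorEq, exists_false, if_false, if_true,
        Option.getD_some]; rfl)
  · simp [inp]; rfl

section
variable {Ω : Type*} [MeasurableSpace Ω]

theorem measTm?_eval (k : ℕ) : ∀ {ρ : Ω → ℕ → Option ℝ} {e x : Ω → Tm},
    (∀ m, MeasTm? fun ω => (ρ ω m).map num) → MeasTm e → MeasTm x →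
    MeasTm? fun ω => eval k (ρ ω) (e ω) (x ω) := by
  classical
  induction k with
  | zero => intro ρ e x _ _ _; simpa only [eval] using measTm?_none
  | succ k ih =>
    intro ρ e x hρ he hx
    have bin : ∀ {F : Tm → Tm → Option Tm}, (∀ f g : Ω → Tm, MeasTm f → MeasTm g →
        MeasTm? fun ω => F (f ω) (g ω)) → MeasTm? fun ω =>
        (eval k (ρ ω) (leftD (rightD (e ω))) (x ω)).bind fun v =>
          (eval k (ρ ω) (rightD (rightD (e ω))) (x ω)).bind fun w => F v w := fun hF =>
      (ih hρ he.rightD.leftD hx).bind fun f hf => (ih hρ he.rightD.rightD hx).bind fun g hg =>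
        hF f g hf hg
    simp only [eval_succ_eq]
    refine MeasTm?.ite he.isNum he.some ?_
    refine MeasTm?.ite (he.eq (measTm_const _)) hx.some ?_
    refine MeasTm?.ite (he.hasHead _) he.rightD.some ?_
    refine MeasTm?.ite (he.hasHead _) ((ih hρ he.rightD hx).bind fun f hf => hf.left) ?_
    refine MeasTm?.ite (he.hasHead _) ((ih hρ he.rightD hx).bind fun f hf => hf.right) ?_
    refine MeasTm?.ite (he.hasHead₂ _) (bin fun f g hf hg => (hf.pair hg).some) ?_
    refine MeasTm?.ite (he.hasHead _)
      ((ih hρ he.rightD hx).bind fun f hf => (measTm_kindOf hf).some) ?_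
    refine MeasTm?.ite (he.hasHead₂ _)
      (bin fun f g hf hg => (measTm_ofProp (hf.eq hg)).some) ?_
    refine MeasTm?.ite (he.hasHead₂ _) (bin fun f g hf hg => hf.onNums hg
      (measTm_ofProp (measurableSet_lt hf.real hg.real)).some) ?_
    refine MeasTm?.ite (he.hasHead₂ _) (bin fun f g hf hg => hf.onNums hg
      (measTm_num.2 (hf.real.add hg.real)).some) ?_
    refine MeasTm?.ite (he.hasHead₂ _) (bin fun f g hf hg => hf.onNums hg
      (measTm_num.2 (hf.real.sub hg.real)).some) ?_
    refine MeasTm?.ite (he.hasHead₂ _) (bin fun f g hf hg => hf.onNums hg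
      (measTm_num.2 (hf.real.mul hg.real)).some) ?_
    refine MeasTm?.ite (he.hasHead₂ _) (bin fun f g hf hg => hf.onNums hg
      (MeasTm?.ite (measurableSet_eq_fun hg.real measurable_const) measTm?_none
        (measTm_num.2 (hf.real.div hg.real)).some)) ?_
    refine MeasTm?.ite (he.hasHead₃ _) ((ih hρ he.rightD.leftD hx).bind fun f hf =>
      MeasTm?.ite (hf.eq (measTm_const _)) (ih hρ he.rightD.rightD.rightD hx)
        (ih hρ he.rightD.rightD.leftD hx)) ?_
    refine MeasTm?.ite (he.hasHead₂ _) ((ih hρ he.rightD.leftD hx).bind fun f hf =>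
      ih hρ he.rightD.rightD hf) ?_
    refine MeasTm?.ite (he.hasHead₃ _) ((ih hρ he.rightD.rightD.rightD hx).bind fun f hf =>
      (ih hρ he.rightD.leftD hf).bind fun g hg =>
        MeasTm?.ite (hg.eq (measTm_const _)) hf.some
          ((ih hρ he.rightD.rightD.leftD hf).bind fun h hh =>
            ih hρ ((measTm_const _).pair (he.rightD.leftD.pair (he.rightD.rightD.leftD.pair
              ((measTm_const _).pair hh)))) hx)) ?_
    refine MeasTm?.ite (he.hasHead _) ((ih hρ he.rightD hx).bind fun f hf => hf.readSeq hρ) ?_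
    refine MeasTm?.ite (he.hasHead₃ _) ((ih hρ he.rightD.leftD hx).bind fun p hp =>
      (ih hρ he.rightD.rightD.leftD hx).bind fun y hy =>
        (ih hρ he.rightD.rightD.rightD hx).bind fun h hh => ih (fun m => ?_) hp hy) measTm?_none
    simp only [Option.map_bind]
    exact (ih hρ hh (measTm_const _)).bind fun f hf => hf.toReal

end

end Tm

theorem measurableSet_plays {n : ℕ} {A : Fin n → Type*} [∀ j, Fintype (A j)] (p : Fin n → Tm)
    (i : Fin n) (a : A i) : MeasurableSet {r | Plays p i r a} := by
  have : {r | Plays p i r a} = ⋃ k, {r : ℕ → unitInterval |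
      eval k (fun m => some (r m : ℝ)) (p i) (programInput p i) = some (actionTm a)} := by
    ext r
    simp [Plays, HaltsWith]
  rw [this]
  refine MeasurableSet.iUnion fun k => (measTm?_eval k (fun m => ?_) (measTm_const _)
    (measTm_const _)).eq_some _
  exact (measTm_num.2 (measurable_subtype_coe.comp (measurable_pi_apply m))).some

namespace Tm

/-! ## Computable functions between encoded types -/

/-- The program testing whether two programs have the same value. -/
def mkEq (e f : Tm) : Tm := pair (sym .eq) (pair e f)

/-- The program multiplying the values of two programs. -/
def mkMul (e f : Tm) : Tm := pair (sym .mul) (pair e f)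

/-- Some program computes `f`, with respect to the encodings `ea` and `eb`. -/
def Comput {α β : Type*} (ea : α → Tm) (eb : β → Tm) (f : α → β) : Prop :=
  ∃ c, ∀ ρ x, HaltsWith c (ea x) ρ (eb (f x))

/-- The encoding of pairs. -/
def encPair {α β : Type*} (ea : α → Tm) (eb : β → Tm) (z : α × β) : Tm := pair (ea z.1) (eb z.2)

/-- The encoding of lists. -/
def encList {α : Type*} (ea : α → Tm) (l : List α) : Tm := list (l.map ea)

section
variable {α β γ κ : Type*} {ea : α → Tm} {eb : β → Tm} {ec : γ → Tm} {ek : κ → Tm}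

theorem Comput.comp {g : β → γ} {f : α → β} (hg : Comput eb ec g) (hf : Comput ea eb f) :
    Comput ea ec fun x => g (f x) := by
  obtain ⟨c, hc⟩ := hg
  obtain ⟨d, hd⟩ := hf
  exact ⟨mkBind d c, fun ρ x => (hd ρ x).bind (hc ρ _)⟩

theorem comput_const (b : β) : Comput ea eb fun _ => b := ⟨mkQuote (eb b), fun _ _ => halts_quote⟩

theorem comput_id : Comput ea ea fun x => x := ⟨inp, fun _ _ => halts_inp⟩

theorem comput_ite_lt {f g : α → ℝ} {h k : α → β} (hf : Comput ea num f) (hg : Comput ea num g)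
    (hh : Comput ea eb h) (hk : Comput ea eb k) :
    Comput ea eb fun x => if f x < g x then h x else k x := by
  obtain ⟨cf, hf⟩ := hf
  obtain ⟨cg, hg⟩ := hg
  obtain ⟨ch, hh⟩ := hh
  obtain ⟨ck, hk⟩ := hk
  refine ⟨mkIte (mkLt cf cg) ch ck, fun ρ x => HaltsWith.ite ((hf ρ x).lt (hg ρ x))
    (fun hx => ?_) fun hx => ?_⟩
  · simpa only [if_pos hx] using hh ρ x
  · simpa only [if_neg hx] using hk ρ x

theorem Comput.sub {f g : α → ℝ} (hf : Comput ea num f) (hg : Comput ea num g) :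
    Comput ea num fun x => f x - g x := by
  obtain ⟨cf, hf⟩ := hf
  obtain ⟨cg, hg⟩ := hg
  exact ⟨mkSub cf cg, fun ρ x => (hf ρ x).sub (hg ρ x)⟩

theorem Comput.add {f g : α → ℝ} (hf : Comput ea num f) (hg : Comput ea num g) :
    Comput ea num fun x => f x + g x := by
  obtain ⟨cf, hf⟩ := hf
  obtain ⟨cg, hg⟩ := hg
  exact ⟨mkAdd cf cg, fun ρ x => (hf ρ x).add (hg ρ x)⟩

theorem Comput.mul {f g : α → ℝ} (hf : Comput ea num f) (hg : Comput ea num g) :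
    Comput ea num fun x => f x * g x := by
  obtain ⟨cf, hf⟩ := hf
  obtain ⟨cg, hg⟩ := hg
  exact ⟨mkMul cf cg, fun ρ x => (hf ρ x).mul (hg ρ x)⟩

/-- A family of computable functions over a finite index type is jointly computable. -/
theorem comput_switch [Finite κ] (hek : Function.Injective ek) {g : κ → α → β}
    (hg : ∀ q, Comput ea eb (g q)) : Comput (encPair ek ea) eb fun z => g z.1 z.2 := by
  classical
  have := Fintype.ofFinite κ
  have key : ∀ L : List κ, ∃ c, ∀ q ∈ L, ∀ ρ x,
      HaltsWith c (pair (ek q) (ea x)) ρ (eb (g q x)) := by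
    intro L
    induction L with
    | nil => exact ⟨nil, by simp⟩
    | cons q₀ L ih =>
      obtain ⟨c, hc⟩ := ih
      obtain ⟨d, hd⟩ := hg q₀
      refine ⟨mkIte (mkEq (mkFst inp) (mkQuote (ek q₀))) (mkBind (mkSnd inp) d) c,
        fun q hq ρ x => HaltsWith.ite (halts_inp.fst.eq halts_quote) (fun h => ?_) fun h => ?_⟩
      · obtain rfl := hek h
        exact halts_inp.snd.bind (hd ρ x)
      · refine hc q ((List.mem_cons.1 hq).resolve_left ?_) ρ x
        rintro rfl
        exact h rfl
  obtain ⟨c, hc⟩ := key Finset.univ.toList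
  exact ⟨c, fun ρ z => hc z.1 (by simp) ρ z.2⟩

/-- Every function on a finite type is computable. -/
theorem comput_finite [Finite α] (hea : Function.Injective ea) (f : α → β) : Comput ea eb f := by
  obtain ⟨c, hc⟩ := comput_switch (ea := fun _ : Unit => nil) (eb := eb) hea (g := fun q _ => f q)
    fun q => comput_const _
  exact ⟨mkBind (mkCons inp (mkQuote nil)) c,
    fun ρ x => (halts_inp.cons halts_quote).bind (hc ρ (x, ()))⟩

end

theorem actionTm_injective {α : Type*} [Fintype α] : Function.Injective (actionTm (α := α)) := by
  intro a b h
  simpa [actionTm, Fin.val_inj] using h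

/-- The encoding of an action profile as the list of its actions. -/
noncomputable def encProfile {n : ℕ} {A : Fin n → Type*} [∀ j, Fintype (A j)] (a : ∀ j, A j) : Tm :=
  list (List.ofFn fun j => actionTm (a j))

theorem list_injective : Function.Injective list := by
  intro l
  induction l with
  | nil => intro l' h; cases l' <;> simp_all [list, nil]
  | cons a l ih =>
    intro l' h
    cases l' with
    | nil => simp [list, nil] at h
    | cons b l' =>
      simp only [list, pair.injEq] at h
      rw [h.1, ih h.2]

theorem encProfile_injective {n : ℕ} {A : Fin n → Type*} [∀ j, Fintype (A j)] :
    Function.Injective (encProfile (A := A)) := by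
  intro a b h
  have := List.ofFn_injective (list_injective h)
  funext j
  exact actionTm_injective (congrFun this j)

theorem comput_profile {α : Type*} {ea : α → Tm} {n : ℕ} {A : Fin n → Type*} [∀ j, Fintype (A j)]
    {f : α → ∀ j, A j} (hf : ∀ j, Comput ea actionTm fun x => f x j) : Comput ea encProfile f := by
  choose c hc using hf
  exact ⟨mkList (List.ofFn c), fun ρ x => HaltsWith.mkList_ofFn fun j => hc j ρ x⟩

section Lists
variable {α β κ : Type*} {ea : α → Tm} {eb : β → Tm} {ek : κ → Tm} {ρ : ℕ → Option ℝ}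

/-- The test whether the first component of the input is not the empty list. -/
def nonemptyTest : Tm := mkIte (mkEq (mkFst inp) (mkQuote nil)) (num 0) (num 1)

open Classical in
theorem nonemptyTest_nil {y : Tm} : HaltsWith nonemptyTest (pair nil y) ρ (num 0) :=
  HaltsWith.ite (halts_inp.fst.eq halts_quote) (fun _ => halts_num 0) fun h => absurd rfl h

open Classical in
theorem nonemptyTest_pair {a b y : Tm} : HaltsWith nonemptyTest (pair (pair a b) y) ρ (num 1) :=
  HaltsWith.ite (halts_inp.fst.eq halts_quote) (fun h => by simp [nil] at h) fun _ => halts_num 1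

theorem comput_reverse : Comput (encList ea) (encList ea) List.reverse := by
  set b := mkCons (mkSnd (mkFst inp)) (mkCons (mkFst (mkFst inp)) (mkSnd inp)) with hb
  have key : ∀ (l acc : List α) (e x : Tm) (ρ : ℕ → Option ℝ),
      HaltsWith e x ρ (pair (encList ea l) (encList ea acc)) →
      HaltsWith (mkLoop nonemptyTest b e) x ρ (pair nil (encList ea (l.reverseAux acc))) := by
    intro l
    induction l with
    | nil => exact fun acc e x ρ he => he.loop_stop nonemptyTest_nil
    | cons a l ih =>
      intro acc e x ρ he
      refine he.loop_step nonemptyTest_pair (by simp) (w := pair (encList ea l)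
        (encList ea (a :: acc))) ?_ (ih (a :: acc) _ x ρ halts_quote)
      exact halts_inp.fst.snd.cons (halts_inp.fst.fst.cons halts_inp.snd)
  exact ⟨_, fun ρ l => (key l [] _ _ ρ (halts_inp.cons halts_quote)).snd⟩

theorem halts_foldl_zip {step : κ → α → β → κ}
    (hstep : Comput (encPair ek (encPair ea eb)) ek fun z => step z.1 z.2.1 z.2.2) :
    ∃ c, ∀ ρ (l : List α) (l' : List β) (q : κ), l.length = l'.length →
      HaltsWith c (pair (encList ea l) (pair (encList eb l') (ek q))) ρ
        (ek ((l.zip l').foldl (fun q z => step q z.1 z.2) q)) := by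
  obtain ⟨s, hs⟩ := hstep
  set b := mkCons (mkSnd (mkFst inp)) (mkCons (mkSnd (mkFst (mkSnd inp)))
    (mkBind (mkCons (mkSnd (mkSnd inp))
      (mkCons (mkFst (mkFst inp)) (mkFst (mkFst (mkSnd inp))))) s)) with hb
  have key : ∀ (l : List α) (l' : List β) (q : κ) (e x : Tm) (ρ : ℕ → Option ℝ),
      l.length = l'.length →
      HaltsWith e x ρ (pair (encList ea l) (pair (encList eb l') (ek q))) →
      HaltsWith (mkLoop nonemptyTest b e) x ρ
        (pair nil (pair nil (ek ((l.zip l').foldl (fun q z => step q z.1 z.2) q)))) := by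
    intro l
    induction l with
    | nil =>
      intro l' q e x ρ hl he
      obtain rfl : l' = [] := List.length_eq_zero_iff.1 hl.symm
      exact he.loop_stop nonemptyTest_nil
    | cons a l ih =>
      intro l' q e x ρ hl he
      obtain _ | ⟨y, l'⟩ := l'
      · simp at hl
      refine he.loop_step nonemptyTest_pair (by simp) (w := pair (encList ea l)
        (pair (encList eb l') (ek (step q a y)))) ?_
        (ih l' _ _ x ρ (by simpa using hl) halts_quote)
      exact halts_inp.fst.snd.cons (halts_inp.snd.fst.snd.cons
        ((halts_inp.snd.snd.cons (halts_inp.fst.fst.cons halts_inp.snd.fst.fst)).bind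
          (hs ρ (q, (a, y)))))
  exact ⟨_, fun ρ l l' q hl => (key l l' q _ _ ρ hl halts_inp).snd.snd⟩

end Lists

end Tm

/-! ## Policies given by finite automata -/

section Automaton
variable {n : ℕ} {A : Fin n → Type*} [∀ j, Fintype (A j)]

/-- The state of an automaton that has read an action history and the random numbers that came
with it. -/
def autoState {κ : Type*} (step : κ → (∀ j, A j) → ℝ → κ) (q₀ : κ) (h : List (∀ j, A j))
    (r : List ℝ) : κ :=
  (h.zip r.tail.reverse).foldl (fun q z => step q z.1 z.2) q₀

/-- The policy that reads the history with an automaton. -/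
def autoPolicy {κ : Type*} (step : κ → (∀ j, A j) → ℝ → κ) (q₀ : κ) {i : Fin n}
    (out : κ → ℝ → A i) : Policy A i :=
  fun h r => out (autoState step q₀ h r) (r.headD 0)

theorem exists_computes_autoPolicy {κ : Type*} [Fintype κ] {step : κ → (∀ j, A j) → ℝ → κ}
    (hstep : ∀ q a, Comput num actionTm (step q a)) (q₀ : κ) {i : Fin n} {out : κ → ℝ → A i}
    (hout : ∀ q, Comput num actionTm (out q)) : ∃ c, Computes c (autoPolicy step q₀ out) := by
  obtain ⟨cr, hcr⟩ := comput_reverse (ea := num)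
  obtain ⟨cs, hcs⟩ := halts_foldl_zip (comput_switch (actionTm_injective (α := κ))
    fun q => comput_switch (encProfile_injective (A := A)) fun a => hstep q a)
  obtain ⟨co, hco⟩ := comput_switch (actionTm_injective (α := κ)) fun q => hout q
  refine ⟨mkBind (mkCons (mkBind (mkCons (mkFst inp) (mkCons (mkBind (mkSnd (mkSnd inp)) cr)
    (mkQuote (actionTm q₀)))) cs) (mkFst (mkSnd inp))) co, fun ρ h r hr _ => ?_⟩
  obtain _ | ⟨y, r⟩ := r
  · simp at hr
  have hl : h.length = r.reverse.length := by simpa using hr.symm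
  refine HaltsWith.bind (HaltsWith.cons (HaltsWith.bind (halts_inp.fst.cons
    ((halts_inp.snd.snd.bind (hcr ρ r)).cons halts_quote)) (hcs ρ h r.reverse q₀ hl))
      halts_inp.snd.fst) (hco ρ (_, y))

end Automaton

/-! ## Sampling -/

/-- Inverse transform sampling along a list. -/
noncomputable def quantileAux {α : Type*} (σ : α → ℝ) (d : α) : List α → ℝ → α
  | [], _ => d
  | a :: l, y => if y < σ a then a else quantileAux σ d l (y - σ a)

/-- Inverse transform sampling: for uniform `y` in `[0, 1)` the result has law `σ`. -/
noncomputable def quantile {α : Type*} [Fintype α] (σ : α → ℝ) (d : α) (y : ℝ) : α :=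
  quantileAux σ d Finset.univ.toList y

theorem comput_quantileAux {α β : Type*} {ea : α → Tm} {eb : β → Tm} (σ : β → ℝ) (d : β)
    (l : List β) : ∀ {f : α → ℝ}, Comput ea num f →
    Comput ea eb fun x => quantileAux σ d l (f x) := by
  induction l with
  | nil => exact fun _ => comput_const _
  | cons b l ih =>
    exact fun hf => comput_ite_lt hf (comput_const _) (comput_const _) (ih (hf.sub (comput_const _)))

theorem Comput.quantile {α β : Type*} {ea : α → Tm} {eb : β → Tm} [Fintype β] {f : α → ℝ}
    (hf : Comput ea num f) (σ : β → ℝ) (d : β) : Comput ea eb fun x => quantile σ d (f x) :=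
  comput_quantileAux σ d _ hf

theorem quantileAux_eq_iff {α : Type*} {σ : α → ℝ} (hσ : ∀ a, 0 ≤ σ a) (d : α) (l : List α)
    (hl : l.Nodup) {b : α} (hb : b ∈ l) : ∃ β : ℝ, 0 ≤ β ∧ β + σ b ≤ (l.map σ).sum ∧
      ∀ y, 0 ≤ y → y < (l.map σ).sum → (quantileAux σ d l y = b ↔ β ≤ y ∧ y < β + σ b) := by
  induction l with
  | nil => simp at hb
  | cons a l ih =>
    have hsum : 0 ≤ (l.map σ).sum := List.sum_nonneg (by simpa using fun a _ => hσ a)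
    obtain ⟨hal, hl⟩ := List.nodup_cons.1 hl
    by_cases hab : b = a
    · subst hab
      refine ⟨0, le_rfl, by simpa using hsum, fun y hy hy' => ?_⟩
      simp only [quantileAux]
      split_ifs with h
      · simp [hy, h]
      · simp only [hy, zero_add, true_and, h, iff_false]
        have : ∀ (l : List α) (y : ℝ), 0 ≤ y → y < (l.map σ).sum → quantileAux σ d l y ∈ l := by
          intro l
          induction l with
          | nil => intro y h₁ h₂; simp at h₂; linarith
          | cons c l ih =>
            intro y h₁ h₂
            simp only [quantileAux]
            split_ifs with h
            · simp
            · exact List.mem_cons_of_mem _ (ih _ (by linarith) (by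
                simp only [List.map_cons, List.sum_cons] at h₂; linarith))
        intro hq
        simp only [List.map_cons, List.sum_cons] at hy'
        exact hal (hq ▸ this l (y - σ b) (by linarith) (by linarith))
    · obtain ⟨β, h₁, h₂, h₃⟩ := ih hl ((List.mem_cons.1 hb).resolve_left hab)
      refine ⟨σ a + β, add_nonneg (hσ a) h₁, ?_, fun y hy hy' => ?_⟩
      · simp only [List.map_cons, List.sum_cons]; linarith
      · simp only [List.map_cons, List.sum_cons] at hy'
        simp only [quantileAux]
        split_ifs with h
        · constructor
          · intro h'; exact absurd h'.symm hab
          · intro h'; linarith [h'.1]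
        · rw [h₃ (y - σ a) (by linarith) (by linarith)]
          constructor <;> rintro ⟨h, h'⟩ <;> constructor <;> linarith

theorem quantile_eq_iff {α : Type*} [Fintype α] {σ : α → ℝ} (hσ : σ ∈ stdSimplex ℝ α) (d b : α) :
    ∃ β : ℝ, 0 ≤ β ∧ β + σ b ≤ 1 ∧
      ∀ y, 0 ≤ y → y < 1 → (quantile σ d y = b ↔ β ≤ y ∧ y < β + σ b) := by
  have := quantileAux_eq_iff hσ.1 d Finset.univ.toList (Finset.nodup_toList _) (b := b) (by simp)
  rwa [Finset.sum_map_toList, hσ.2] at this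

/-! ## The schedule and the punishing automaton -/

/-- The relative position of `x` in the part, below or above `ε`, of the unit interval. -/
noncomputable def relPos (ε x : ℝ) : ℝ := if x < ε then x / ε else (x - ε) / (1 - ε)

theorem comput_relPos (ε : ℝ) : Comput num num (relPos ε) := by
  have : relPos ε = fun x => if x < ε then x * ε⁻¹ else (x - ε) * (1 - ε)⁻¹ := by
    funext x; simp only [relPos, div_eq_mul_inv]
  rw [this]
  exact comput_ite_lt comput_id (comput_const _) (comput_id.mul (comput_const _))
    ((comput_id.sub (comput_const _)).mul (comput_const _))

/-- The probability that a geometric time that is less than `W` is less than `p`. -/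
noncomputable def cumWeight (ε : ℝ) (W p : ℕ) : ℝ := (1 - (1 - ε) ^ p) / (1 - (1 - ε) ^ W)

section Punish
variable {n : ℕ} {A : Fin n → Type*} [∀ j, Fintype (A j)]

/-- The data of the punishing policies: grounding probability, block length, strategies that are
to be played, punishments, and a default profile. -/
structure PunishData {n : ℕ} (A : Fin n → Type*) [∀ j, Fintype (A j)] where
  /-- the grounding probability -/
  ε : ℝ
  /-- the block length, less one -/
  w : ℕ
  /-- the strategies that are to be played -/
  s : ∀ j, A j → ℝ
  /-- how `j` punishes an action of `i` -/
  S : ∀ i j, A i → A j → ℝ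
  /-- a default profile -/
  d : ∀ j, A j

variable (D : PunishData A)

/-- The block length. -/
abbrev PunishData.W : ℕ := D.w + 1

/-- The action that is scheduled for player `j` at position `p` of a block. -/
noncomputable def PunishData.sched (p : ℕ) (x : ℝ) : ∀ j, A j := fun j =>
  quantile (D.s j) (D.d j)
    (cumWeight D.ε D.W p + (cumWeight D.ε D.W (p + 1) - cumWeight D.ε D.W p) * relPos D.ε x)

/-- A block of played and scheduled profiles. -/
abbrev PunishData.Block : Type _ := Fin D.W → (∀ j, A j) × (∀ j, A j)

/-- The states: position in the block, the accused player, the previous and the present block. -/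
abbrev PunishData.State : Type _ := Fin D.W × Option (Fin n) × D.Block × D.Block

open Classical in
/-- Accuse a player who does not play what is scheduled, unless someone is already accused. -/
noncomputable def accuse (acc : Option (Fin n)) (a sc : ∀ j, A j) : Option (Fin n) :=
  match acc with
  | some i => some i
  | none => if h : ∃ k, a k ≠ sc k then some h.choose else none

/-- The transitions, in terms of the scheduled profile. -/
noncomputable def PunishData.next (q : D.State) (a sc : ∀ j, A j) : D.State :=
  if h : q.1 + 1 < D.W then
    (⟨q.1 + 1, h⟩, accuse q.2.1 a sc, q.2.2.1, Function.update q.2.2.2 q.1 (a, sc))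
  else
    (0, accuse q.2.1 a sc, Function.update q.2.2.2 q.1 (a, sc),
      Function.update q.2.2.2 q.1 (a, sc))

/-- The transitions of the automaton. -/
noncomputable def PunishData.step (q : D.State) (a : ∀ j, A j) (x : ℝ) : D.State :=
  D.next q a (D.sched q.1 x)

/-- The initial state. -/
def PunishData.start : D.State := (0, none, fun _ => (D.d, D.d), fun _ => (D.d, D.d))

open Classical in
/-- The output of player `j`: punish the accused player if he did not play what was scheduled
somewhere in the previous block, and otherwise play what is scheduled. -/
noncomputable def PunishData.out (j : Fin n) (q : D.State) (x : ℝ) : A j :=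
  match q.2.1 with
  | none => D.sched q.1 x j
  | some i =>
    if j ≠ i ∧ ∃ t, (q.2.2.1 t).1 i ≠ (q.2.2.1 t).2 i then
      quantile (D.S i j ((q.2.2.1 q.1).1 i)) (D.d j) (relPos D.ε x)
    else D.sched q.1 x j

/-- The policy of player `j`. -/
noncomputable def PunishData.policy (j : Fin n) : Policy A j := autoPolicy D.step D.start (D.out j)

theorem PunishData.comput_sched {α : Type*} {ea : α → Tm} {f : α → ℝ} (hf : Comput ea num f)
    (p : ℕ) (j : Fin n) : Comput ea actionTm fun x => D.sched p (f x) j :=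
  Comput.quantile ((comput_const _).add ((comput_const _).mul ((comput_relPos _).comp hf))) _ _

theorem PunishData.exists_computes (j : Fin n) : ∃ c, Computes c (D.policy j) := by
  refine exists_computes_autoPolicy (fun q a => ?_) D.start fun q => ?_
  · exact (comput_finite (encProfile_injective (A := A)) (D.next q a)).comp
      (comput_profile fun j => D.comput_sched comput_id q.1 j)
  · unfold PunishData.out
    split
    · exact D.comput_sched comput_id _ _
    · split_ifs
      · exact Comput.quantile (comput_relPos _) _ _
      · exact D.comput_sched comput_id _ _

/-! ## What the automaton does -/

/-- The state after the profiles `act T, …, act 1`, played with random numbers `x T, …, x 1`. -/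
noncomputable def PunishData.stateOf (T : ℕ) (act : ℕ → ∀ j, A j) (x : ℕ → ℝ) : D.State :=
  (historyOf (fun m => (act m, x m)) T).foldl (fun q z => D.step q z.1 z.2) D.start

theorem historyOf_succ' {α : Type*} (act : ℕ → α) (T : ℕ) :
    historyOf act (T + 1) = historyOf (fun m => act (m + 1)) T ++ [act 1] := by
  simp [historyOf, List.range_succ_eq_map, Function.comp_def]

theorem historyOf_zip {α β : Type*} (f : ℕ → α) (g : ℕ → β) (T : ℕ) :
    (historyOf f T).zip (historyOf g T) = historyOf (fun m => (f m, g m)) T := by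
  induction T with
  | zero => rfl
  | succ T ih => simp only [historyOf_succ, List.zip_cons_cons, ih]

theorem PunishData.stateOf_succ (T : ℕ) (act : ℕ → ∀ j, A j) (x : ℕ → ℝ) :
    D.stateOf (T + 1) act x =
      D.step (D.stateOf T (fun m => act (m + 1)) fun m => x (m + 1)) (act 1) (x 1) := by
  simp [PunishData.stateOf, historyOf_succ']

theorem PunishData.policy_apply (j : Fin n) (T : ℕ) (act : ℕ → ∀ j, A j) (x : ℕ → ℝ) :
    D.policy j (historyOf act T) ((List.range (T + 1)).map x) =
      D.out j (D.stateOf T act x) (x 0) := by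
  have : ((List.range (T + 1)).map x).tail.reverse = historyOf x T := by
    simp [historyOf, List.range_succ_eq_map, Function.comp_def]
  simp only [PunishData.policy, autoPolicy, autoState, this, historyOf_zip]
  simp [PunishData.stateOf, List.range_succ_eq_map]

/-- The state records the history of the two last blocks, and the first player who did not play
what was scheduled. -/
theorem PunishData.stateOf_spec (T : ℕ) (act : ℕ → ∀ j, A j) (x : ℕ → ℝ) :
    ((D.stateOf T act x).1 : ℕ) = T % D.W ∧
    (∀ q : Fin D.W, (q : ℕ) < T % D.W → (D.stateOf T act x).2.2.2 q =
      (act (T % D.W - q), D.sched q (x (T % D.W - q)))) ∧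
    (D.W ≤ T → ∀ q : Fin D.W, (D.stateOf T act x).2.2.1 q =
      (act (T % D.W + D.W - q), D.sched q (x (T % D.W + D.W - q)))) ∧
    (T < D.W → ∀ q : Fin D.W, (D.stateOf T act x).2.2.1 q = (D.d, D.d)) ∧
    ((D.stateOf T act x).2.1 = none ↔
      ∀ m, 1 ≤ m → m ≤ T → act m = D.sched ((T - m) % D.W) (x m)) ∧
    (∀ k, (D.stateOf T act x).2.1 = some k → ∃ m, 1 ≤ m ∧ m ≤ T ∧
      act m k ≠ D.sched ((T - m) % D.W) (x m) k ∧
      ∀ m', m < m' → m' ≤ T → act m' = D.sched ((T - m') % D.W) (x m')) := by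
  induction T generalizing act x with
  | zero =>
    refine ⟨rfl, by simp, fun h => by simp at h, fun _ q => rfl, ?_, ?_⟩
    · simp only [stateOf, historyOf, start]; simp; omega
    · intro k hk; simp [stateOf, historyOf, start] at hk
  | succ T ih =>
    obtain ⟨h₁, h₂, h₃, h₄, h₅, h₆⟩ := ih (fun m => act (m + 1)) fun m => x (m + 1)
    rw [PunishData.stateOf_succ]
    set st := D.stateOf T (fun m => act (m + 1)) fun m => x (m + 1) with hst
    have hW : 0 < D.W := Nat.succ_pos _
    have hacc : (D.step st (act 1) (x 1)).2.1 = accuse st.2.1 (act 1) (D.sched (T % D.W) (x 1)) := by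
      simp only [step, next, h₁]
      split_ifs <;> rfl
    have hcur : ∀ q : Fin D.W, (q : ℕ) ≤ T % D.W →
        Function.update st.2.2.2 st.1 (act 1, D.sched st.1 (x 1)) q =
          (act (T % D.W + 1 - q), D.sched q (x (T % D.W + 1 - q))) := by
      intro q hq
      by_cases hq' : q = st.1
      · subst hq'
        have : T % D.W + 1 - (st.1 : ℕ) = 1 := by omega
        simp [this]
      · have hlt : (q : ℕ) < T % D.W :=
          lt_of_le_of_ne hq fun h => hq' (Fin.ext (by rw [h₁]; exact h))
        rw [Function.update_of_ne hq', h₂ q hlt]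
        have : T % D.W + 1 - (q : ℕ) = T % D.W - q + 1 := by omega
        rw [this]
    have hmod : T % D.W < D.W := Nat.mod_lt _ hW
    have hst5 : st.2.1 = none ↔ ∀ m, 2 ≤ m → m ≤ T + 1 →
        act m = D.sched ((T + 1 - m) % D.W) (x m) := by
      rw [h₅]
      refine ⟨fun h m hm hm' => ?_, fun h m hm hm' => ?_⟩
      · have := h (m - 1) (by omega) (by omega)
        rwa [Nat.sub_add_cancel (by omega), show T - (m - 1) = T + 1 - m by omega] at this
      · have := h (m + 1) (by omega) (by omega)
        rwa [show T + 1 - (m + 1) = T - m by omega] at this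
    have key : ((D.step st (act 1) (x 1)).2.1 = none ↔
        ∀ m, 1 ≤ m → m ≤ T + 1 → act m = D.sched ((T + 1 - m) % D.W) (x m)) ∧
      (∀ k, (D.step st (act 1) (x 1)).2.1 = some k → ∃ m, 1 ≤ m ∧ m ≤ T + 1 ∧
        act m k ≠ D.sched ((T + 1 - m) % D.W) (x m) k ∧
        ∀ m', m < m' → m' ≤ T + 1 → act m' = D.sched ((T + 1 - m') % D.W) (x m')) := by
      rw [hacc]
      rcases hs : st.2.1 with _ | k₀
      · have hs' := hst5.1 hs
        by_cases hk : ∃ k, act 1 k ≠ D.sched (T % D.W) (x 1) k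
        · simp only [accuse, hk, dif_pos, reduceCtorEq, false_iff, Option.some.injEq]
          refine ⟨fun h => ?_, ?_⟩
          · obtain ⟨k, hk⟩ := hk
            exact hk (by rw [h 1 le_rfl (by omega)]; rfl)
          · rintro _ rfl
            exact ⟨1, le_rfl, by omega, hk.choose_spec, fun m' h h' => hs' m' h h'⟩
        · simp only [accuse, hk, dif_neg, not_false_eq_true, true_iff, reduceCtorEq,
            false_implies, implies_true, and_true]
          intro m hm hm'
          rcases hm.eq_or_lt with rfl | hm
          · push Not at hk
            exact funext hk
          · exact hs' m hm hm'
      · simp only [accuse, reduceCtorEq, false_iff, Option.some.injEq]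
        refine ⟨fun h => ?_, ?_⟩
        · have := hst5.2 fun m hm hm' => h m (by omega) hm'
          simp [hs] at this
        · rintro _ rfl
          obtain ⟨m, h1, h2, h3, h4⟩ := h₆ _ hs
          refine ⟨m + 1, by omega, by omega, ?_, fun m' hm hm' => ?_⟩
          · rwa [show T + 1 - (m + 1) = T - m by omega]
          · have := h4 (m' - 1) (by omega) (by omega)
            rwa [Nat.sub_add_cancel (by omega), show T - (m' - 1) = T + 1 - m' by omega] at this
    suffices hblock : _ ∧ _ ∧ _ ∧ _ from
      ⟨hblock.1, hblock.2.1, hblock.2.2.1, hblock.2.2.2, key⟩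
    clear key hst5 hacc h₅ h₆
    by_cases h : T % D.W + 1 < D.W
    · have hT : (T + 1) % D.W = T % D.W + 1 := by
        rw [Nat.add_mod, Nat.mod_eq_of_lt (a := 1) (by omega), Nat.mod_eq_of_lt h]
      have hstep : D.step st (act 1) (x 1) = (⟨st.1 + 1, by rw [h₁]; exact h⟩,
          accuse st.2.1 (act 1) (D.sched st.1 (x 1)), st.2.2.1,
          Function.update st.2.2.2 st.1 (act 1, D.sched st.1 (x 1))) := by
        simp only [step, next]
        rw [dif_pos (by rw [h₁]; exact h)]
      rw [hstep, hT]
      refine ⟨by simp [h₁], fun q hq => hcur q (by omega), fun hle q => ?_, fun hlt q => ?_⟩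
      · have hne : T + 1 ≠ D.W := by
          intro h'
          rw [h', Nat.mod_self] at hT
          omega
        have := h₃ (by omega) q
        rwa [show T % D.W + D.W - (q : ℕ) + 1 = T % D.W + 1 + D.W - q by have := q.2; omega] at this
      · exact h₄ (by omega) q
    · have hw : T % D.W + 1 = D.W := by omega
      have hT : (T + 1) % D.W = 0 := by
        rw [← Nat.mod_add_mod, hw, Nat.mod_self]
      have hstep : D.step st (act 1) (x 1) = (0,
          accuse st.2.1 (act 1) (D.sched st.1 (x 1)),
          Function.update st.2.2.2 st.1 (act 1, D.sched st.1 (x 1)),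
          Function.update st.2.2.2 st.1 (act 1, D.sched st.1 (x 1))) := by
        simp only [step, next]
        rw [dif_neg (by rw [h₁]; exact h)]
      rw [hstep, hT]
      refine ⟨rfl, fun q hq => absurd hq (Nat.not_lt_zero _), fun _ q => ?_, fun hlt => ?_⟩
      · have := hcur q (by have := q.2; omega)
        rw [hw] at this
        have hz : ∀ q, 0 + D.W - q = D.W - q := fun q => by rw [Nat.zero_add]
        simpa only [hz] using this
      · rw [Nat.mod_eq_of_lt (by omega)] at hw
        omega

/-- What the punishing policies play, when at most player `i` does not follow them. -/
theorem PunishData.out_stateOf {T : ℕ} {act : ℕ → ∀ j, A j} {x : ℕ → ℝ} {i : Fin n}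
    (hact : ∀ m ≤ T, ∀ j ≠ i, act m j =
      D.out j (D.stateOf (T - m) (fun l => act (l + m)) fun l => x (l + m)) (x m))
    {j : Fin n} (hj : j ≠ i) :
    (T < D.W → act 0 j = D.sched (T % D.W) (x 0) j) ∧
    (D.W ≤ T → (∃ q < D.W, act (T % D.W + 1 + q) i ≠
        D.sched (D.w - q) (x (T % D.W + 1 + q)) i) →
      act 0 j = quantile (D.S i j (act D.W i)) (D.d j) (relPos D.ε (x 0))) ∧
    ((∀ q < D.W, act (T % D.W + 1 + q) i = D.sched (D.w - q) (x (T % D.W + 1 + q)) i) →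
      act 0 j = D.sched (T % D.W) (x 0) j) := by
  obtain ⟨h₁, -, h₃, h₄, h₅, h₆⟩ := D.stateOf_spec T act x
  have hWw : D.W = D.w + 1 := rfl
  have hmod : T % D.W < D.W := Nat.mod_lt _ (Nat.succ_pos _)
  have hacc : ∀ k, (D.stateOf T act x).2.1 = some k → k = i := by
    intro k hk
    by_contra hki
    obtain ⟨m, hm, hmT, hdev, hlater⟩ := h₆ k hk
    have hnone := (D.stateOf_spec (T - m) (fun l => act (l + m)) fun l => x (l + m)).2.2.2.2.1.2
      fun l hl hl' => by
        have := hlater (l + m) (by omega) (by omega)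
        rwa [show T - (l + m) = T - m - l by omega] at this
    have hpos := (D.stateOf_spec (T - m) (fun l => act (l + m)) fun l => x (l + m)).1
    apply hdev
    rw [hact m hmT k hki, out, hnone, hpos]
  have h0 : act 0 j = D.out j (D.stateOf T act x) (x 0) := hact 0 (Nat.zero_le _) j hj
  have hidx : ∀ q : Fin D.W, T % D.W + D.W - (q : ℕ) = T % D.W + 1 + (D.w - q) := by
    intro q; have := q.2; omega
  refine ⟨fun hT => ?_, fun hT hdev => ?_, fun hdev => ?_⟩
  · rw [h0, out, h₁]
    split
    · rfl
    · simp [h₄ hT]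
  · obtain ⟨q, hq, hdev⟩ := hdev
    have hblock : ((D.stateOf T act x).2.2.1 ⟨D.w - q, by omega⟩).1 i ≠
        ((D.stateOf T act x).2.2.1 ⟨D.w - q, by omega⟩).2 i := by
      rw [h₃ hT, hidx]
      simpa [show D.w - (D.w - q) = q by omega] using hdev
    have hsome : (D.stateOf T act x).2.1 = some i := by
      rcases hs : (D.stateOf T act x).2.1 with _ | k
      · exfalso
        have hk : D.W * (T / D.W) = D.W * (T / D.W - 1) + D.W := by
          rw [← Nat.mul_succ, Nat.succ_eq_add_one,
            Nat.sub_add_cancel (Nat.div_pos hT (Nat.succ_pos _))]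
        have hdiv := Nat.mod_add_div T D.W
        have hsub : T - (T % D.W + 1 + q) = D.w - q + D.W * (T / D.W - 1) := by omega
        have hmodq : (T - (T % D.W + 1 + q)) % D.W = D.w - q := by
          rw [hsub, Nat.add_mul_mod_self_left, Nat.mod_eq_of_lt (by omega)]
        apply hdev
        rw [h₅.1 hs (T % D.W + 1 + q) (by omega) (by omega), hmodq]
      · rw [hacc k hs]
    rw [h0, out, hsome]
    simp only
    rw [if_pos ⟨hj, _, hblock⟩, h₃ hT, h₁]
    simp
  · rw [h0, out, h₁]
    split
    · rfl
    · rename_i k hk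
      obtain rfl := hacc k hk
      rw [if_neg]
      rintro ⟨-, q, hq⟩
      by_cases hT : D.W ≤ T
      · rw [h₃ hT, hidx] at hq
        have := hdev (D.w - q) (by omega)
        rw [show D.w - (D.w - (q : ℕ)) = q by have := q.2; omega] at this
        exact hq this
      · simp [h₄ (not_le.1 hT)] at hq

end Punish

section Played
variable {n : ℕ} {A : Fin n → Type*} [∀ j, Fintype (A j)]

theorem Plays.unique {P : Fin n → Tm} {j : Fin n} {r : ℕ → unitInterval} {a b : A j}
    (ha : Plays P j r a) (hb : Plays P j r b) : a = b :=
  actionTm_injective (HaltsWith.unique ha hb)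

open Classical in
/-- The profile that the programs play on one sequence, with default `d`. -/
noncomputable def played (d : ∀ j, A j) (P : Fin n → Tm) (r : ℕ → unitInterval) : ∀ j, A j :=
  fun j => if h : ∃ a : A j, Plays P j r a then h.choose else d j

theorem plays_played {d : ∀ j, A j} {P : Fin n → Tm} {r : ℕ → unitInterval} {j : Fin n}
    (h : ∃ a : A j, Plays P j r a) : Plays P j r (played d P r j) := by
  rw [played, dif_pos h]
  exact h.choose_spec

theorem Plays.played_eq {d : ∀ j, A j} {P : Fin n → Tm} {r : ℕ → unitInterval} {j : Fin n}
    {a : A j} (h : Plays P j r a) : played d P r j = a :=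
  (plays_played ⟨a, h⟩).unique h

theorem dropSeq_dropSeq (k m : ℕ) (r : ℕ → unitInterval) :
    dropSeq k (dropSeq m r) = dropSeq (k + m) r := by
  funext l
  simp [dropSeq, add_assoc]

theorem IsTime.drop {ε : ℝ} {r : ℕ → unitInterval} {T m : ℕ} (h : IsTime ε r T) (hm : m ≤ T) :
    IsTime ε (dropSeq m r) (T - m) := by
  refine ⟨?_, fun l hl => h.2 (l + m) (by omega)⟩
  simpa [dropSeq, Nat.sub_add_cancel hm] using h.1

variable {D : PunishData A} {P : Fin n → Tm} {c : Fin n → Tm} {r : ℕ → unitInterval} {T : ℕ}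

theorem plays_of_isTime (hc : ∀ j, Computes (c j) (D.policy j))
    (hP : ∀ j, (∀ m, ∃ a : A j, Plays P j (dropSeq m r) a) ∨ P j = groundedBot n D.ε (c j))
    (hT : IsTime D.ε r T) (j : Fin n) : ∃ a : A j, Plays P j r a := by
  induction T using Nat.strong_induction_on generalizing r j with
  | _ T ih =>
    rcases hP j with h | h
    · exact h 0
    · refine ⟨_, groundedBot_plays (hc j) h hT (act := fun m => played D.d P (dropSeq m r))
        fun m hm k => plays_played (ih (T - (m + 1)) (by omega) (fun k => ?_) (hT.drop hm) k)⟩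
      refine (hP k).imp_left fun hk l => ?_
      rw [dropSeq_dropSeq]
      exact hk _

theorem played_eq_out (hc : ∀ j, Computes (c j) (D.policy j))
    (hP : ∀ j, (∀ m, ∃ a : A j, Plays P j (dropSeq m r) a) ∨ P j = groundedBot n D.ε (c j))
    (hT : IsTime D.ε r T) {j : Fin n} (hj : P j = groundedBot n D.ε (c j)) {m : ℕ} (hm : m ≤ T) :
    played D.d P (dropSeq m r) j =
      D.out j (D.stateOf (T - m) (fun l => played D.d P (dropSeq (l + m) r)) fun l => r (l + m))
        (r m) := by
  have hP' : ∀ l k, (∀ m, ∃ a : A k, Plays P k (dropSeq m (dropSeq l r)) a) ∨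
      P k = groundedBot n D.ε (c k) := fun l k => (hP k).imp_left fun hk m => by
    rw [dropSeq_dropSeq]
    exact hk _
  have := groundedBot_plays (hc j) hj (hT.drop hm)
    (act := fun l => played D.d P (dropSeq (l + m) r)) fun l hl k => by
      rw [dropSeq_dropSeq]
      exact plays_played (plays_of_isTime hc (hP' _) (hT.drop (m := l + 1 + m) (by omega)) k)
  rw [D.policy_apply j (T - m) _ fun l => (dropSeq m r l : ℝ)] at this
  rw [this.played_eq]
  simp [dropSeq]

end Played

/-! ## Independent uniform sequences -/

/-- The law of a sequence of independent uniform random numbers. -/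
noncomputable def seqLaw : Measure (ℕ → unitInterval) :=
  Measure.infinitePi fun _ => (volume : Measure unitInterval)

instance : IsProbabilityMeasure seqLaw := by unfold seqLaw; infer_instance

/-- A sequence with a new first entry. -/
def consSeq (z : unitInterval × (ℕ → unitInterval)) : ℕ → unitInterval
  | 0 => z.1
  | m + 1 => z.2 m

theorem measurable_consSeq : Measurable consSeq := by
  refine measurable_pi_lambda _ fun m => ?_
  cases m with
  | zero => exact measurable_fst
  | succ m => exact (measurable_pi_apply m).comp measurable_snd

theorem map_consSeq : (volume.prod seqLaw).map consSeq = seqLaw := by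
  refine Measure.eq_infinitePi _ fun s t ht => ?_
  classical
  have hs : consSeq ⁻¹' (Set.pi s t) = (if 0 ∈ s then t 0 else Set.univ) ×ˢ
      Set.pi (s.preimage Nat.succ (Nat.succ_injective.injOn)) (fun m => t (m + 1)) := by
    ext z
    simp only [Set.mem_preimage, Set.mem_pi, Finset.mem_coe, Set.mem_prod, Finset.mem_preimage]
    constructor
    · intro h
      refine ⟨?_, fun m hm => h _ hm⟩
      split_ifs with h0
      · exact h 0 h0
      · trivial
    · rintro ⟨h0, h⟩ (_ | m) hm
      · rw [if_pos hm] at h0; exact h0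
      · exact h m hm
  rw [Measure.map_apply measurable_consSeq
    (MeasurableSet.pi s.countable_toSet fun i _ => ht i), hs, Measure.prod_prod, seqLaw,
    Measure.infinitePi_pi _ fun i _ => ht _,
    Finset.prod_preimage' Nat.succ s Nat.succ_injective.injOn fun m => volume (t m),
    ← Finset.prod_filter_mul_prod_filter_not s (fun m => m ∈ Set.range Nat.succ), mul_comm]
  congr 1
  have : s.filter (fun m => m ∉ Set.range Nat.succ) = if 0 ∈ s then {0} else ∅ := by
    ext m
    rcases m with _ | m
    · split_ifs with h <;> simp [h]
    · split_ifs <;> simp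
  rw [this]
  split_ifs <;> simp

theorem measurable_dropSeq (m : ℕ) : Measurable (dropSeq m) :=
  measurable_pi_lambda _ fun l => measurable_pi_apply (l + m)

theorem measurableSet_head_tail {V : Set unitInterval} {B : Set (ℕ → unitInterval)}
    (hV : MeasurableSet V) (hB : MeasurableSet B) :
    MeasurableSet {r : ℕ → unitInterval | r 0 ∈ V ∧ dropSeq 1 r ∈ B} :=
  (measurable_pi_apply 0 hV).inter (measurable_dropSeq 1 hB)

theorem seqLaw_head_tail {V : Set unitInterval} {B : Set (ℕ → unitInterval)}
    (hV : MeasurableSet V) (hB : MeasurableSet B) :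
    seqLaw.real {r | r 0 ∈ V ∧ dropSeq 1 r ∈ B} = volume.real V * seqLaw.real B := by
  have hm := measurableSet_head_tail hV hB
  have : consSeq ⁻¹' {r | r 0 ∈ V ∧ dropSeq 1 r ∈ B} = V ×ˢ B := by
    ext z
    rfl
  rw [← map_consSeq, map_measureReal_apply measurable_consSeq hm, this, measureReal_prod_prod,
    map_consSeq]

theorem measurePreserving_dropSeq_one : MeasurePreserving (dropSeq 1) seqLaw seqLaw := by
  refine ⟨measurable_dropSeq 1, ?_⟩
  ext B hB
  have := seqLaw_head_tail MeasurableSet.univ hB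
  rw [Measure.map_apply (measurable_dropSeq 1) hB]
  simp only [Set.mem_univ, true_and, probReal_univ, one_mul] at this
  exact (measureReal_eq_measureReal_iff).1 this

theorem measurePreserving_dropSeq (m : ℕ) : MeasurePreserving (dropSeq m) seqLaw seqLaw := by
  induction m with
  | zero => exact MeasurePreserving.id _
  | succ m ih =>
    have : dropSeq (m + 1) = dropSeq m ∘ dropSeq 1 := by
      funext r
      rw [Function.comp, dropSeq_dropSeq]
    rw [this]
    exact ih.comp measurePreserving_dropSeq_one

theorem volume_real_between {α β : ℝ} (h₀ : 0 ≤ α) (h : α ≤ β) (h₁ : β ≤ 1) :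
    volume.real {x : unitInterval | α ≤ (x : ℝ) ∧ (x : ℝ) < β} = β - α := by
  have := unitInterval.volume_Ico (x := ⟨α, h₀, h.trans h₁⟩) (y := ⟨β, h₀.trans h, h₁⟩)
  rw [measureReal_def]
  change (volume (Set.Ico (⟨α, h₀, h.trans h₁⟩ : unitInterval) ⟨β, h₀.trans h, h₁⟩)).toReal = _
  rw [this, ENNReal.toReal_ofReal (sub_nonneg.2 h)]

theorem ae_lt_one : ∀ᵐ r ∂seqLaw, ∀ m, (r m : ℝ) < 1 := by
  rw [ae_all_iff]
  intro m
  have h0 : ∀ᵐ x : unitInterval, (x : ℝ) < 1 := by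
    have h := volume_real_between le_rfl zero_le_one le_rfl
    have hm : MeasurableSet {x : unitInterval | (0 : ℝ) ≤ (x : ℝ) ∧ (x : ℝ) < 1} :=
      (measurableSet_le measurable_const measurable_subtype_coe).inter
        (measurableSet_lt measurable_subtype_coe measurable_const)
    rw [sub_zero] at h
    have h' : volume {x : unitInterval | (0 : ℝ) ≤ (x : ℝ) ∧ (x : ℝ) < 1} = 1 := by
      rw [← ofReal_measureReal, h, ENNReal.ofReal_one]
    filter_upwards [(mem_ae_iff_prob_eq_one hm).2 h'] with x hx
    exact hx.2
  exact (measurePreserving_eval_infinitePi (fun _ => (volume : Measure unitInterval))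
    m).quasiMeasurePreserving.ae h0

section Time
variable {ε : ℝ}

theorem seqLaw_ge (h₀ : 0 ≤ ε) (h₁ : ε ≤ 1) {B : Set (ℕ → unitInterval)} (hB : MeasurableSet B)
    (k : ℕ) : seqLaw.real {r | (∀ m < k, ¬ (r m : ℝ) < ε) ∧ dropSeq k r ∈ B} =
      (1 - ε) ^ k * seqLaw.real B := by
  induction k with
  | zero =>
    simp only [Nat.not_lt_zero, false_implies, implies_true, true_and, pow_zero, one_mul]
    rfl
  | succ k ih =>
    have hV : MeasurableSet {x : unitInterval | ¬ (x : ℝ) < ε} :=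
      (measurableSet_lt measurable_subtype_coe measurable_const).compl
    have hB' : MeasurableSet {r : ℕ → unitInterval |
        (∀ m < k, ¬ (r m : ℝ) < ε) ∧ dropSeq k r ∈ B} := by
      refine MeasurableSet.inter ?_ (measurable_dropSeq k hB)
      have : {r : ℕ → unitInterval | ∀ m < k, ¬ (r m : ℝ) < ε} =
          ⋂ m, ⋂ (_ : m < k), (fun r => r m) ⁻¹' {x : unitInterval | ¬ (x : ℝ) < ε} := by
        ext r; simp
      change MeasurableSet {r : ℕ → unitInterval | ∀ m < k, ¬ (r m : ℝ) < ε}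
      rw [this]
      exact MeasurableSet.iInter fun m => MeasurableSet.iInter fun _ => measurable_pi_apply m hV
    have hvol : volume.real {x : unitInterval | ¬ (x : ℝ) < ε} = 1 - ε := by
      have h := volume_real_between le_rfl h₀ h₁
      rw [sub_zero] at h
      have hm : MeasurableSet {x : unitInterval | (0 : ℝ) ≤ (x : ℝ) ∧ (x : ℝ) < ε} :=
        (measurableSet_le measurable_const measurable_subtype_coe).inter
          (measurableSet_lt measurable_subtype_coe measurable_const)
      have hc := probReal_compl_eq_one_sub hm (μ := volume)
      rw [h] at hc
      rw [← hc]
      congr 1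
      ext x
      simp [x.2.1]
    have : {r : ℕ → unitInterval | (∀ m < k + 1, ¬ (r m : ℝ) < ε) ∧ dropSeq (k + 1) r ∈ B} =
        {r | r 0 ∈ {x : unitInterval | ¬ (x : ℝ) < ε} ∧ dropSeq 1 r ∈
          {r : ℕ → unitInterval | (∀ m < k, ¬ (r m : ℝ) < ε) ∧ dropSeq k r ∈ B}} := by
      ext r
      simp only [Set.mem_ofPred_eq, dropSeq_dropSeq, Nat.forall_lt_succ_left, and_assoc]
      rfl
    rw [this, seqLaw_head_tail hV hB', hvol, ih, pow_succ]
    ring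

/-- The least time at which the sequence is below `ε`. -/
noncomputable def firstTime (ε : ℝ) (r : ℕ → unitInterval) : ℕ := sInf {t | (r t : ℝ) < ε}

theorem isTime_firstTime {r : ℕ → unitInterval} (h : ∃ t, (r t : ℝ) < ε) :
    IsTime ε r (firstTime ε r) :=
  ⟨Nat.sInf_mem (s := {t | (r t : ℝ) < ε}) h, fun _ hm => Nat.notMem_of_lt_sInf hm⟩

theorem IsTime.firstTime_eq {r : ℕ → unitInterval} {T : ℕ} (h : IsTime ε r T) :
    firstTime ε r = T := by
  have h' := isTime_firstTime ⟨T, h.1⟩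
  by_contra hne
  rcases lt_or_gt_of_ne hne with h1 | h1
  · exact h.2 _ h1 h'.1
  · exact h'.2 _ h1 h.1

theorem measurable_firstTime : Measurable (firstTime ε) := by
  refine measurable_to_countable' fun t => ?_
  have hlt : ∀ t, MeasurableSet {r : ℕ → unitInterval | (r t : ℝ) < ε} := fun t =>
    measurableSet_lt (measurable_subtype_coe.comp (measurable_pi_apply t)) measurable_const
  have hT : MeasurableSet {r : ℕ → unitInterval | IsTime ε r t} := by
    have : {r : ℕ → unitInterval | IsTime ε r t} =
        {r | (r t : ℝ) < ε} ∩ ⋂ m, ⋂ (_ : m < t), {r : ℕ → unitInterval | (r m : ℝ) < ε}ᶜ := by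
      ext r; simp [IsTime]
    rw [this]
    exact (hlt t).inter (MeasurableSet.iInter fun m => MeasurableSet.iInter fun _ => (hlt m).compl)
  have hN : MeasurableSet {r : ℕ → unitInterval | t = 0 ∧ ∀ m, ¬ (r m : ℝ) < ε} := by
    have : {r : ℕ → unitInterval | t = 0 ∧ ∀ m, ¬ (r m : ℝ) < ε} =
        {_r : ℕ → unitInterval | t = 0} ∩ ⋂ m, {r : ℕ → unitInterval | (r m : ℝ) < ε}ᶜ := by
      ext r; simp
    rw [this]
    exact (MeasurableSet.const _).inter (MeasurableSet.iInter fun m => (hlt m).compl)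
  have : firstTime ε ⁻¹' {t} = {r : ℕ → unitInterval | IsTime ε r t} ∪
      {r : ℕ → unitInterval | t = 0 ∧ ∀ m, ¬ (r m : ℝ) < ε} := by
    ext r
    simp only [Set.mem_preimage, Set.mem_singleton_iff, Set.mem_union, Set.mem_ofPred_eq]
    refine ⟨fun h => ?_, ?_⟩
    · by_cases hr : ∃ m, (r m : ℝ) < ε
      · exact .inl (h ▸ isTime_firstTime hr)
      · push Not at hr
        refine .inr ⟨?_, fun m => not_lt.2 (hr m)⟩
        rw [← h, firstTime, Nat.sInf_eq_zero]
        right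
        ext m
        simpa using hr m
    · rintro (h | ⟨rfl, h⟩)
      · exact h.firstTime_eq
      · rw [firstTime, Nat.sInf_eq_zero]
        right
        ext m
        simpa using h m
  rw [this]
  exact hT.union hN

theorem ae_isTime (h₀ : 0 < ε) (h₁ : ε ≤ 1) :
    ∀ᵐ r ∂seqLaw, IsTime ε r (firstTime ε r) := by
  have key : seqLaw {r | ∀ t, ¬ (r t : ℝ) < ε} = 0 := by
    refine (measureReal_eq_zero_iff).1 (le_antisymm ?_ measureReal_nonneg)
    refine ge_of_tendsto' (tendsto_pow_atTop_nhds_zero_of_lt_one (r := 1 - ε) (by linarith)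
      (by linarith)) fun k => ?_
    have := seqLaw_ge h₀.le h₁ MeasurableSet.univ k
    rw [probReal_univ, mul_one] at this
    rw [← this]
    exact measureReal_mono fun r hr => ⟨fun m _ => hr m, trivial⟩
  filter_upwards [compl_mem_ae_iff.2 key] with r hr
  exact isTime_firstTime (by simpa using hr)

/-- Dropping `k` entries before the first time below `ε` leaves an independent sequence. -/
theorem seqLaw_le_firstTime (h₀ : 0 < ε) (h₁ : ε ≤ 1) {B : Set (ℕ → unitInterval)}
    (hB : MeasurableSet B) (k : ℕ) :
    seqLaw.real {r | k ≤ firstTime ε r ∧ dropSeq k r ∈ B} = (1 - ε) ^ k * seqLaw.real B := by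
  rw [← seqLaw_ge h₀.le h₁ hB]
  refine measureReal_congr ?_
  filter_upwards [ae_isTime h₀ h₁] with r hr
  refine propext (and_congr_left fun _ => ⟨fun h m hm => hr.2 m (by omega), fun h => ?_⟩)
  by_contra hlt
  exact h _ (not_le.1 hlt) hr.1

theorem firstTime_dropSeq {r : ℕ → unitInterval} (hr : IsTime ε r (firstTime ε r)) {k : ℕ}
    (hk : k ≤ firstTime ε r) : firstTime ε (dropSeq k r) = firstTime ε r - k :=
  (hr.drop hk).firstTime_eq

end Time

/-! ## Independence of the relative position -/

/-- The event `E` is independent of the relative position of the first entry, which is uniform. -/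
def IndepRelPos (ε : ℝ) (E : Set (ℕ → unitInterval)) : Prop :=
  MeasurableSet E ∧ ∀ α β : ℝ, 0 ≤ α → α ≤ β → β ≤ 1 →
    seqLaw.real (E ∩ {r | α ≤ relPos ε (r 0) ∧ relPos ε (r 0) < β}) = (β - α) * seqLaw.real E

theorem measurable_relPos (ε : ℝ) : Measurable (relPos ε) :=
  Measurable.ite (measurableSet_lt measurable_id measurable_const) (by fun_prop) (by fun_prop)

theorem relPos_mem {ε : ℝ} (h₀ : 0 < ε) (h₁ : ε < 1) {x : ℝ} (hx : 0 ≤ x) (hx' : x < 1) :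
    0 ≤ relPos ε x ∧ relPos ε x < 1 := by
  unfold relPos
  split_ifs with h
  · exact ⟨by positivity, (div_lt_one h₀).2 h⟩
  · have : 0 < 1 - ε := by linarith
    exact ⟨div_nonneg (by linarith) this.le, (div_lt_one this).2 (by linarith)⟩

theorem IndepRelPos.union {ε : ℝ} {E F : Set (ℕ → unitInterval)} (hE : IndepRelPos ε E)
    (hF : IndepRelPos ε F) (hEF : Disjoint E F) : IndepRelPos ε (E ∪ F) := by
  refine ⟨hE.1.union hF.1, fun α β h₀ h h₁ => ?_⟩
  have hm : MeasurableSet {r : ℕ → unitInterval | α ≤ relPos ε (r 0) ∧ relPos ε (r 0) < β} := by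
    have : Measurable fun r : ℕ → unitInterval => relPos ε (r 0) :=
      (measurable_relPos ε).comp (measurable_subtype_coe.comp (measurable_pi_apply 0))
    exact (measurableSet_le measurable_const this).inter (measurableSet_lt this measurable_const)
  rw [Set.union_inter_distrib_right, measureReal_union (hEF.mono Set.inter_subset_left
    Set.inter_subset_left) (hF.1.inter hm), hE.2 α β h₀ h h₁, hF.2 α β h₀ h h₁,
    measureReal_union hEF hF.1]
  ring

theorem IndepRelPos.congr {ε : ℝ} {E F : Set (ℕ → unitInterval)} (hE : IndepRelPos ε E)
    (hF : MeasurableSet F) (h : ∀ᵐ r ∂seqLaw, r ∈ E ↔ r ∈ F) : IndepRelPos ε F := by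
  refine ⟨hF, fun α β h₀ h' h₁ => ?_⟩
  have hEF : E =ᵐ[seqLaw] F := by
    filter_upwards [h] with r hr
    exact propext hr
  rw [← measureReal_congr hEF, ← hE.2 α β h₀ h' h₁]
  refine measureReal_congr ?_
  filter_upwards [h] with r hr
  exact propext (and_congr_left fun _ => hr.symm)

theorem indepRelPos_lt {ε : ℝ} (h₀ : 0 < ε) (h₁ : ε < 1) {B : Set (ℕ → unitInterval)}
    (hB : MeasurableSet B) : IndepRelPos ε {r | (r 0 : ℝ) < ε ∧ dropSeq 1 r ∈ B} := by
  have hV : ∀ α β : ℝ, MeasurableSet {x : unitInterval | α ≤ (x : ℝ) ∧ (x : ℝ) < β} := fun α β =>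
    (measurableSet_le measurable_const measurable_subtype_coe).inter
      (measurableSet_lt measurable_subtype_coe measurable_const)
  have hE : {r : ℕ → unitInterval | (r 0 : ℝ) < ε ∧ dropSeq 1 r ∈ B} =
      {r | r 0 ∈ {x : unitInterval | 0 ≤ (x : ℝ) ∧ (x : ℝ) < ε} ∧ dropSeq 1 r ∈ B} := by
    ext r
    exact and_congr_left fun _ => ⟨fun h => ⟨(r 0).2.1, h⟩, fun h => h.2⟩
  rw [hE]
  refine ⟨measurableSet_head_tail (hV _ _) hB, fun α β hα h hβ => ?_⟩
  have : {r : ℕ → unitInterval | r 0 ∈ {x : unitInterval | 0 ≤ (x : ℝ) ∧ (x : ℝ) < ε} ∧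
        dropSeq 1 r ∈ B} ∩ {r | α ≤ relPos ε (r 0) ∧ relPos ε (r 0) < β} =
      {r | r 0 ∈ {x : unitInterval | ε * α ≤ (x : ℝ) ∧ (x : ℝ) < ε * β} ∧ dropSeq 1 r ∈ B} := by
    ext r
    simp only [Set.mem_inter_iff, Set.mem_ofPred_eq]
    constructor
    · rintro ⟨⟨⟨h1, h2⟩, hB⟩, h3, h4⟩
      rw [relPos, if_pos h2] at h3 h4
      rw [le_div_iff₀ h₀] at h3
      rw [div_lt_iff₀ h₀] at h4
      exact ⟨⟨by linarith, by linarith⟩, hB⟩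
    · rintro ⟨⟨h1, h2⟩, hB⟩
      have h5 : (r 0 : ℝ) < ε := by nlinarith
      rw [relPos, if_pos h5, le_div_iff₀ h₀, div_lt_iff₀ h₀]
      exact ⟨⟨⟨(r 0).2.1, h5⟩, hB⟩, by linarith, by linarith⟩
  rw [this, seqLaw_head_tail (hV _ _) hB, seqLaw_head_tail (hV _ _) hB,
    volume_real_between (by positivity) (by nlinarith) (by nlinarith),
    volume_real_between le_rfl h₀.le h₁.le]
  ring

theorem indepRelPos_ge {ε : ℝ} (h₀ : 0 < ε) (h₁ : ε < 1) {B : Set (ℕ → unitInterval)}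
    (hB : MeasurableSet B) : IndepRelPos ε {r | ¬ (r 0 : ℝ) < ε ∧ dropSeq 1 r ∈ B} := by
  have hV : ∀ α β : ℝ, MeasurableSet {x : unitInterval | α ≤ (x : ℝ) ∧ (x : ℝ) < β} := fun α β =>
    (measurableSet_le measurable_const measurable_subtype_coe).inter
      (measurableSet_lt measurable_subtype_coe measurable_const)
  have hE : MeasurableSet {r : ℕ → unitInterval | ¬ (r 0 : ℝ) < ε ∧ dropSeq 1 r ∈ B} :=
    measurableSet_head_tail (V := {x : unitInterval | ¬ (x : ℝ) < ε})
      (measurableSet_lt measurable_subtype_coe measurable_const).compl hB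
  have hε : 0 < 1 - ε := by linarith
  refine ⟨hE, fun α β hα h hβ => ?_⟩
  have : {r : ℕ → unitInterval | ¬ (r 0 : ℝ) < ε ∧ dropSeq 1 r ∈ B} ∩
        {r | α ≤ relPos ε (r 0) ∧ relPos ε (r 0) < β} =
      {r | r 0 ∈ {x : unitInterval | ε + (1 - ε) * α ≤ (x : ℝ) ∧ (x : ℝ) < ε + (1 - ε) * β} ∧
        dropSeq 1 r ∈ B} := by
    ext r
    simp only [Set.mem_inter_iff, Set.mem_ofPred_eq]
    constructor
    · rintro ⟨⟨h2, hB⟩, h3, h4⟩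
      rw [relPos, if_neg h2] at h3 h4
      rw [le_div_iff₀ hε] at h3
      rw [div_lt_iff₀ hε] at h4
      exact ⟨⟨by linarith, by linarith⟩, hB⟩
    · rintro ⟨⟨h1, h2⟩, hB⟩
      have h5 : ¬ (r 0 : ℝ) < ε := by nlinarith
      rw [relPos, if_neg h5, le_div_iff₀ hε, div_lt_iff₀ hε]
      exact ⟨⟨h5, hB⟩, by linarith, by linarith⟩
  have hmass : seqLaw.real {r | ¬ (r 0 : ℝ) < ε ∧ dropSeq 1 r ∈ B} =
      (1 - ε) * seqLaw.real B := by
    have := seqLaw_ge h₀.le h₁.le hB 1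
    simpa [Nat.lt_one_iff] using this
  rw [this, seqLaw_head_tail (hV _ _) hB, hmass,
    volume_real_between (by nlinarith) (by nlinarith) (by nlinarith)]
  ring

section Quantile

theorem quantile_law {α : Type*} [Fintype α] {σ : α → ℝ} (hσ : σ ∈ stdSimplex ℝ α) (d b : α)
    {ε : ℝ} (h₀ : 0 < ε) (h₁ : ε < 1) : ∃ K : ℝ → ℝ, K 1 - K 0 = σ b ∧
      ∀ c l, 0 ≤ c → 0 < l → c + l ≤ 1 → ∀ E, IndepRelPos ε E →
        seqLaw.real (E ∩ {r | quantile σ d (c + l * relPos ε (r 0)) = b}) =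
          seqLaw.real E * ((K (c + l) - K c) / l) := by
  obtain ⟨β, hβ, hβ', hq⟩ := quantile_eq_iff hσ d b
  have hb : 0 ≤ σ b := hσ.1 b
  refine ⟨fun y => max β (min y (β + σ b)), ?_, fun c l hc hl hcl E hE => ?_⟩
  · simp only [max_def, min_def]
    split_ifs <;> linarith
  · set y₁ := max c (min β (c + l)) with hy₁
    set y₂ := max c (min (β + σ b) (c + l)) with hy₂
    have hK : max β (min (c + l) (β + σ b)) - max β (min c (β + σ b)) = y₂ - y₁ := by
      simp only [hy₁, hy₂, max_def, min_def]
      split_ifs <;> linarith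
    have h1 : c ≤ y₁ := le_max_left _ _
    have h2 : y₁ ≤ y₂ := max_le_max le_rfl (min_le_min (by linarith) le_rfl)
    have h3 : y₂ ≤ c + l := max_le (by linarith) (min_le_right _ _)
    have key := hE.2 ((y₁ - c) / l) ((y₂ - c) / l) (div_nonneg (by linarith) hl.le)
      (by gcongr) ((div_le_one hl).2 (by linarith))
    beta_reduce
    rw [hK, show seqLaw.real E * ((y₂ - y₁) / l) = ((y₂ - c) / l - (y₁ - c) / l) * seqLaw.real E by
      ring, ← key]
    refine measureReal_congr ?_
    filter_upwards [ae_lt_one] with r hr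
    refine propext (and_congr_right fun _ => ?_)
    obtain ⟨hu, hu'⟩ := relPos_mem h₀ h₁ (r 0).2.1 (hr 0)
    have hlu : l * relPos ε (r 0) < l := by nlinarith
    have hlu' : 0 ≤ l * relPos ε (r 0) := by positivity
    change (quantile σ d (c + l * relPos ε (r 0)) = b) ↔
      ((y₁ - c) / l ≤ relPos ε (r 0) ∧ relPos ε (r 0) < (y₂ - c) / l)
    rw [hq _ (by linarith) (by linarith), div_le_iff₀' hl, lt_div_iff₀' hl]
    simp only [hy₁, hy₂, max_def, min_def]
    split_ifs <;> constructor <;> rintro ⟨h, h'⟩ <;> constructor <;> linarith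

/-- In a stratified sample, no value is much more frequent than it should be. -/
theorem sum_quantile_le {α : Type*} [Fintype α] [DecidableEq α] {σ : α → ℝ}
    (hσ : σ ∈ stdSimplex ℝ α) (d b : α) {c : ℕ → ℝ} {W : ℕ} {η : ℝ} (hc0 : c 0 = 0) (hcW : c W = 1)
    (hc : Monotone c) (hη : ∀ p, c (p + 1) - c p ≤ η) {y : ℕ → ℝ}
    (hy : ∀ p < W, c p ≤ y p ∧ y p < c (p + 1)) :
    ∑ p ∈ Finset.range W, (if quantile σ d (y p) = b then c (p + 1) - c p else 0) ≤
      σ b + 2 * η := by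
  obtain ⟨β, hβ, hβ', hq⟩ := quantile_eq_iff hσ d b
  have hb : 0 ≤ σ b := hσ.1 b
  have hη0 : 0 ≤ η := (sub_nonneg.2 (hc (Nat.le_succ 0))).trans (hη 0)
  set K : ℝ → ℝ := fun y => max (β - η) (min y (β + σ b + η)) with hK
  have hKm : Monotone K := fun x y h => max_le_max le_rfl (min_le_min h le_rfl)
  calc ∑ p ∈ Finset.range W, (if quantile σ d (y p) = b then c (p + 1) - c p else 0)
      ≤ ∑ p ∈ Finset.range W, (K (c (p + 1)) - K (c p)) := by
        refine Finset.sum_le_sum fun p hp => ?_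
        have hpW := Finset.mem_range.1 hp
        obtain ⟨h1, h2⟩ := hy p hpW
        have h3 := hη p
        split_ifs with h
        · have h0 : 0 ≤ c p := by rw [← hc0]; exact hc (Nat.zero_le _)
          have hc1 : c (p + 1) ≤ 1 := by rw [← hcW]; exact hc hpW
          obtain ⟨h4, h5⟩ := (hq _ (by linarith) (by linarith)).1 h
          simp only [hK]
          rw [min_eq_left (by linarith), min_eq_left (by linarith), max_eq_right (by linarith),
            max_eq_right (by linarith)]
        · exact sub_nonneg.2 (hKm (hc (Nat.le_succ p)))
    _ = K (c W) - K (c 0) := Finset.sum_range_sub (fun p => K (c p)) W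
    _ ≤ σ b + 2 * η := by
        have h1 : K (c W) ≤ β + σ b + η := max_le (by linarith) (min_le_right _ _)
        have h2 : β - η ≤ K (c 0) := le_max_left _ _
        linarith

end Quantile

section Weights
variable {ε : ℝ} {W : ℕ}

theorem one_sub_pow_pos (h₀ : 0 < ε) (h₁ : ε < 1) (hW : 0 < W) : 0 < 1 - (1 - ε) ^ W := by
  have := pow_lt_one₀ (by linarith : 0 ≤ 1 - ε) (by linarith) hW.ne'
  linarith

theorem cumWeight_zero : cumWeight ε W 0 = 0 := by simp [cumWeight]

theorem cumWeight_self (h₀ : 0 < ε) (h₁ : ε < 1) (hW : 0 < W) : cumWeight ε W W = 1 :=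
  div_self (one_sub_pow_pos h₀ h₁ hW).ne'

theorem cumWeight_succ_sub (p : ℕ) : cumWeight ε W (p + 1) - cumWeight ε W p =
    (1 - ε) ^ p * cumWeight ε W 1 := by
  simp only [cumWeight, pow_succ]
  ring

theorem cumWeight_one_pos (h₀ : 0 < ε) (h₁ : ε < 1) (hW : 0 < W) : 0 < cumWeight ε W 1 :=
  div_pos (by linarith) (one_sub_pow_pos h₀ h₁ hW)

theorem cumWeight_sub_pos (h₀ : 0 < ε) (h₁ : ε < 1) (hW : 0 < W) (p : ℕ) :
    0 < cumWeight ε W (p + 1) - cumWeight ε W p := by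
  rw [cumWeight_succ_sub]
  exact mul_pos (pow_pos (by linarith) p) (cumWeight_one_pos h₀ h₁ hW)

theorem cumWeight_mono (h₀ : 0 < ε) (h₁ : ε < 1) (hW : 0 < W) : Monotone (cumWeight ε W) :=
  monotone_nat_of_le_succ fun p => sub_nonneg.1 (cumWeight_sub_pos h₀ h₁ hW p).le

theorem cumWeight_sub_le (h₀ : 0 < ε) (h₁ : ε < 1) (hW : 0 < W) (p : ℕ) :
    cumWeight ε W (p + 1) - cumWeight ε W p ≤ cumWeight ε W 1 := by
  rw [cumWeight_succ_sub]
  exact mul_le_of_le_one_left (cumWeight_one_pos h₀ h₁ hW).le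
    (pow_le_one₀ (by linarith) (by linarith))

end Weights

theorem seqLaw_real_eq_sum {ι : Type*} (s : Finset ι) (F : (ℕ → unitInterval) → ι)
    (hF : ∀ i ∈ s, MeasurableSet {r | F r = i}) {E : Set (ℕ → unitInterval)}
    (h : ∀ r ∈ E, F r ∈ s) : seqLaw.real E = ∑ i ∈ s, seqLaw.real (E ∩ {r | F r = i}) := by
  have h1 := sum_measureReal_preimage_singleton (μ := seqLaw.restrict E) s (f := F) hF
  have h2 : ∀ i ∈ s, (seqLaw.restrict E).real (F ⁻¹' {i}) = seqLaw.real (E ∩ {r | F r = i}) := by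
    intro i hi
    have hm : MeasurableSet (F ⁻¹' {i}) := hF i hi
    rw [measureReal_restrict_apply hm, Set.inter_comm]
    rfl
  have hm : MeasurableSet (F ⁻¹' s) := by
    have : F ⁻¹' s = ⋃ i ∈ s, {r | F r = i} := by
      ext r; simp
    rw [this]
    exact Finset.measurableSet_biUnion s hF
  have hE : F ⁻¹' s ∩ E = E := Set.inter_eq_right.2 fun r hr => h r hr
  rw [← Finset.sum_congr rfl h2, h1, measureReal_restrict_apply hm, hE]

theorem succ_mod_succ (t w : ℕ) :
    (t + 1) % (w + 1) = if t % (w + 1) = w then 0 else t % (w + 1) + 1 := by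
  have h := Nat.mod_lt t (show 0 < w + 1 by omega)
  rw [← Nat.mod_add_mod]
  split_ifs with h'
  · rw [h', Nat.mod_self]
  · exact Nat.mod_eq_of_lt (by omega)

section Position
variable {ε : ℝ} {w : ℕ}

theorem measurableSet_pos (W p : ℕ) : MeasurableSet {r | firstTime ε r % W = p} :=
  measurable_firstTime ((MeasurableSet.of_discrete (s := {t | t % W = p})))

/-- The positions in a block are related by dropping entries. -/
theorem seqLaw_pos_drop (h₀ : 0 < ε) (h₁ : ε < 1) {p m : ℕ} (hpm : p + m ≤ w) {B : Set (ℕ → unitInterval)}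
    (hB : MeasurableSet B) :
    seqLaw.real {r | firstTime ε r % (w + 1) = p + m ∧ dropSeq m r ∈ B} =
      (1 - ε) ^ m * seqLaw.real {r | firstTime ε r % (w + 1) = p ∧ r ∈ B} := by
  have hpB : MeasurableSet {r | firstTime ε r % (w + 1) = p ∧ r ∈ B} :=
    (measurableSet_pos (w + 1) p).inter hB
  rw [← seqLaw_le_firstTime h₀ h₁.le hpB]
  refine measureReal_congr ?_
  filter_upwards [ae_isTime h₀ h₁.le] with r hr
  refine propext ?_
  change (firstTime ε r % (w + 1) = p + m ∧ dropSeq m r ∈ B) ↔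
    (m ≤ firstTime ε r ∧ firstTime ε (dropSeq m r) % (w + 1) = p ∧ dropSeq m r ∈ B)
  constructor
  · rintro ⟨h, hB⟩
    have hm : m ≤ firstTime ε r := le_trans (by omega) (h ▸ Nat.mod_le (firstTime ε r) (w + 1))
    refine ⟨hm, ?_, hB⟩
    rw [firstTime_dropSeq hr hm]
    have hdiv := Nat.mod_add_div (firstTime ε r) (w + 1)
    rw [show firstTime ε r - m = p + (w + 1) * (firstTime ε r / (w + 1)) by omega,
      Nat.add_mul_mod_self_left, Nat.mod_eq_of_lt (by omega)]
  · rintro ⟨hm, h, hB⟩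
    rw [firstTime_dropSeq hr hm] at h
    refine ⟨?_, hB⟩
    have : firstTime ε r = (firstTime ε r - m) + m := by omega
    rw [this, Nat.add_mod, h, ← Nat.add_mod_mod, Nat.mod_mod, Nat.add_mod_mod,
      Nat.mod_eq_of_lt (by omega)]

theorem seqLaw_pos (h₀ : 0 < ε) (h₁ : ε < 1) {p : ℕ} (hp : p ≤ w) : seqLaw.real {r | firstTime ε r % (w + 1) = p} =
    cumWeight ε (w + 1) (p + 1) - cumWeight ε (w + 1) p := by
  have h : ∀ p ≤ w, seqLaw.real {r | firstTime ε r % (w + 1) = p} =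
      (1 - ε) ^ p * seqLaw.real {r | firstTime ε r % (w + 1) = 0} := by
    intro p hp
    have := seqLaw_pos_drop h₀ h₁ (p := 0) (m := p) (w := w) (by omega) MeasurableSet.univ
    simpa using this
  have hsum := seqLaw_real_eq_sum (Finset.range (w + 1)) (fun r => firstTime ε r % (w + 1))
    (fun p _ => measurableSet_pos (w + 1) p) (E := Set.univ)
    fun r _ => Finset.mem_range.2 (Nat.mod_lt _ (Nat.succ_pos w))
  have hW := one_sub_pow_pos h₀ h₁ (Nat.succ_pos w)
  rw [probReal_univ, Finset.sum_congr rfl fun p hp => by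
    rw [Set.univ_inter, h p (by simpa [Nat.lt_succ_iff] using hp)], ← Finset.sum_mul,
    geom_sum_eq (by linarith)] at hsum
  rw [h p hp, cumWeight_succ_sub]
  congr 1
  rw [cumWeight, eq_div_iff hW.ne']
  have hε : 1 - ε - 1 ≠ 0 := by linarith
  rw [div_mul_eq_mul_div, eq_div_iff hε] at hsum
  rw [Nat.succ_eq_add_one]
  linarith

theorem indepRelPos_le_firstTime (h₀ : 0 < ε) (h₁ : ε < 1) {B : Set (ℕ → unitInterval)} (hB : MeasurableSet B) (k : ℕ) :
    IndepRelPos ε {r | k + 1 ≤ firstTime ε r ∧ dropSeq (k + 1) r ∈ B} := by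
  have hm : ∀ k, MeasurableSet {r | k ≤ firstTime ε r ∧ dropSeq k r ∈ B} := fun k =>
    (measurable_firstTime ((MeasurableSet.of_discrete (s := {t | k ≤ t})))).inter (measurable_dropSeq k hB)
  refine (indepRelPos_ge h₀ h₁ (hm k)).congr (hm (k + 1)) ?_
  filter_upwards [ae_isTime h₀ h₁.le] with r hr
  simp only [dropSeq_dropSeq]
  rw [← and_assoc]
  refine and_congr_left fun _ => ⟨fun ⟨h, h'⟩ => ?_, fun h => ?_⟩
  · have h1 : 1 ≤ firstTime ε r := by
      by_contra hlt
      have := hr.1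
      rw [Nat.lt_one_iff.1 (not_le.1 hlt)] at this
      exact h this
    rw [firstTime_dropSeq hr h1] at h'
    omega
  · refine ⟨hr.2 0 (by omega), ?_⟩
    rw [firstTime_dropSeq hr (by omega)]
    omega

theorem indepRelPos_pos (h₀ : 0 < ε) (h₁ : ε < 1) {p : ℕ} (hp : p ≤ w) :
    IndepRelPos ε {r | firstTime ε r % (w + 1) = p} := by
  have hlast := indepRelPos_le_firstTime h₀ h₁ (measurableSet_pos (ε := ε) (w + 1) w) 0
  rcases p with _ | p
  · refine ((indepRelPos_lt h₀ h₁ MeasurableSet.univ).union hlast ?_).congr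
      (measurableSet_pos (w + 1) 0) ?_
    · rw [Set.disjoint_left]
      rintro r ⟨h, -⟩ ⟨h', -⟩
      have : IsTime ε r 0 := ⟨h, fun m hm => absurd hm (Nat.not_lt_zero m)⟩
      rw [this.firstTime_eq] at h'
      omega
    · filter_upwards [ae_isTime h₀ h₁.le] with r hr
      change ((r 0 : ℝ) < ε ∧ True) ∨ (1 ≤ firstTime ε r ∧
        firstTime ε (dropSeq 1 r) % (w + 1) = w) ↔ firstTime ε r % (w + 1) = 0
      rcases Nat.eq_zero_or_pos (firstTime ε r) with h | h
      · rw [h] at hr ⊢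
        simpa using hr.1
      · rw [firstTime_dropSeq hr h]
        obtain ⟨t, ht⟩ : ∃ t, firstTime ε r = t + 1 := ⟨firstTime ε r - 1, by omega⟩
        have h0 : ¬ (r 0 : ℝ) < ε := hr.2 0 h
        rw [ht, Nat.add_sub_cancel, succ_mod_succ]
        simp [h0]
  · refine (indepRelPos_le_firstTime h₀ h₁ (measurableSet_pos (ε := ε) (w + 1) p) 0).congr
      (measurableSet_pos (w + 1) (p + 1)) ?_
    filter_upwards [ae_isTime h₀ h₁.le] with r hr
    change (1 ≤ firstTime ε r ∧ firstTime ε (dropSeq 1 r) % (w + 1) = p) ↔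
      firstTime ε r % (w + 1) = p + 1
    rcases Nat.eq_zero_or_pos (firstTime ε r) with h | h
    · simp [h]
    · rw [firstTime_dropSeq hr h]
      obtain ⟨t, ht⟩ : ∃ t, firstTime ε r = t + 1 := ⟨firstTime ε r - 1, by omega⟩
      rw [ht, Nat.add_sub_cancel, succ_mod_succ]
      have := Nat.mod_lt t (show 0 < w + 1 by omega)
      split_ifs with h'
      · exact ⟨fun h => by omega, fun h => h.elim⟩
      · exact ⟨fun h => by rw [h.2], fun h => ⟨by omega, by omega⟩⟩

end Position

section Law
variable {n : ℕ} {A : Fin n → Type*} [∀ j, Fintype (A j)]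

theorem measurableSet_quantileAux {α : Type*} (σ : α → ℝ) (d : α) (l : List α) (b : α) :
    MeasurableSet {y : ℝ | quantileAux σ d l y = b} := by
  classical
  induction l with
  | nil => exact MeasurableSet.const (d = b)
  | cons a l ih =>
    have hsub : MeasurableSet {y : ℝ | quantileAux σ d l (y - σ a) = b} :=
      (measurable_id.sub_const (σ a)) ih
    have : {y : ℝ | quantileAux σ d (a :: l) y = b} =
        ({y : ℝ | y < σ a} ∩ {_y : ℝ | a = b}) ∪
          ({y : ℝ | y < σ a}ᶜ ∩ {y : ℝ | quantileAux σ d l (y - σ a) = b}) := by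
      ext y
      simp only [Set.mem_ofPred_eq, Set.mem_union, Set.mem_inter_iff, Set.mem_compl_iff,
        quantileAux]
      split_ifs with h <;> simp [h]
    have hlt : MeasurableSet {y : ℝ | y < σ a} := measurableSet_lt measurable_id measurable_const
    rw [this]
    exact (hlt.inter (MeasurableSet.const _)).union (hlt.compl.inter hsub)

variable (D : PunishData A)

theorem PunishData.measurableSet_sched (p q : ℕ) (j : Fin n) (b : A j) :
    MeasurableSet {r : ℕ → unitInterval | D.sched p (r q) j = b} := by
  have h1 : Measurable fun r : ℕ → unitInterval =>
      cumWeight D.ε D.W p + (cumWeight D.ε D.W (p + 1) - cumWeight D.ε D.W p) * relPos D.ε (r q) :=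
    (((measurable_relPos D.ε).comp (measurable_subtype_coe.comp (measurable_pi_apply q))).const_mul
      _).const_add _
  exact h1 (measurableSet_quantileAux _ _ _ b)

/-- The weight of a position in a block. -/
noncomputable def PunishData.ℓ (p : ℕ) : ℝ := cumWeight D.ε D.W (p + 1) - cumWeight D.ε D.W p

/-- The ratio between the probability of a block and that of its last position. -/
noncomputable def PunishData.κ : ℝ := ((1 - D.ε) ^ D.w * cumWeight D.ε D.W 1)⁻¹

/-- The parameters of the data are admissible. -/
structure PunishData.Good : Prop where
  pos : 0 < D.ε
  lt_one : D.ε < 1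
  s_mem : ∀ j, D.s j ∈ stdSimplex ℝ (A j)
  S_mem : ∀ i j a, D.S i j a ∈ stdSimplex ℝ (A j)

variable {D}

theorem PunishData.Good.κ_mul (hD : D.Good) {p : ℕ} (hp : p ≤ D.w) :
    D.κ * D.ℓ p * (1 - D.ε) ^ (D.w - p) = 1 := by
  have h1 : 0 < 1 - D.ε := by linarith [hD.lt_one]
  have h2 := cumWeight_one_pos hD.pos hD.lt_one (Nat.succ_pos D.w)
  have h3 : (1 - D.ε) ^ D.w = (1 - D.ε) ^ p * (1 - D.ε) ^ (D.w - p) := by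
    rw [← pow_add, Nat.add_sub_cancel' hp]
  rw [ℓ, cumWeight_succ_sub, κ, h3]
  have h4 := (pow_pos h1 p).ne'
  have h5 := (pow_pos h1 (D.w - p)).ne'
  have h6 := h2.ne'
  simp only [Nat.succ_eq_add_one] at h6
  field_simp

theorem PunishData.Good.κ_pos (hD : D.Good) : 0 < D.κ :=
  inv_pos.2 (mul_pos (pow_pos (by linarith [hD.lt_one]) _)
    (cumWeight_one_pos hD.pos hD.lt_one (Nat.succ_pos D.w)))

theorem PunishData.Good.ℓ_pos (hD : D.Good) (p : ℕ) : 0 < D.ℓ p :=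
  cumWeight_sub_pos hD.pos hD.lt_one (Nat.succ_pos D.w) p

theorem PunishData.Good.sum_ℓ (hD : D.Good) : ∑ p ∈ Finset.range D.W, D.ℓ p = 1 := by
  simp only [ℓ]
  rw [Finset.sum_range_sub (fun p => cumWeight D.ε D.W p), cumWeight_zero,
    cumWeight_self hD.pos hD.lt_one (Nat.succ_pos D.w), sub_zero]

theorem PunishData.Good.pow_eq (hD : D.Good) {p : ℕ} (hp : p ≤ D.w) :
    (1 - D.ε) ^ (p + 1) = (1 - D.ε) ^ D.W * (D.κ * D.ℓ p) := by
  have h := hD.κ_mul hp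
  have h3 : (1 - D.ε) ^ D.W = (1 - D.ε) ^ (p + 1) * (1 - D.ε) ^ (D.w - p) := by
    rw [← pow_add, W]
    congr 1
    omega
  rw [h3]
  linear_combination (-(1 - D.ε) ^ (p + 1)) * h

/-- The law of the schedule at a position. -/
theorem PunishData.Good.sched_law (hD : D.Good) (j : Fin n) (b : A j) : ∃ τ : ℕ → ℝ,
    ∑ p ∈ Finset.range D.W, D.ℓ p * τ p = D.s j b ∧ ∀ p ≤ D.w, ∀ E, IndepRelPos D.ε E →
      seqLaw.real (E ∩ {r | D.sched p (r 0) j = b}) = seqLaw.real E * τ p := by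
  obtain ⟨K, hK, hE⟩ := quantile_law (hD.s_mem j) (D.d j) b hD.pos hD.lt_one
  have hmono := cumWeight_mono hD.pos hD.lt_one (Nat.succ_pos D.w)
  have hself := cumWeight_self hD.pos hD.lt_one (Nat.succ_pos D.w)
  refine ⟨fun p => (K (cumWeight D.ε D.W (p + 1)) - K (cumWeight D.ε D.W p)) / D.ℓ p, ?_,
    fun p hp E hEi => ?_⟩
  · have : ∀ p ∈ Finset.range D.W, D.ℓ p * ((K (cumWeight D.ε D.W (p + 1)) -
        K (cumWeight D.ε D.W p)) / D.ℓ p) =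
        K (cumWeight D.ε D.W (p + 1)) - K (cumWeight D.ε D.W p) := fun p _ =>
      mul_div_cancel₀ _ (hD.ℓ_pos p).ne'
    rw [Finset.sum_congr rfl this, Finset.sum_range_sub (fun p => K (cumWeight D.ε D.W p)),
      cumWeight_zero, hself, hK]
  · have h0 : 0 ≤ cumWeight D.ε D.W p := by
      rw [← cumWeight_zero (ε := D.ε) (W := D.W)]; exact hmono (Nat.zero_le p)
    have h1 : cumWeight D.ε D.W p + D.ℓ p = cumWeight D.ε D.W (p + 1) := by rw [ℓ]; ring
    have h2 : cumWeight D.ε D.W (p + 1) ≤ 1 := by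
      rw [← hself]; exact hmono (Nat.succ_le_succ hp)
    have := hE _ _ h0 (hD.ℓ_pos p) (h1.trans_le h2) E hEi
    rw [h1] at this
    exact this

theorem PunishData.Good.indep_pos (hD : D.Good) {p : ℕ} (hp : p ≤ D.w) :
    IndepRelPos D.ε {r | firstTime D.ε r % D.W = p} := indepRelPos_pos hD.pos hD.lt_one hp

theorem PunishData.Good.real_pos (hD : D.Good) {p : ℕ} (hp : p ≤ D.w) :
    seqLaw.real {r | firstTime D.ε r % D.W = p} = D.ℓ p := seqLaw_pos hD.pos hD.lt_one hp

theorem PunishData.real_eq_sum_pos (D : PunishData A) (E : Set (ℕ → unitInterval)) :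
    seqLaw.real E =
      ∑ p ∈ Finset.range D.W, seqLaw.real (E ∩ {r | firstTime D.ε r % D.W = p}) :=
  seqLaw_real_eq_sum _ _ (fun p _ => measurableSet_pos _ p)
    fun _ _ => Finset.mem_range.2 (Nat.mod_lt _ (Nat.succ_pos _))

/-- The schedule has the intended law. -/
theorem PunishData.Good.sched_total (hD : D.Good) (j : Fin n) (b : A j) :
    ∑ p ∈ Finset.range D.W, seqLaw.real ({r | firstTime D.ε r % D.W = p} ∩
      {r | D.sched p (r 0) j = b}) = D.s j b := by
  obtain ⟨τ, hτ, hE⟩ := hD.sched_law j b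
  rw [← hτ]
  refine Finset.sum_congr rfl fun p hp => ?_
  have hp' : p ≤ D.w := Nat.lt_succ_iff.1 (Finset.mem_range.1 hp)
  rw [hE p hp' _ (hD.indep_pos hp'), hD.real_pos hp']

variable {F : (ℕ → unitInterval) → ∀ j, A j} {i : Fin n}

/-- In the block that ends here, player `i` plays something that is not scheduled. -/
def PunishData.devSet (D : PunishData A) (F : (ℕ → unitInterval) → ∀ j, A j) (i : Fin n) :
    Set (ℕ → unitInterval) :=
  {r | ∃ q < D.W, F (dropSeq q r) i ≠ D.sched (D.w - q) (r q) i}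

/-- A block ends here in which player `i` plays something that is not scheduled. -/
def PunishData.devEnd (D : PunishData A) (F : (ℕ → unitInterval) → ∀ j, A j) (i : Fin n) :
    Set (ℕ → unitInterval) :=
  {r | firstTime D.ε r % D.W = D.w ∧ r ∈ D.devSet F i}

/-- How often `i` plays `a` in blocks with deviations. -/
noncomputable def PunishData.devLaw (D : PunishData A) (F : (ℕ → unitInterval) → ∀ j, A j)
    (i : Fin n) (a : A i) : ℝ :=
  ∑ p ∈ Finset.range D.W, D.κ * D.ℓ p *
    seqLaw.real (D.devEnd F i ∩ {r | F (dropSeq (D.w - p) r) i = a})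

/-- How often `a` is scheduled for `i` in blocks with deviations. -/
noncomputable def PunishData.schedLaw (D : PunishData A) (F : (ℕ → unitInterval) → ∀ j, A j)
    (i : Fin n) (a : A i) : ℝ :=
  ∑ p ∈ Finset.range D.W, D.κ * D.ℓ p *
    seqLaw.real (D.devEnd F i ∩ {r | D.sched p (r (D.w - p)) i = a})

/-- The probability of blocks with deviations. -/
noncomputable def PunishData.devProb (D : PunishData A) (F : (ℕ → unitInterval) → ∀ j, A j)
    (i : Fin n) : ℝ := D.κ * seqLaw.real (D.devEnd F i)

theorem PunishData.measurableSet_devSet (hF : ∀ a, MeasurableSet {r | F r i = a}) :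
    MeasurableSet (D.devSet F i) := by
  classical
  have : D.devSet F i = ⋃ q, ⋃ (_ : q < D.W), (⋃ a, {r | F (dropSeq q r) i = a} ∩
      {r : ℕ → unitInterval | D.sched (D.w - q) (r q) i = a})ᶜ := by
    ext r
    simp [devSet, eq_comm]
  rw [this]
  refine MeasurableSet.iUnion fun q => MeasurableSet.iUnion fun _ => MeasurableSet.compl ?_
  refine MeasurableSet.iUnion fun a => ?_
  exact MeasurableSet.inter (measurable_dropSeq q (hF a)) (D.measurableSet_sched _ _ _ _)

theorem PunishData.measurableSet_devEnd (hF : ∀ a, MeasurableSet {r | F r i = a}) :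
    MeasurableSet (D.devEnd F i) :=
  (measurableSet_pos _ _).inter (measurableSet_devSet hF)

theorem PunishData.Good.sum_devLaw (hD : D.Good) (hF : ∀ a, MeasurableSet {r | F r i = a}) :
    ∑ a, D.devLaw F i a = D.devProb F i := by
  simp only [devLaw]
  rw [Finset.sum_comm]
  have : ∀ p ∈ Finset.range D.W, ∑ a, D.κ * D.ℓ p *
      seqLaw.real (D.devEnd F i ∩ {r | F (dropSeq (D.w - p) r) i = a}) =
      D.ℓ p * D.devProb F i := by
    intro p _
    rw [← Finset.mul_sum, ← seqLaw_real_eq_sum Finset.univ (fun r => F (dropSeq (D.w - p) r) i)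
      (fun a _ => measurable_dropSeq _ (hF a)) (fun _ _ => Finset.mem_univ _), devProb]
    ring
  rw [Finset.sum_congr rfl this, ← Finset.sum_mul, hD.sum_ℓ, one_mul]

theorem PunishData.Good.sum_schedLaw (hD : D.Good) : ∑ a, D.schedLaw F i a = D.devProb F i := by
  simp only [schedLaw]
  rw [Finset.sum_comm]
  have : ∀ p ∈ Finset.range D.W, ∑ a, D.κ * D.ℓ p *
      seqLaw.real (D.devEnd F i ∩ {r | D.sched p (r (D.w - p)) i = a}) =
      D.ℓ p * D.devProb F i := by
    intro p _
    rw [← Finset.mul_sum, ← seqLaw_real_eq_sum Finset.univ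
      (fun r : ℕ → unitInterval => D.sched p (r (D.w - p)) i)
      (fun a _ => D.measurableSet_sched _ _ _ _) (fun _ _ => Finset.mem_univ _), devProb]
    ring
  rw [Finset.sum_congr rfl this, ← Finset.sum_mul, hD.sum_ℓ, one_mul]

theorem PunishData.Good.devProb_nonneg (hD : D.Good) : 0 ≤ D.devProb F i :=
  mul_nonneg hD.κ_pos.le measureReal_nonneg

theorem PunishData.Good.devLaw_nonneg (hD : D.Good) (a : A i) : 0 ≤ D.devLaw F i a :=
  Finset.sum_nonneg fun p _ =>
    mul_nonneg (mul_nonneg hD.κ_pos.le (hD.ℓ_pos p).le) measureReal_nonneg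

theorem PunishData.Good.devProb_le_one (hD : D.Good) : D.devProb F i ≤ 1 := by
  have h := hD.κ_mul (le_refl D.w)
  rw [Nat.sub_self, pow_zero, mul_one, ← hD.real_pos le_rfl] at h
  rw [devProb, ← h]
  exact mul_le_mul_of_nonneg_left (measureReal_mono fun r hr => hr.1) hD.κ_pos.le

/-- The law of the actions of the deviating player. -/
theorem PunishData.Good.law_deviator (hD : D.Good) (hF : ∀ a, MeasurableSet {r | F r i = a})
    (a : A i) :
    seqLaw.real {r | F r i = a} = D.s i a + D.devLaw F i a - D.schedLaw F i a := by
  rw [D.real_eq_sum_pos, ← hD.sched_total i a, devLaw, schedLaw, ← Finset.sum_add_distrib,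
    ← Finset.sum_sub_distrib]
  refine Finset.sum_congr rfl fun p hp => ?_
  have hp' : p ≤ D.w := Nat.lt_succ_iff.1 (Finset.mem_range.1 hp)
  have hm := measurableSet_devEnd (D := D) hF
  have hscale : ∀ B : Set (ℕ → unitInterval), MeasurableSet B →
      seqLaw.real {r | firstTime D.ε r % D.W = p ∧ r ∈ B} = D.κ * D.ℓ p *
        seqLaw.real {r | firstTime D.ε r % D.W = D.w ∧ dropSeq (D.w - p) r ∈ B} := by
    intro B hB
    have := seqLaw_pos_drop hD.pos hD.lt_one (w := D.w) (p := p) (m := D.w - p) (by omega) hB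
    rw [Nat.add_sub_cancel' hp'] at this
    rw [this, ← mul_assoc, hD.κ_mul hp', one_mul]
  have hs : MeasurableSet {r : ℕ → unitInterval | D.sched p (r 0) i = a} :=
    D.measurableSet_sched _ _ _ _
  have h1 := hscale _ (hF a)
  have h2 := hscale _ hs
  have e1 : {r | F r i = a} ∩ {r | firstTime D.ε r % D.W = p} =
      {r | firstTime D.ε r % D.W = p ∧ r ∈ {r | F r i = a}} := Set.inter_comm _ _
  have e2 : {r | firstTime D.ε r % D.W = p} ∩ {r | D.sched p (r 0) i = a} =
      {r | firstTime D.ε r % D.W = p ∧ r ∈ {r : ℕ → unitInterval | D.sched p (r 0) i = a}} := rfl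
  rw [e1, e2, h1, h2, ← mul_add, ← mul_sub]
  congr 1
  have hsplit : ∀ V : Set (ℕ → unitInterval),
      seqLaw.real {r | firstTime D.ε r % D.W = D.w ∧ r ∈ V} =
      seqLaw.real (D.devEnd F i ∩ V) +
        seqLaw.real ({r | firstTime D.ε r % D.W = D.w ∧ r ∈ V} \ D.devEnd F i) := by
    intro V
    rw [← measureReal_inter_add_sdiff (s := {r | firstTime D.ε r % D.W = D.w ∧ r ∈ V}) hm]
    congr 2
    ext r
    exact ⟨fun h => ⟨h.2, h.1.2⟩, fun h => ⟨⟨h.1.1, h.2⟩, h.1⟩⟩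
  have k1 := hsplit {r | dropSeq (D.w - p) r ∈ {r | F r i = a}}
  have k2 := hsplit {r | dropSeq (D.w - p) r ∈ {r : ℕ → unitInterval | D.sched p (r 0) i = a}}
  have hd0 : ∀ r, dropSeq (D.w - p) r 0 = r (D.w - p) := fun r => by simp [dropSeq]
  have k3 : {r | firstTime D.ε r % D.W = D.w ∧ r ∈ {r | dropSeq (D.w - p) r ∈ {r | F r i = a}}} \
      D.devEnd F i = {r | firstTime D.ε r % D.W = D.w ∧ r ∈ {r | dropSeq (D.w - p) r ∈
        {r : ℕ → unitInterval | D.sched p (r 0) i = a}}} \ D.devEnd F i := by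
    ext r
    refine and_congr_left fun hr => and_congr_right fun hpos => ?_
    have hnd : F (dropSeq (D.w - p) r) i = D.sched p (r (D.w - p)) i := by
      by_contra hne
      refine hr ⟨hpos, D.w - p, Nat.lt_succ_of_le (Nat.sub_le _ _), ?_⟩
      rwa [Nat.sub_sub_self hp']
    change F (dropSeq (D.w - p) r) i = a ↔ D.sched p (dropSeq (D.w - p) r 0) i = a
    rw [hnd, hd0]
  rw [k3] at k1
  have e3 : {r | dropSeq (D.w - p) r ∈ {r : ℕ → unitInterval | D.sched p (r 0) i = a}} =
      {r | D.sched p (r (D.w - p)) i = a} := by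
    ext r
    change D.sched p (dropSeq (D.w - p) r 0) i = a ↔ _
    rw [hd0]
    rfl
  rw [e3] at k1 k2
  have e4 : {r | firstTime D.ε r % D.W = D.w ∧ dropSeq (D.w - p) r ∈
      {r : ℕ → unitInterval | D.sched p (r 0) i = a}} = {r | firstTime D.ε r % D.W = D.w ∧
        r ∈ {r : ℕ → unitInterval | D.sched p (r (D.w - p)) i = a}} := by
    rw [← e3]; rfl
  rw [e4]
  have k1' : seqLaw.real {r | firstTime D.ε r % D.W = D.w ∧
      dropSeq (D.w - p) r ∈ {r | F r i = a}} = seqLaw.real (D.devEnd F i ∩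
        {r | F (dropSeq (D.w - p) r) i = a}) + _ := k1
  linarith

end Law

section Law
variable {n : ℕ} {A : Fin n → Type*} [∀ j, Fintype (A j)] {D : PunishData A}
  {F : (ℕ → unitInterval) → ∀ j, A j} {i : Fin n}

/-- Within every block, the schedule is close to the intended strategy. -/
theorem PunishData.Good.schedLaw_le (hD : D.Good) (hF : ∀ a, MeasurableSet {r | F r i = a})
    (a : A i) :
    D.schedLaw F i a ≤ D.devProb F i * (D.s i a + 2 * cumWeight D.ε D.W 1) := by
  classical
  set B := D.devEnd F i with hB
  have hBm : MeasurableSet B := measurableSet_devEnd hF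
  set E : ℕ → Set (ℕ → unitInterval) := fun p => {r | D.sched p (r (D.w - p)) i = a} with hE
  have hEm : ∀ p, MeasurableSet (E p) := fun p => D.measurableSet_sched _ _ _ _
  have hint : ∀ p, Integrable ((E p).indicator fun _ => D.ℓ p) (seqLaw.restrict B) := fun p =>
    (integrable_const _).indicator (hEm p)
  have h1 : ∑ p ∈ Finset.range D.W, D.ℓ p * seqLaw.real (B ∩ E p) =
      ∫ r in B, ∑ p ∈ Finset.range D.W, (E p).indicator (fun _ => D.ℓ p) r ∂seqLaw := by
    rw [integral_finsetSum _ fun p _ => hint p]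
    refine Finset.sum_congr rfl fun p _ => ?_
    rw [integral_indicator_const _ (hEm p), measureReal_restrict_apply (hEm p), Set.inter_comm,
      smul_eq_mul, mul_comm]
  have h2 : ∫ r in B, ∑ p ∈ Finset.range D.W, (E p).indicator (fun _ => D.ℓ p) r ∂seqLaw ≤
      ∫ _ in B, (D.s i a + 2 * cumWeight D.ε D.W 1) ∂seqLaw := by
    refine integral_mono_ae (integrable_finsetSum _ fun p _ => hint p) (integrable_const _) ?_
    refine ae_restrict_of_ae ?_
    filter_upwards [ae_lt_one] with r hr
    have := sum_quantile_le (hD.s_mem i) (D.d i) a (c := cumWeight D.ε D.W) (W := D.W)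
      cumWeight_zero (cumWeight_self hD.pos hD.lt_one (Nat.succ_pos _))
      (cumWeight_mono hD.pos hD.lt_one (Nat.succ_pos _))
      (cumWeight_sub_le hD.pos hD.lt_one (Nat.succ_pos _))
      (y := fun p => cumWeight D.ε D.W p + (cumWeight D.ε D.W (p + 1) - cumWeight D.ε D.W p) *
        relPos D.ε (r (D.w - p))) fun p _ => by
          obtain ⟨h, h'⟩ := relPos_mem hD.pos hD.lt_one (r (D.w - p)).2.1 (hr _)
          have := hD.ℓ_pos p
          rw [ℓ] at this
          constructor <;> nlinarith
    refine le_trans (le_of_eq (Finset.sum_congr rfl fun p _ => ?_)) this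
    rfl
  rw [setIntegral_const, smul_eq_mul, ← h1] at h2
  have h3 : D.schedLaw F i a = D.κ * ∑ p ∈ Finset.range D.W, D.ℓ p * seqLaw.real (B ∩ E p) := by
    rw [schedLaw, Finset.mul_sum]
    exact Finset.sum_congr rfl fun p _ => mul_assoc _ _ _
  rw [h3, devProb, mul_assoc]
  exact mul_le_mul_of_nonneg_left h2 hD.κ_pos.le

theorem PunishData.Good.abs_sub_schedLaw_le (hD : D.Good)
    (hF : ∀ a, MeasurableSet {r | F r i = a}) (a : A i) :
    |D.devProb F i * D.s i a - D.schedLaw F i a| ≤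
      2 * cumWeight D.ε D.W 1 * Fintype.card (A i) * D.devProb F i := by
  classical
  set η := 2 * cumWeight D.ε D.W 1 * D.devProb F i with hη
  have hη0 : 0 ≤ η := mul_nonneg (mul_nonneg zero_le_two
    (cumWeight_one_pos hD.pos hD.lt_one (Nat.succ_pos _)).le) hD.devProb_nonneg
  have hle : ∀ b, -η ≤ D.devProb F i * D.s i b - D.schedLaw F i b := fun b => by
    have := hD.schedLaw_le hF b
    rw [mul_add] at this
    linarith
  have hsum : ∑ b, (D.devProb F i * D.s i b - D.schedLaw F i b) = 0 := by
    rw [Finset.sum_sub_distrib, ← Finset.mul_sum, (hD.s_mem i).2, hD.sum_schedLaw]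
    ring
  have hcard : 2 * cumWeight D.ε D.W 1 * Fintype.card (A i) * D.devProb F i =
      Fintype.card (A i) * η := by rw [hη]; ring
  have hone : (1 : ℝ) ≤ Fintype.card (A i) := by
    exact_mod_cast Fintype.card_pos_iff.2 ⟨a⟩
  rw [hcard, abs_le]
  refine ⟨?_, ?_⟩
  · nlinarith [hle a]
  · rw [← Finset.add_sum_erase _ _ (Finset.mem_univ a)] at hsum
    have : -(((Finset.univ.erase a).card : ℝ) * η) ≤
        ∑ b ∈ Finset.univ.erase a, (D.devProb F i * D.s i b - D.schedLaw F i b) := by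
      have := Finset.card_nsmul_le_sum (Finset.univ.erase a)
        (fun b => D.devProb F i * D.s i b - D.schedLaw F i b) (-η) fun b _ => hle b
      simpa [nsmul_eq_mul] using this
    have hc : ((Finset.univ.erase a).card : ℝ) ≤ Fintype.card (A i) := by
      exact_mod_cast Finset.card_le_univ _
    nlinarith

/-- The law of the actions of a punishing player. -/
theorem PunishData.Good.law_punisher (hD : D.Good) (hF : ∀ j a, MeasurableSet {r | F r j = a})
    {j : Fin n} (hj : ∀ᵐ r ∂seqLaw,
      (firstTime D.ε r < D.W → F r j = D.sched (firstTime D.ε r % D.W) (r 0) j) ∧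
      (D.W ≤ firstTime D.ε r → dropSeq (firstTime D.ε r % D.W + 1) r ∈ D.devSet F i →
        F r j = quantile (D.S i j (F (dropSeq D.W r) i)) (D.d j) (relPos D.ε (r 0))) ∧
      (dropSeq (firstTime D.ε r % D.W + 1) r ∉ D.devSet F i →
        F r j = D.sched (firstTime D.ε r % D.W) (r 0) j)) (b : A j) :
    seqLaw.real {r | F r j = b} = D.s j b - (1 - D.ε) ^ D.W * D.devProb F i * D.s j b +
      (1 - D.ε) ^ D.W * ∑ a, D.devLaw F i a * D.S i j a b := by
  obtain ⟨τ, hτ, hτE⟩ := hD.sched_law j b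
  have hBm : MeasurableSet (D.devEnd F i) := measurableSet_devEnd (hF i)
  have hW : D.W = D.w + 1 := rfl
  set Fl : ℕ → Set (ℕ → unitInterval) := fun p =>
    {r | p + 1 ≤ firstTime D.ε r ∧ dropSeq (p + 1) r ∈ D.devEnd F i} with hFl
  have hFlm : ∀ p, MeasurableSet (Fl p) := fun p =>
    (indepRelPos_le_firstTime hD.pos hD.lt_one hBm p).1
  have hFl_iff : ∀ p ≤ D.w, ∀ᵐ r ∂seqLaw, r ∈ Fl p ↔ (firstTime D.ε r % D.W = p ∧
      D.W ≤ firstTime D.ε r ∧ dropSeq (p + 1) r ∈ D.devSet F i) := by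
    intro p hp
    filter_upwards [ae_isTime hD.pos hD.lt_one.le] with r hr
    change (p + 1 ≤ firstTime D.ε r ∧ firstTime D.ε (dropSeq (p + 1) r) % D.W = D.w ∧
      dropSeq (p + 1) r ∈ D.devSet F i) ↔ _
    rw [← and_assoc, ← and_assoc]
    refine and_congr_left fun _ => ?_
    have hdiv := Nat.mod_add_div (firstTime D.ε r) D.W
    constructor
    · rintro ⟨h, h'⟩
      rw [firstTime_dropSeq hr h] at h'
      have h2 := Nat.mod_add_div (firstTime D.ε r - (p + 1)) D.W
      rw [h'] at h2
      have h3 : firstTime D.ε r = p + D.W * ((firstTime D.ε r - (p + 1)) / D.W + 1) := by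
        rw [Nat.mul_add, Nat.mul_one]
        omega
      constructor
      · rw [h3, Nat.add_mul_mod_self_left, Nat.mod_eq_of_lt (by omega)]
      · have : D.W ≤ D.W * ((firstTime D.ε r - (p + 1)) / D.W + 1) :=
          Nat.le_mul_of_pos_right _ (Nat.succ_pos _)
        omega
    · rintro ⟨h, h'⟩
      have hle : p + 1 ≤ firstTime D.ε r := by omega
      refine ⟨hle, ?_⟩
      rw [firstTime_dropSeq hr hle]
      have hk : D.W * (firstTime D.ε r / D.W) = D.W * (firstTime D.ε r / D.W - 1) + D.W := by
        rw [← Nat.mul_succ, Nat.succ_eq_add_one,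
          Nat.sub_add_cancel (Nat.div_pos h' (Nat.succ_pos _))]
      rw [show firstTime D.ε r - (p + 1) = D.w + D.W * (firstTime D.ε r / D.W - 1) by omega,
        Nat.add_mul_mod_self_left, Nat.mod_eq_of_lt (by omega)]
  have hterm : ∀ p ∈ Finset.range D.W,
      seqLaw.real ({r | F r j = b} ∩ {r | firstTime D.ε r % D.W = p}) =
      D.ℓ p * τ p - (1 - D.ε) ^ D.W * D.devProb F i * (D.ℓ p * τ p) + (1 - D.ε) ^ D.W *
        ∑ a, D.κ * D.ℓ p * seqLaw.real (D.devEnd F i ∩ {r | F (dropSeq (D.w - p) r) i = a}) *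
          D.S i j a b := by
    intro p hp
    have hp' : p ≤ D.w := Nat.lt_succ_iff.1 (Finset.mem_range.1 hp)
    set G : Set (ℕ → unitInterval) := {r | firstTime D.ε r % D.W = p} with hG
    set U : Set (ℕ → unitInterval) := {r | D.sched p (r 0) j = b} with hU
    have hUm : MeasurableSet U := D.measurableSet_sched _ _ _ _
    have hflprob : ∀ B : Set (ℕ → unitInterval), MeasurableSet B →
        seqLaw.real {r | p + 1 ≤ firstTime D.ε r ∧ dropSeq (p + 1) r ∈ B} =
          (1 - D.ε) ^ D.W * (D.κ * D.ℓ p) * seqLaw.real B := fun B hB => by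
      rw [seqLaw_le_firstTime hD.pos hD.lt_one.le hB, hD.pow_eq hp']
    have k1 : seqLaw.real (G ∩ U) = D.ℓ p * τ p := by
      rw [hτE p hp' _ (hD.indep_pos hp'), hD.real_pos hp']
    have k2 : seqLaw.real (Fl p ∩ U) = (1 - D.ε) ^ D.W * D.devProb F i * (D.ℓ p * τ p) := by
      rw [hτE p hp' _ (indepRelPos_le_firstTime hD.pos hD.lt_one hBm p), hflprob _ hBm, devProb]
      ring
    have k3 : seqLaw.real (Fl p ∩ {r | F r j = b}) = (1 - D.ε) ^ D.W *
        ∑ a, D.κ * D.ℓ p * seqLaw.real (D.devEnd F i ∩ {r | F (dropSeq (D.w - p) r) i = a}) *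
          D.S i j a b := by
      rw [seqLaw_real_eq_sum Finset.univ (fun r => F (dropSeq D.W r) i)
        (fun a _ => measurable_dropSeq _ (hF i a)) (fun _ _ => Finset.mem_univ _), Finset.mul_sum]
      refine Finset.sum_congr rfl fun a _ => ?_
      have hBa : MeasurableSet (D.devEnd F i ∩ {r | F (dropSeq (D.w - p) r) i = a}) :=
        hBm.inter (measurable_dropSeq _ (hF i a))
      obtain ⟨K, hK, hKE⟩ := quantile_law (hD.S_mem i j a) (D.d j) b hD.pos hD.lt_one
      have := hKE 0 1 le_rfl one_pos (by norm_num) _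
        (indepRelPos_le_firstTime hD.pos hD.lt_one hBa p)
      rw [zero_add, div_one, hK, hflprob _ hBa] at this
      refine Eq.trans ?_ (this.trans (by ring))
      refine measureReal_congr ?_
      filter_upwards [hj, hFl_iff p hp'] with r hr hfl
      have hdrop : dropSeq (D.w - p) (dropSeq (p + 1) r) = dropSeq D.W r := by
        rw [dropSeq_dropSeq]
        congr 1
        omega
      refine propext ?_
      change ((r ∈ Fl p ∧ F r j = b) ∧ F (dropSeq D.W r) i = a) ↔
        ((p + 1 ≤ firstTime D.ε r ∧ dropSeq (p + 1) r ∈ D.devEnd F i ∧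
          F (dropSeq (D.w - p) (dropSeq (p + 1) r)) i = a) ∧
          quantile (D.S i j a) (D.d j) (0 + 1 * relPos D.ε (r 0)) = b)
      rw [hdrop, zero_add, one_mul]
      have hq : r ∈ Fl p → F (dropSeq D.W r) i = a →
          F r j = quantile (D.S i j a) (D.d j) (relPos D.ε (r 0)) := by
        intro h h'
        obtain ⟨h1, h2, h3⟩ := hfl.1 h
        rw [← h']
        exact hr.2.1 h2 (by rw [h1]; exact h3)
      constructor
      · rintro ⟨⟨h, h'⟩, h''⟩
        exact ⟨⟨h.1, h.2, h''⟩, by rw [← hq h h'', h']⟩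
      · rintro ⟨⟨h, h', h''⟩, h3⟩
        exact ⟨⟨⟨h, h'⟩, by rw [hq ⟨h, h'⟩ h'', h3]⟩, h''⟩
    have s1 := measureReal_inter_add_sdiff (μ := seqLaw) (s := {r | F r j = b} ∩ G) (hFlm p)
    have s2 := measureReal_inter_add_sdiff (μ := seqLaw) (s := G ∩ U) (hFlm p)
    have e1 : seqLaw.real ({r | F r j = b} ∩ G ∩ Fl p) = seqLaw.real (Fl p ∩ {r | F r j = b}) := by
      refine measureReal_congr ?_
      filter_upwards [hFl_iff p hp'] with r hfl
      refine propext ⟨fun h => ⟨h.2, h.1.1⟩, fun h => ⟨⟨h.2, (hfl.1 h.1).1⟩, h.1⟩⟩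
    have e2 : seqLaw.real (G ∩ U ∩ Fl p) = seqLaw.real (Fl p ∩ U) := by
      refine measureReal_congr ?_
      filter_upwards [hFl_iff p hp'] with r hfl
      refine propext ⟨fun h => ⟨h.2, h.1.2⟩, fun h => ⟨⟨(hfl.1 h.1).1, h.2⟩, h.1⟩⟩
    have e3 : seqLaw.real (({r | F r j = b} ∩ G) \ Fl p) = seqLaw.real ((G ∩ U) \ Fl p) := by
      refine measureReal_congr ?_
      filter_upwards [hj, hFl_iff p hp'] with r hr hfl
      refine propext ?_
      change ((F r j = b ∧ firstTime D.ε r % D.W = p) ∧ r ∉ Fl p) ↔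
        ((firstTime D.ε r % D.W = p ∧ D.sched p (r 0) j = b) ∧ r ∉ Fl p)
      refine and_congr_left fun hnf => ?_
      have hs : firstTime D.ε r % D.W = p → F r j = D.sched p (r 0) j := by
        intro h
        rw [hfl] at hnf
        rcases lt_or_ge (firstTime D.ε r) D.W with hlt | hge
        · rw [hr.1 hlt, h]
        · rw [hr.2.2 (by rw [h]; exact fun h' => hnf ⟨h, hge, h'⟩), h]
      constructor
      · rintro ⟨h, h'⟩
        exact ⟨h', by rw [← hs h', h]⟩
      · rintro ⟨h, h'⟩
        exact ⟨by rw [hs h, h'], h⟩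
    rw [e1, e3, k3] at s1
    rw [e2, k1, k2] at s2
    linarith
  rw [D.real_eq_sum_pos, Finset.sum_congr rfl hterm, Finset.sum_add_distrib,
    Finset.sum_sub_distrib, ← Finset.mul_sum, hτ, ← Finset.mul_sum]
  congr 2
  rw [Finset.sum_comm]
  refine Finset.sum_congr rfl fun a _ => ?_
  rw [devLaw, Finset.sum_mul]

end Law

/-! ## Expected utilities -/

section Game
variable {n : ℕ} {A : Fin n → Type*} [∀ j, Fintype (A j)]

theorem abs_prod_sub_prod_le {ι : Type*} (t : Finset ι) {x y : ι → ℝ} (hx : ∀ i ∈ t, |x i| ≤ 1)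
    (hy : ∀ i ∈ t, |y i| ≤ 1) :
    |∏ i ∈ t, x i - ∏ i ∈ t, y i| ≤ ∑ i ∈ t, |x i - y i| := by
  classical
  induction t using Finset.induction_on with
  | empty => simp
  | insert i t hi ih =>
    rw [Finset.prod_insert hi, Finset.prod_insert hi, Finset.sum_insert hi]
    have ih' := ih (fun j hj => hx j (Finset.mem_insert_of_mem hj))
      fun j hj => hy j (Finset.mem_insert_of_mem hj)
    have hx' : |∏ j ∈ t, x j| ≤ 1 := by
      rw [Finset.abs_prod]
      exact Finset.prod_le_one (fun _ _ => abs_nonneg _)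
        fun j hj => hx j (Finset.mem_insert_of_mem hj)
    calc |x i * ∏ j ∈ t, x j - y i * ∏ j ∈ t, y j|
        = |(x i - y i) * ∏ j ∈ t, x j + y i * (∏ j ∈ t, x j - ∏ j ∈ t, y j)| := by ring_nf
      _ ≤ |x i - y i| * |∏ j ∈ t, x j| + |y i| * |∏ j ∈ t, x j - ∏ j ∈ t, y j| := by
        rw [← abs_mul, ← abs_mul]
        exact abs_add_le _ _
      _ ≤ |x i - y i| * 1 + 1 * ∑ j ∈ t, |x j - y j| := by
        gcongr
        exact hy i (Finset.mem_insert_self _ _)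
      _ = _ := by ring

theorem mixedUtility_le_add (w : (∀ j, A j) → ℝ) {x y : ∀ j, A j → ℝ} {δ : ℝ}
    (hx : ∀ j b, |x j b| ≤ 1) (hy : ∀ j b, |y j b| ≤ 1) (h : ∀ j b, |x j b - y j b| ≤ δ) :
    mixedUtility w x ≤ mixedUtility w y + (∑ a, |w a|) * n * δ := by
  rw [mixedUtility, mixedUtility, Finset.sum_mul, Finset.sum_mul, ← Finset.sum_add_distrib]
  refine Finset.sum_le_sum fun a _ => ?_
  have h1 := abs_prod_sub_prod_le Finset.univ (x := fun j => x j (a j)) (y := fun j => y j (a j))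
    (fun j _ => hx j _) fun j _ => hy j _
  have h2 : ∑ j, |x j (a j) - y j (a j)| ≤ n * δ := by
    simpa using Finset.sum_le_card_nsmul Finset.univ (fun j => |x j (a j) - y j (a j)|) δ
      fun j _ => h j _
  have h3 : (∏ j, x j (a j) - ∏ j, y j (a j)) * w a ≤ n * δ * |w a| := by
    refine (le_abs_self _).trans ?_
    rw [abs_mul]
    exact mul_le_mul_of_nonneg_right (h1.trans h2) (abs_nonneg _)
  linarith

theorem continuous_mixedUtility {X : Type*} [TopologicalSpace X] (w : (∀ j, A j) → ℝ)
    {x : X → ∀ j, A j → ℝ} (hx : ∀ j b, Continuous fun z => x z j b) :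
    Continuous fun z => mixedUtility w (x z) :=
  continuous_finsetSum _ fun a _ =>
    (continuous_finsetProd _ fun j _ => hx j (a j)).mul continuous_const

theorem continuous_punishedProfile (s : ∀ j, stdSimplex ℝ (A j)) (i j : Fin n) (b : A j) :
    Continuous fun z : (∀ j : {j : Fin n // j ≠ i}, A i → stdSimplex ℝ (A j)) ×
      (Set.Icc (0 : ℝ) 1 × stdSimplex ℝ (A i)) =>
        punishedProfile s i z.1 z.2.1 z.2.2 j b := by
  have hs' : ∀ a, Continuous fun z : (∀ j : {j : Fin n // j ≠ i}, A i → stdSimplex ℝ (A j)) ×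
      (Set.Icc (0 : ℝ) 1 × stdSimplex ℝ (A i)) => z.2.2.1 a := fun a =>
    (continuous_apply a).comp (continuous_subtype_val.comp (continuous_snd.comp continuous_snd))
  have hq : Continuous fun z : (∀ j : {j : Fin n // j ≠ i}, A i → stdSimplex ℝ (A j)) ×
      (Set.Icc (0 : ℝ) 1 × stdSimplex ℝ (A i)) => (z.2.1 : ℝ) :=
    continuous_subtype_val.comp (continuous_fst.comp continuous_snd)
  unfold punishedProfile
  by_cases h : j = i
  · simp only [dif_pos h]
    exact ((continuous_const.sub hq).mul continuous_const).add (hq.mul (hs' _))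
  · simp only [dif_neg h]
    refine ((continuous_const.sub hq).mul continuous_const).add
      (hq.mul (continuous_finsetSum _ fun a _ => (hs' a).mul ?_))
    exact (continuous_apply b).comp (continuous_subtype_val.comp ((continuous_apply a).comp
      ((continuous_apply (⟨j, h⟩ : {j : Fin n // j ≠ i})).comp continuous_fst)))

/-- The minimum over the punishments is attained. -/
theorem exists_punishment (w : (∀ j, A j) → ℝ) (s : ∀ j, stdSimplex ℝ (A j)) (i : Fin n)
    {lam v : ℝ} (h : (⨅ S : ∀ j : {j : Fin n // j ≠ i}, A i → stdSimplex ℝ (A j),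
        ⨆ d : Set.Icc (0 : ℝ) 1 × stdSimplex ℝ (A i),
          (mixedUtility w (punishedProfile s i S d.1 d.2) + lam * (d.1 : ℝ))) ≤ v) :
    ∃ S : ∀ j : {j : Fin n // j ≠ i}, A i → stdSimplex ℝ (A j),
      ∀ q ∈ Set.Icc (0 : ℝ) 1, ∀ s' : stdSimplex ℝ (A i),
        mixedUtility w (punishedProfile s i S q s') + lam * q ≤ v := by
  have hcs : ∀ j, CompactSpace (stdSimplex ℝ (A j)) := fun j =>
    isCompact_iff_compactSpace.1 (isCompact_stdSimplex ℝ (A j))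
  set f : (∀ j : {j : Fin n // j ≠ i}, A i → stdSimplex ℝ (A j)) →
      Set.Icc (0 : ℝ) 1 × stdSimplex ℝ (A i) → ℝ := fun S d =>
    mixedUtility w (punishedProfile s i S d.1 d.2) + lam * (d.1 : ℝ) with hf
  have hcont : Continuous (Function.uncurry f) :=
    (continuous_mixedUtility w (continuous_punishedProfile s i)).add
      (continuous_const.mul (continuous_subtype_val.comp (continuous_fst.comp continuous_snd)))
  have hbdd : ∀ S, BddAbove (Set.range (f S)) := fun S =>
    (isCompact_range (hcont.comp (Continuous.prodMk_right S))).bddAbove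
  have hlsc : LowerSemicontinuous fun S => ⨆ d, f S d :=
    lowerSemicontinuous_ciSup hbdd fun d =>
      (hcont.comp (Continuous.prodMk_left d)).lowerSemicontinuous
  obtain ⟨S, -, hS⟩ := LowerSemicontinuousOn.exists_isMinOn
    (s := Set.univ) (f := fun S => ⨆ d, f S d) ⟨fun j _ => s j, Set.mem_univ _⟩ isCompact_univ
    (hlsc.lowerSemicontinuousOn Set.univ)
  have : Nonempty (∀ j : {j : Fin n // j ≠ i}, A i → stdSimplex ℝ (A j)) := ⟨S⟩
  refine ⟨S, fun q hq s' => ?_⟩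
  exact (le_ciSup (hbdd S) (⟨q, hq⟩, s')).trans ((le_ciInf fun S' => hS (Set.mem_univ S')).trans h)

/-- A small grounding probability and a long block. -/
theorem exists_cumWeight_le {η C : ℝ} (hη : 0 < η) (hC : 0 ≤ C) : ∃ (ε : ℝ) (w : ℕ), 0 < ε ∧ ε < 1 ∧
    1 - (1 - ε) ^ (w + 1) ≤ η ∧ C * cumWeight ε (w + 1) 1 ≤ η := by
  obtain ⟨w, hw⟩ := exists_nat_gt (2 * C / η)
  set t := min η (1 / 2) with ht
  have ht0 : 0 < t := lt_min hη (by norm_num)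
  have ht1 : t ≤ 1 / 2 := min_le_right _ _
  have hW : (0 : ℝ) < w + 1 := by positivity
  have hε : t / (w + 1) ≤ t := div_le_self ht0.le (by linarith [(Nat.cast_nonneg w : (0 : ℝ) ≤ w)])
  have hε0 : 0 < t / (w + 1) := by positivity
  have hmul : (w + 1) * (t / (w + 1)) = t := by field_simp
  refine ⟨t / (w + 1), w, hε0, by linarith, ?_, ?_⟩
  · have := one_add_mul_le_pow (a := -(t / (w + 1))) (by linarith) (w + 1)
    rw [← sub_eq_add_neg] at this
    push_cast at this
    have : t ≤ η := min_le_left _ _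
    nlinarith
  · set ρ := (1 - t / (w + 1)) ^ (w + 1) with hρ
    have h1 : ρ * (1 + t) ≤ 1 := by
      have hb := one_add_mul_le_pow (a := t / (w + 1)) (by linarith) (w + 1)
      push_cast at hb
      rw [hmul] at hb
      have hρ0 : 0 ≤ ρ := pow_nonneg (by linarith) _
      have h3 : ρ * (1 + t / (w + 1)) ^ (w + 1) ≤ 1 := by
        rw [hρ, ← mul_pow]
        exact pow_le_one₀ (by nlinarith) (by nlinarith)
      exact (mul_le_mul_of_nonneg_left hb hρ0).trans h3
    have h2 : t / 2 ≤ 1 - ρ := by nlinarith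
    have h4 : cumWeight (t / (w + 1)) (w + 1) 1 ≤ 2 / (w + 1) := by
      rw [cumWeight, pow_one, sub_sub_cancel, ← hρ, div_le_div_iff₀ (by linarith) hW,
        div_mul_cancel₀ _ hW.ne']
      linarith
    refine (mul_le_mul_of_nonneg_left h4 hC).trans ?_
    rw [div_lt_iff₀ hη] at hw
    rw [mul_div_assoc', div_le_iff₀ hW]
    nlinarith

end Game

/-! ## The program equilibrium -/

section Equilibrium
variable {n : ℕ} {A : Fin n → Type*} [∀ j, Fintype (A j)] {P : Fin n → Tm}

theorem programUtility_eq (u : Fin n → (∀ j, A j) → ℝ) (P : Fin n → Tm) (i : Fin n) :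
    programUtility u P i =
      mixedUtility (u i) fun j b => seqLaw.real {r | Plays P j r b} := by
  refine Finset.sum_congr rfl fun a _ => ?_
  congr 1
  have : {r : Fin n → ℕ → unitInterval | ∀ j, Plays P j (r j) (a j)} =
      Set.pi Set.univ fun j => {r | Plays P j r (a j)} := by
    ext r
    simp
  rw [outcomeProb, this, measureReal_def]
  change ((Measure.pi fun _ => seqLaw) _).toReal = _
  rw [Measure.pi_pi, ENNReal.toReal_prod]
  rfl

theorem haltAgainst_iff :
    HaltAgainst A P ↔ ∀ j, ∀ᵐ r ∂seqLaw, ∃ a : A j, Plays P j r a := by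
  have hm : ∀ j, MeasurableSet {r | ∃ a : A j, Plays P j r a} := fun j => by
    have : {r | ∃ a : A j, Plays P j r a} = ⋃ a : A j, {r | Plays P j r a} := by
      ext r
      simp
    rw [this]
    exact MeasurableSet.iUnion fun a => measurableSet_plays P j a
  have hp : ∀ j, MeasurePreserving (Function.eval j)
      (Measure.pi fun _ : Fin n => seqLaw) seqLaw := fun j =>
    measurePreserving_eval (fun _ : Fin n => seqLaw) j
  change (∀ᵐ r ∂(Measure.pi fun _ : Fin n => seqLaw), ∀ j, ∃ a : A j, Plays P j (r j) a) ↔ _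
  rw [ae_all_iff]
  refine forall_congr' fun j => ?_
  have h := ae_map_iff (μ := Measure.pi fun _ : Fin n => seqLaw)
    (hp j).measurable.aemeasurable (hm j)
  rw [(hp j).map_eq] at h
  exact h.symm

theorem measurableSet_played (d : ∀ j, A j) (P : Fin n → Tm) (j : Fin n) (b : A j) :
    MeasurableSet {r | played d P r j = b} := by
  have : {r | played d P r j = b} = {r | Plays P j r b} ∪
      ((⋃ a : A j, {r | Plays P j r a})ᶜ ∩ {_r : ℕ → unitInterval | d j = b}) := by
    ext r
    rw [Set.mem_union, Set.mem_inter_iff, Set.mem_compl_iff, Set.mem_iUnion]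
    change played d P r j = b ↔ Plays P j r b ∨ ((¬ ∃ a : A j, Plays P j r a) ∧ d j = b)
    by_cases h : ∃ a : A j, Plays P j r a
    · have h' := plays_played (d := d) h
      constructor
      · rintro rfl
        exact Or.inl h'
      · rintro (h'' | h'')
        · exact h''.played_eq
        · exact absurd h h''.1
    · have h' : played d P r j = d j := dif_neg h
      rw [h']
      exact ⟨fun h'' => Or.inr ⟨h, h''⟩, fun h'' => h''.elim (fun h₁ => absurd ⟨b, h₁⟩ h) And.right⟩
  rw [this]
  exact (measurableSet_plays P j b).union
    ((MeasurableSet.iUnion fun a => measurableSet_plays P j a).compl.inter (.const _))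

theorem seqLaw_plays {j : Fin n} (d : ∀ j, A j) (h : ∀ᵐ r ∂seqLaw, ∃ a : A j, Plays P j r a)
    (b : A j) : seqLaw.real {r | Plays P j r b} = seqLaw.real {r | played d P r j = b} := by
  refine measureReal_congr ?_
  filter_upwards [h] with r hr
  refine propext ⟨fun h' => Plays.played_eq h', fun h' => ?_⟩
  change Plays P j r b
  rw [← (show played d P r j = b from h')]
  exact plays_played hr

variable {D : PunishData A} {c : Fin n → Tm}

/-- If everyone complies, then what is scheduled is played. -/
theorem played_eq_sched (hc : ∀ j, Computes (c j) (D.policy j))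
    (hP : ∀ j, P j = groundedBot n D.ε (c j)) {r : ℕ → unitInterval} {T : ℕ}
    (hT : IsTime D.ε r T) : played D.d P r = D.sched (T % D.W) (r 0) := by
  induction T using Nat.strong_induction_on generalizing r with
  | _ T ih =>
    funext j
    have h := played_eq_out hc (fun k => Or.inr (hP k)) hT (hP j) (Nat.zero_le T)
    obtain ⟨h₁, -, -, -, h₅, -⟩ := D.stateOf_spec T (fun l => played D.d P (dropSeq l r))
      fun l => r l
    have hnone := h₅.2 fun m hm hm' => by
      rw [ih (T - m) (by omega) (hT.drop hm')]
      simp [dropSeq]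
    change played D.d P r j = D.out j (D.stateOf T (fun l => played D.d P (dropSeq l r))
      fun l => r l) (r 0) at h
    rw [h, PunishData.out, hnone, h₁]

theorem PunishData.Good.law_compliant (hD : D.Good) (hc : ∀ j, Computes (c j) (D.policy j))
    (hP : ∀ j, P j = groundedBot n D.ε (c j)) (j : Fin n) (b : A j) :
    seqLaw.real {r | played D.d P r j = b} = D.s j b := by
  rw [D.real_eq_sum_pos, ← hD.sched_total j b]
  refine Finset.sum_congr rfl fun p _ => measureReal_congr ?_
  filter_upwards [ae_isTime hD.pos hD.lt_one.le] with r hr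
  refine propext ?_
  change (played D.d P r j = b ∧ firstTime D.ε r % D.W = p) ↔
    (firstTime D.ε r % D.W = p ∧ D.sched p (r 0) j = b)
  rw [played_eq_sched hc hP hr, and_comm]
  exact and_congr_right fun h => by rw [h]

section Deviation
variable {i : Fin n}

theorem ae_plays_drop (hP : ∀ j ≠ i, P j = groundedBot n D.ε (c j))
    (hi : ∀ᵐ r ∂seqLaw, ∃ a : A i, Plays P i r a) : ∀ᵐ r ∂seqLaw, ∀ j,
    (∀ m, ∃ a : A j, Plays P j (dropSeq m r) a) ∨ P j = groundedBot n D.ε (c j) := by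
  have : ∀ᵐ r ∂seqLaw, ∀ m, ∃ a : A i, Plays P i (dropSeq m r) a :=
    ae_all_iff.2 fun m => (measurePreserving_dropSeq m).quasiMeasurePreserving.ae hi
  filter_upwards [this] with r hr j
  by_cases h : j = i
  · subst h
    exact Or.inl hr
  · exact Or.inr (hP j h)

/-- What a player other than the deviating one plays. -/
theorem ae_played_punisher (hD : D.Good) (hc : ∀ j, Computes (c j) (D.policy j))
    (hP : ∀ j ≠ i, P j = groundedBot n D.ε (c j))
    (hi : ∀ᵐ r ∂seqLaw, ∃ a : A i, Plays P i r a) {j : Fin n} (hj : j ≠ i) :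
    ∀ᵐ r ∂seqLaw,
      (firstTime D.ε r < D.W →
        played D.d P r j = D.sched (firstTime D.ε r % D.W) (r 0) j) ∧
      (D.W ≤ firstTime D.ε r →
        dropSeq (firstTime D.ε r % D.W + 1) r ∈ D.devSet (played D.d P) i →
        played D.d P r j =
          quantile (D.S i j (played D.d P (dropSeq D.W r) i)) (D.d j) (relPos D.ε (r 0))) ∧
      (dropSeq (firstTime D.ε r % D.W + 1) r ∉ D.devSet (played D.d P) i →
        played D.d P r j = D.sched (firstTime D.ε r % D.W) (r 0) j) := by
  filter_upwards [ae_plays_drop hP hi, ae_isTime hD.pos hD.lt_one.le] with r hr hT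
  have h := D.out_stateOf (T := firstTime D.ε r) (act := fun m => played D.d P (dropSeq m r))
    (x := fun m => r m) (i := i)
    (fun m hm k hk => played_eq_out hc hr hT (hP k hk) hm) hj
  have hdev : dropSeq (firstTime D.ε r % D.W + 1) r ∈ D.devSet (played D.d P) i ↔
      ∃ q < D.W, played D.d P (dropSeq (firstTime D.ε r % D.W + 1 + q) r) i ≠
        D.sched (D.w - q) (r (firstTime D.ε r % D.W + 1 + q)) i := by
    refine exists_congr fun q => and_congr_right fun _ => ?_
    rw [dropSeq_dropSeq, add_comm q]
    simp only [dropSeq]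
    rw [add_comm q]
  rw [hdev]
  refine ⟨h.1, h.2.1, fun h' => h.2.2 fun q hq => ?_⟩
  by_contra hne
  exact h' ⟨q, hq, hne⟩

end Deviation

/-- A deviation does not pay. -/
theorem PunishData.Good.mixedUtility_le (hD : D.Good) {F : (ℕ → unitInterval) → ∀ j, A j}
    {i : Fin n} (hF : ∀ a, MeasurableSet {r | F r i = a}) (w : (∀ j, A j) → ℝ)
    (s : ∀ j, stdSimplex ℝ (A j)) (hs : ∀ j, D.s j = (s j).1)
    (S : ∀ j : {j : Fin n // j ≠ i}, A i → stdSimplex ℝ (A j))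
    (hS : ∀ j (h : j ≠ i) a, D.S i j a = (S ⟨j, h⟩ a).1) {δ lam v : ℝ}
    (hδ₁ : 1 - (1 - D.ε) ^ D.W ≤ δ) (hδ₂ : 2 * cumWeight D.ε D.W 1 * Fintype.card (A i) ≤ δ)
    (hlam : (∑ a, |w a|) * n * δ ≤ lam)
    (hv : ∀ q ∈ Set.Icc (0 : ℝ) 1, ∀ s' : stdSimplex ℝ (A i),
        mixedUtility w (punishedProfile s i S q s') + lam * q ≤ v)
    (hpun : ∀ j ≠ i, ∀ b, seqLaw.real {r | F r j = b} =
      D.s j b - (1 - D.ε) ^ D.W * D.devProb F i * D.s j b +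
        (1 - D.ε) ^ D.W * ∑ a, D.devLaw F i a * D.S i j a b) :
    mixedUtility w (fun j b => seqLaw.real {r | F r j = b}) ≤ v := by
  have hq0 : 0 ≤ D.devProb F i := hD.devProb_nonneg
  have hq1 : D.devProb F i ≤ 1 := hD.devProb_le_one
  obtain ⟨s', hs'⟩ : ∃ s' : stdSimplex ℝ (A i), ∀ a, D.devLaw F i a = D.devProb F i * s'.1 a := by
    rcases hq0.eq_or_lt with h | h
    · refine ⟨s i, fun a => ?_⟩
      have hsum := hD.sum_devLaw hF
      rw [← h, Finset.sum_eq_zero_iff_of_nonneg fun a _ => hD.devLaw_nonneg a] at hsum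
      rw [hsum a (Finset.mem_univ a), ← h, zero_mul]
    · refine ⟨⟨fun a => D.devLaw F i a / D.devProb F i,
        fun a => div_nonneg (hD.devLaw_nonneg a) h.le, ?_⟩, fun a => ?_⟩
      · rw [← Finset.sum_div, hD.sum_devLaw hF, div_self h.ne']
      · change _ = _ * (_ / _)
        field_simp
  set q := D.devProb F i with hq
  have hbound : ∀ {α : Type _} [Fintype α] (σ : stdSimplex ℝ α) (a : α), 0 ≤ σ.1 a ∧ σ.1 a ≤ 1 :=
    fun σ a => ⟨σ.2.1 a, by
      rw [← σ.2.2]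
      exact Finset.single_le_sum (fun b _ => σ.2.1 b) (Finset.mem_univ a)⟩
  have hmix : ∀ (j : Fin n) (h : j ≠ i) (b : A j), 0 ≤ ∑ a, s'.1 a * (S ⟨j, h⟩ a).1 b ∧
      ∑ a, s'.1 a * (S ⟨j, h⟩ a).1 b ≤ 1 := fun j h b => by
    refine ⟨Finset.sum_nonneg fun a _ => mul_nonneg (s'.2.1 a) ((S ⟨j, h⟩ a).2.1 b), ?_⟩
    rw [← s'.2.2]
    refine Finset.sum_le_sum fun a _ => mul_le_of_le_one_right (s'.2.1 a) ?_
    rw [← (S ⟨j, h⟩ a).2.2]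
    exact Finset.single_le_sum (fun b _ => (S ⟨j, h⟩ a).2.1 b) (Finset.mem_univ b)
  have hρ1 : (1 - D.ε) ^ D.W ≤ 1 :=
    pow_le_one₀ (by linarith [hD.lt_one]) (by linarith [hD.pos])
  have key := mixedUtility_le_add w (x := fun j b => seqLaw.real {r | F r j = b})
    (y := punishedProfile s i S q s') (δ := δ * q)
    (fun j b => by rw [abs_of_nonneg measureReal_nonneg]; exact measureReal_le_one)
    (fun j b => by
      unfold punishedProfile
      have hsb := hbound (s j) b
      by_cases h : j = i
      · subst h
        have := hbound s' b
        simp only [dif_pos]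
        rw [abs_le]
        constructor <;> nlinarith
      · have := hmix j h b
        simp only [dif_neg h]
        rw [abs_le]
        constructor <;> nlinarith)
    (fun j b => by
      unfold punishedProfile
      by_cases h : j = i
      · subst h
        simp only [dif_pos]
        rw [hD.law_deviator hF, hs', ← hs]
        have := (hD.abs_sub_schedLaw_le hF b).trans (mul_le_mul_of_nonneg_right hδ₂ hq0)
        rw [← hq] at this
        refine le_trans (le_of_eq ?_) this
        congr 1
        ring
      · simp only [dif_neg h]
        have hsb := hbound (s j) b
        have hm := hmix j h b
        have hsum : ∑ a, D.devLaw F i a * D.S i j a b = q * ∑ a, s'.1 a * (S ⟨j, h⟩ a).1 b := by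
          rw [Finset.mul_sum]
          refine Finset.sum_congr rfl fun a _ => ?_
          rw [hs', hS j h, mul_assoc]
        rw [hpun j h b, hsum, hs]
        set z := ∑ a, s'.1 a * (S ⟨j, h⟩ a).1 b
        have e : (s j).1 b - (1 - D.ε) ^ D.W * q * (s j).1 b + (1 - D.ε) ^ D.W * (q * z) -
            ((1 - q) * (s j).1 b + q * z) = (1 - (1 - D.ε) ^ D.W) * q * ((s j).1 b - z) := by
          ring
        rw [e, abs_mul, abs_mul, abs_of_nonneg hq0, abs_of_nonneg (by linarith)]
        have : |(s j).1 b - z| ≤ 1 := by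
          rw [abs_le]
          constructor <;> linarith
        calc (1 - (1 - D.ε) ^ D.W) * q * |(s j).1 b - z|
            ≤ (1 - (1 - D.ε) ^ D.W) * q * 1 :=
              mul_le_mul_of_nonneg_left this (mul_nonneg (by linarith) hq0)
          _ ≤ δ * q := by
            rw [mul_one]
            exact mul_le_mul_of_nonneg_right hδ₁ hq0)
  have := hv q ⟨hq0, hq1⟩ s'
  have h2 := mul_le_mul_of_nonneg_right hlam hq0
  rw [mul_assoc] at h2
  linarith

end Equilibrium

theorem mainTheorem5 {n : ℕ} {A : Fin n → Type*} [∀ j, Fintype (A j)]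
    (u : Fin n → (∀ j, A j) → ℝ) (v : Fin n → ℝ) (s : ∀ j, stdSimplex ℝ (A j))
    (hv : ∀ i, v i = mixedUtility (u i) (fun j => (s j).1))
    (hpunish : ∀ i, ∃ lam : ℝ, 0 < lam ∧
      v i ≥ (⨅ S : ∀ j : {j : Fin n // j ≠ i}, A i → stdSimplex ℝ (A j),
        ⨆ d : Set.Icc (0 : ℝ) 1 × stdSimplex ℝ (A i),
          (mixedUtility (u i) (punishedProfile s i S d.1 d.2) + lam * (d.1 : ℝ)))) :
    ∃ (ε : ℝ) (π : ∀ i, Policy A i) (c : Fin n → Tm),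
      0 < ε ∧ ε < 1 ∧ (∀ i, Computes (c i) (π i)) ∧
      IsProgramEquilibrium u (fun i => groundedBot n ε (c i)) ∧
      ∀ i, programUtility u (fun i => groundedBot n ε (c i)) i = v i := by
  classical
  choose lam hlam hle using hpunish
  choose S hS using fun i => exists_punishment (u i) s i (hle i)
  have hd : ∀ j, Nonempty (A j) := fun j => by
    by_contra h
    rw [not_nonempty_iff] at h
    have := (s j).2.2
    simp at this
  obtain ⟨η, hη, hηl⟩ : ∃ η : ℝ, 0 < η ∧ ∀ i, (∑ a, |u i a|) * n * η ≤ lam i := by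
    have h0 : ∀ i, ∀ᶠ η : ℝ in nhdsWithin 0 (Set.Ioi 0), (∑ a, |u i a|) * n * η ≤ lam i := by
      intro i
      have hc : Filter.Tendsto (fun η : ℝ => (∑ a, |u i a|) * n * η) (nhdsWithin 0 (Set.Ioi 0))
          (nhds ((∑ a, |u i a|) * n * 0)) :=
        ((continuous_const.mul continuous_id).tendsto 0).mono_left nhdsWithin_le_nhds
      rw [mul_zero] at hc
      exact (hc.eventually (gt_mem_nhds (hlam i))).mono fun _ h => le_of_lt h
    obtain ⟨η, h1, h2⟩ := ((Filter.eventually_all.2 h0).and self_mem_nhdsWithin).exists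
    exact ⟨η, h2, h1⟩
  obtain ⟨ε, w, hε₀, hε₁, hε₂, hε₃⟩ := exists_cumWeight_le hη
    (C := ∑ i, 2 * (Fintype.card (A i) : ℝ)) (by positivity)
  let D : PunishData A :=
    { ε := ε
      w := w
      s := fun j => (s j).1
      S := fun i j a => if h : j ≠ i then (S i ⟨j, h⟩ a).1 else (s j).1
      d := fun j => (hd j).some }
  have hD : D.Good := ⟨hε₀, hε₁, fun j => (s j).2, fun i j a => by
    change (if h : j ≠ i then (S i ⟨j, h⟩ a).1 else (s j).1) ∈ _
    split_ifs with h
    · exact (S i ⟨j, h⟩ a).2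
    · exact (s j).2⟩
  choose c hc using D.exists_computes
  have hP : ∀ j, (fun i => groundedBot n ε (c i)) j = groundedBot n D.ε (c j) := fun _ => rfl
  have hhalt : ∀ j, ∀ᵐ r ∂seqLaw, ∃ a : A j, Plays (fun i => groundedBot n ε (c i)) j r a := by
    intro j
    filter_upwards [ae_isTime hε₀ hε₁.le] with r hT
    exact plays_of_isTime hc (fun k => Or.inr (hP k)) hT j
  have hval : ∀ i, programUtility u (fun i => groundedBot n ε (c i)) i = v i := fun i => by
    rw [programUtility_eq, hv]
    congr 1
    funext j b
    rw [seqLaw_plays D.d (hhalt j), hD.law_compliant hc hP]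
  refine ⟨ε, D.policy, c, hε₀, hε₁, hc, ⟨haltAgainst_iff.2 hhalt, fun i p' hp' => ?_⟩, hval⟩
  rw [hval, programUtility_eq]
  set P := Function.update (fun i => groundedBot n ε (c i)) i p' with hPdef
  have hPj : ∀ j ≠ i, P j = groundedBot n D.ε (c j) := fun j hj => Function.update_of_ne hj _ _
  have hi := haltAgainst_iff.1 hp' i
  have hlaw : (fun j b => seqLaw.real {r | Plays P j r b}) =
      fun j b => seqLaw.real {r | played D.d P r j = b} := by
    funext j b
    exact seqLaw_plays D.d (haltAgainst_iff.1 hp' j) b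
  have hcw := cumWeight_one_pos hε₀ hε₁ (Nat.succ_pos w)
  rw [hlaw]
  refine hD.mixedUtility_le (measurableSet_played D.d P i) (u i) s (fun _ => rfl) (S i)
    (fun j h a => dif_pos h) hε₂ ?_ (hηl i) (hS i)
    fun j hj b => hD.law_punisher (measurableSet_played D.d P) (ae_played_punisher hD hc hPj hi hj) b
  refine le_trans ?_ hε₃
  have : 2 * (Fintype.card (A i) : ℝ) ≤ ∑ i, 2 * (Fintype.card (A i) : ℝ) :=
    Finset.single_le_sum (f := fun i => 2 * (Fintype.card (A i) : ℝ)) (fun _ _ => by positivity)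
      (Finset.mem_univ i)
  have h2 := mul_le_mul_of_nonneg_right this hcw.le
  refine le_trans (le_of_eq ?_) h2
  change 2 * cumWeight ε (w + 1) 1 * (Fintype.card (A i) : ℝ) = _
  ring
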